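/- **Setting.** Let $1\le r<p$, $n\ge 1$, $h=1/n$, and let $\mathcal S(p,r,h)$ be the spline space of degree $p$ and regularity $r$ on the uniform mesh of size $h$ of $[0,1]$ (open knot vector, interior knots of multiplicity $p-r$), with B-splines $b_1,\dots,b_N$. Let $b^+_1,\dots,b^+_{N_+}$ and $b^-_1,\dots,b^-_{N_-}$ be the B-splines of $\mathcal S(p,p-1,h)$ and $\mathcal S(p-1,p-2,h)$, so $N_+=p+n$, $N_-=p+n-1$, and assume $N_+\ge 6$. Let $\Omega\subset\mathbb R^2$ be a bounded open multi-patch domain, $\overline\Omega=\bigcup_{k=1}^K F^{(k)}([0,1]^2)$, with non-overlapping patches $\Omega^{(k)}=F^{(k)}((0,1)^2)\subseteq\Omega$, no hanging nodes, and injective $F^{(k)}\in(\mathcal S(p,r,h)\otimes\mathcal S(p,r,h))^2$ with $\det\nabla F^{(k)}\ge c>0$. Each patch edge either lies in $\partial\Omega$ and is not shared with another patch (boundary edge $(k,s)$), or does not lie in $\partial\Omega$ and is shared with exactly one other patch; an interface $\kappa$ is a pair of coinciding edges $(k,s_k),(l,s_l)$, $k<l$, along which the two parametrizations agree up to the identity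 or the reflection $\rho_\kappa$ of the edge parameter. **Gluing data.** For an edge with tangential parameter $t\in[0,1]$ and inward transversal parameter $d\in[0,1]$ ($d=0$ on the edge) put $\alpha=|\det(\partial_dF,\partial_tF)|$ and $\beta=\partial_dF\cdot\partial_tF/\|\partial_tF\|^2$ on the edge. Let $P_h$ be any projection (with values in $\mathcal S(\tilde p,\tilde r,h)$ and equal to the identity there), $0\le\tilde r<\tilde p$. On non-boundary edges $\tilde\alpha=P_h\alpha$, $\tilde\beta=P_h\beta$, and $\tilde\alpha$ is assumed to have no zero on $[0,1]$; on boundary edges $\tilde\alpha=1$, $\tilde\beta=0$. The approximate outward normal is $\tilde n=-\tilde\alpha^{-1}\partial_dF+\tilde\alpha^{-1}\tilde\beta\,\partial_tF$. **Local functions** (on $[0,1]^2$). For an edge $s$ of patch $k$, $$f_s^{(k)}[b^+,b^-](d,t)=b^+(t)\,(b_1(d)+b_2(d))+\bigl(\tilde\alpha(t)b^-(t)+\tilde\beta(t)(b^+)'(t)\bigr)\tfrac hp\,b_2(d).$$ - Interior space $\widehat{\mathcal A}_\circ^{(k)}$: span of $b_i(u)b_j(v)$, $3\le i,j\le N-2$.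 - Edge space $\widehat{\mathcal A}_{E,s}^{(k)}$: span of $f_s^{(k)}[b_j^+,0]$, $4\le j\le N_+-3$, and $f_s^{(k)}[0,b_j^-]$, $3\le j\le N_--2$. - Vertex space $\widehat{\mathcal A}_{V,s}^{(k)}$: number B-splines starting at the vertex, and let $u,v$ be the coordinates measured from it. Each of three spans contains a unique function with prescribed physical value, gradient and Hessian $\Phi$ at the vertex: the span of $f_e[b^+_1,0],f_e[b^+_2,0],f_e[b^+_3,0],f_e[0,b^-_1],f_e[0,b^-_2]$ and $b_1(u)b_3(v)$, with $e$ the adjacent edge $v=0$; the analogous span for the adjacent edge $u=0$ with $b_3(u)b_1(v)$; and the span of $b_i(u)b_j(v)$, $i+j\le4$. Let $g_s^{(k)}[\Phi]$ be the sum of the first two interpolants minus the third. With $\Phi_1,\dots,\Phi_6$ the unit data (value, two first and three second derivatives), $\widehat{\mathcal A}_{V,s}^{(k)}$ is the span of $g_s^{(k)}[\Phi_1],\dots,g_s^{(k)}[\Phi_6]$. **Global spaces.** In $C^0(\overline\Omega)$ define: - $\mathcal A_\circ^{(k)}$: all $\varphi$ with $\varphi\circ F^{(k)}\in\widehat{\mathcal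 A}_\circ^{(k)}$ that vanish on all other patches; - $\mathcal A_{I_\kappa}$: all $\varphi$ with $\varphi\circ F^{(k)}\in\widehat{\mathcal A}_{E,s_k}^{(k)}$, $\varphi\circ F^{(l)}\in\widehat{\mathcal A}_{E,s_l}^{(l)}$, vanishing on all other patches, with $\partial_{\tilde n_k}\varphi=-\partial_{\tilde n_l}\varphi$ on the interface; - $\mathcal A_{V_\iota}$ for each vertex $V_\iota$: all $\varphi$ whose pull-back to every patch with vertex $V_\iota$ lies in the corresponding vertex space, vanishing on all other patches, and $C^2$ at $V_\iota$ (value, gradient and Hessian at $V_\iota$ agree on all these patches); - $\mathcal A_{B_\sigma}$ for each boundary edge $\sigma=(k,s)$: all $\varphi$ with $\varphi\circ F^{(k)}\in\widehat{\mathcal A}_{E,s}^{(k)}$ that vanish on all other patches. Let $\widetilde{\mathcal V}_h$ be the sum of all these spaces. **Lemma.** All these sets are linear subspaces, and $\widetilde{\mathcal V}_h$ is their direct sum. A basis of each of them is formed by the following functions of $C^0(\overline\Omega)$, which exist, where pull-backs to patches that are not mentioned are $0$: - for $\mathcal A_\circ^{(k)}$: $\varphi\circ F^{(k)}=b_i(u)b_j(v)$,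 $3\le i,j\le N-2$; - for $\mathcal A_{I_\kappa}$: $\varphi\circ F^{(k)}=f^{(k)}_{s_k}[b^+,b^-]$ and $\varphi\circ F^{(l)}=f^{(l)}_{s_l}[b^+\circ\rho_\kappa,-b^-\circ\rho_\kappa]$, for $(b^+,b^-)=(b_j^+,0)$, $4\le j\le N_+-3$, and $(0,b_j^-)$, $3\le j\le N_--2$; - for $\mathcal A_{V_\iota}$: $\varphi\circ F^{(k)}=g_s^{(k)}[\Phi_i]$ on every patch $k$ whose vertex $s$ is $V_\iota$, for $i=1,\dots,6$; - for $\mathcal A_{B_\sigma}$: $\varphi\circ F^{(k)}=f_s^{(k)}[b_j^+,0]$, $4\le j\le N_+-3$, and $f_s^{(k)}[0,b_j^-]$, $3\le j\le N_--2$. Together these functions form a basis of $\widetilde{\mathcal V}_h$. -/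

import Mathlib

open Set

noncomputable section

namespace ApproxC1

/-! ## Univariate B-splines -/

/-- Uniform open knot vector, numbered from `0`: the knot `0` is repeated `p + 1` times, each
interior knot `i / n` is repeated `p - r` times, and all further knots are `1`. -/
def knot (p r n i : ℕ) : ℝ :=
  if i ≤ p then 0 else ((min n ((i - p - 1) / (p - r) + 1) : ℕ) : ℝ) / n

open Classical in
/-- Cox–de Boor recursion for the knots `ξ` (quotients with denominator `0` are `0`). The last
nonempty knot interval of `[0, 1]` is closed on the right, the others are half-open. -/
def coxDeBoor (ξ : ℕ → ℝ) : ℕ → ℕ → ℝ → ℝ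
  | 0, i, x => if (ξ i ≤ x ∧ x < ξ (i + 1)) ∨ (x = 1 ∧ ξ i < 1 ∧ ξ (i + 1) = 1) then 1 else 0
  | q + 1, i, x =>
      (x - ξ i) / (ξ (i + q + 1) - ξ i) * coxDeBoor ξ q i x
        + (ξ (i + q + 2) - x) / (ξ (i + q + 2) - ξ (i + 1)) * coxDeBoor ξ q (i + 1) x

/-- Number of B-splines of degree `p` and regularity `r` on the uniform mesh of size `1 / n`. -/
def splineDim (p r n : ℕ) : ℕ := p + 1 + (p - r) * (n - 1)

/-- The B-splines of degree `p`, regularity `r`, mesh size `1 / n`, numbered from `0` to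
`splineDim p r n - 1`. -/
def bspline (p r n i : ℕ) : ℝ → ℝ := coxDeBoor (knot p r n) p i

/-- The spline space `S(p, r, 1 / n)`. -/
def splineSpace (p r n : ℕ) : Submodule ℝ (ℝ → ℝ) :=
  Submodule.span ℝ {w | ∃ i < splineDim p r n, w = bspline p r n i}

/-- Tensor-product B-splines. -/
def tensorBspline (p r n i j : ℕ) : ℝ × ℝ → ℝ :=
  fun x => bspline p r n i x.1 * bspline p r n j x.2

/-- The bivariate spline space `S(p, r, 1 / n) ⊗ S(p, r, 1 / n)`. -/
def tensorSplineSpace (p r n : ℕ) : Submodule ℝ (ℝ × ℝ → ℝ) :=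
  Submodule.span ℝ
    {w | ∃ i < splineDim p r n, ∃ j < splineDim p r n, w = tensorBspline p r n i j}

/-- `P` is a projection (not assumed linear) onto the space `S`. -/
def IsProjectionOnto (S : Submodule ℝ (ℝ → ℝ)) (P : (ℝ → ℝ) → ℝ → ℝ) : Prop :=
  (∀ w, P w ∈ S) ∧ ∀ w ∈ S, P w = w

/-! ## The parameter square -/

abbrev Plane := EuclideanSpace ℝ (Fin 2)

/-- The closed parameter square. -/
def square : Set (ℝ × ℝ) := Icc 0 1 ×ˢ Icc 0 1

/-- The open parameter square. -/
def openSquare : Set (ℝ × ℝ) := Ioo 0 1 ×ˢ Ioo 0 1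

/-- The four edges `v = 0`, `u = 1`, `v = 1`, `u = 0` of the square. -/
inductive Edge
  | bottom
  | right
  | top
  | left

/-- The four vertices of the square; `true` stands for the coordinate `1`. -/
abbrev Corner := Bool × Bool

/-- The reflection of `[0, 1]` if `e` is `true`, the identity otherwise. -/
def mirror (e : Bool) (x : ℝ) : ℝ := if e then 1 - x else x

/-- The point of the square with distance `d` from the edge and tangential parameter `t`. -/
def Edge.frame : Edge → ℝ → ℝ → ℝ × ℝ
  | .bottom, d, t => (t, d)
  | .right, d, t => (1 - d, t)
  | .top, d, t => (t, 1 - d)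
  | .left, d, t => (d, t)

/-- Distance of a point of the square from the edge. -/
def Edge.dist : Edge → ℝ × ℝ → ℝ
  | .bottom, x => x.2
  | .right, x => 1 - x.1
  | .top, x => 1 - x.2
  | .left, x => x.1

/-- Tangential parameter of a point of the square with respect to the edge. -/
def Edge.param : Edge → ℝ × ℝ → ℝ
  | .bottom, x => x.1
  | .right, x => x.2
  | .top, x => x.1
  | .left, x => x.2

/-- The vertex as a point of the square. -/
def Corner.pt (c : Corner) : ℝ × ℝ := (mirror c.1 0, mirror c.2 0)

/-- The horizontal edge at a vertex. -/
def Corner.hEdge (c : Corner) : Edge := if c.2 then .top else .bottom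

/-- The vertical edge at a vertex. -/
def Corner.vEdge (c : Corner) : Edge := if c.1 then .right else .left

section Derivatives

variable {X : Type*} [NormedAddCommGroup X] [NormedSpace ℝ X]

/-- Partial derivative in `u` on the closed square (one-sided at the boundary). -/
def dU (g : ℝ × ℝ → X) (x : ℝ × ℝ) : X := derivWithin (fun u => g (u, x.2)) (Icc 0 1) x.1

/-- Partial derivative in `v` on the closed square (one-sided at the boundary). -/
def dV (g : ℝ × ℝ → X) (x : ℝ × ℝ) : X := derivWithin (fun v => g (x.1, v)) (Icc 0 1) x.2

/-- Transversal (inward) derivative at the point with parameter `t` of an edge. -/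
def dTrans (s : Edge) (g : ℝ × ℝ → X) (t : ℝ) : X :=
  derivWithin (fun d => g (s.frame d t)) (Icc 0 1) 0

/-- Tangential derivative at the point with parameter `t` of an edge. -/
def dTang (s : Edge) (g : ℝ × ℝ → X) (t : ℝ) : X :=
  derivWithin (fun τ => g (s.frame 0 τ)) (Icc 0 1) t

end Derivatives

def det2 (a b : Plane) : ℝ := a 0 * b 1 - a 1 * b 0

/-- The open edge of the patch with parametrization `F`. -/
def edgeSet (F : ℝ × ℝ → Plane) (s : Edge) : Set Plane := (fun t => F (s.frame 0 t)) '' Ioo 0 1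

/-! ## Multi-patch domains -/

/-- A planar multi-patch domain with `K` spline patches, conforming and without hanging nodes. -/
structure MultiPatch (p r n K : ℕ) where
  /-- the domain -/
  Ω : Set Plane
  /-- the patch parametrizations (only their values on the closed square matter) -/
  F : Fin K → ℝ × ℝ → Plane
  isOpen : IsOpen Ω
  isBounded : Bornology.IsBounded Ω
  closure_eq : closure Ω = ⋃ k, F k '' square
  patch_subset : ∀ k, F k '' openSquare ⊆ Ω
  patch_disjoint : ∀ k l, k ≠ l → Disjoint (F k '' openSquare) (F l '' openSquare)
  spline : ∀ k (i : Fin 2), ∃ w ∈ tensorSplineSpace p r n, ∀ x ∈ square, F k x i = w x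
  regular : ∀ k, ∃ c > 0, ∀ x ∈ square, c ≤ det2 (dU (F k) x) (dV (F k) x)
  injOn : ∀ k, InjOn (F k) square
  /-- no hanging nodes: a common point of two patches is a vertex of both or lies on an edge that
  the two patches share -/
  no_hanging : ∀ k l, k ≠ l → ∀ x ∈ square, ∀ y ∈ square, F k x = F l y →
    (∃ c c' : Corner, x = c.pt ∧ y = c'.pt) ∨
    ∃ s s' : Edge, edgeSet (F k) s = edgeSet (F l) s' ∧
      (∃ t ∈ Ioo (0 : ℝ) 1, x = s.frame 0 t) ∧ ∃ t ∈ Ioo (0 : ℝ) 1, y = s'.frame 0 t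
  /-- `C⁰`-conformity: along a common edge the parametrizations agree up to a Euclidean motion
  between the two parameter edges -/
  conforming : ∀ k l s s', k ≠ l → edgeSet (F k) s = edgeSet (F l) s' →
    (∀ t ∈ Icc (0 : ℝ) 1, F k (s.frame 0 t) = F l (s'.frame 0 t)) ∨
    ∀ t ∈ Icc (0 : ℝ) 1, F k (s.frame 0 t) = F l (s'.frame 0 (1 - t))
  /-- every edge is either a boundary edge or shared with another patch -/
  edge_dichotomy : ∀ k s, edgeSet (F k) s ⊆ frontier Ω ↔
    ¬ ∃ l s', l ≠ k ∧ edgeSet (F l) s' = edgeSet (F k) s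
  /-- an interface belongs to two patches only -/
  interface_two : ∀ k l m s s' s'', l ≠ k → m ≠ k → edgeSet (F l) s' = edgeSet (F k) s →
    edgeSet (F m) s'' = edgeSet (F k) s → l = m

/-- The six `C²`-data at a point of the plane: value, gradient and Hessian. -/
inductive C2Index
  | val
  | dx
  | dy
  | dxx
  | dxy
  | dyy
  deriving DecidableEq

/-- Pairing of the gradient part of `C²`-data with a vector. -/
def gradAt (Φ : C2Index → ℝ) (a : Plane) : ℝ := Φ .dx * a 0 + Φ .dy * a 1

/-- The Hessian part of `C²`-data as a bilinear form. -/
def hessAt (Φ : C2Index → ℝ) (a b : Plane) : ℝ :=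
  Φ .dxx * (a 0 * b 0) + Φ .dxy * (a 0 * b 1 + a 1 * b 0) + Φ .dyy * (a 1 * b 1)

/-- The function `φ = g ∘ F⁻¹` on the patch has at `F x` the value, gradient and Hessian `Φ`
(limits from inside the patch), written with the derivatives of `g = φ ∘ F` by the chain rule. -/
def HasC2Data (F : ℝ × ℝ → Plane) (x : ℝ × ℝ) (g : ℝ × ℝ → ℝ) (Φ : C2Index → ℝ) : Prop :=
  g x = Φ .val ∧
  dU g x = gradAt Φ (dU F x) ∧
  dV g x = gradAt Φ (dV F x) ∧
  dU (dU g) x = hessAt Φ (dU F x) (dU F x) + gradAt Φ (dU (dU F) x) ∧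
  dV (dU g) x = hessAt Φ (dU F x) (dV F x) + gradAt Φ (dV (dU F) x) ∧
  dV (dV g) x = hessAt Φ (dV F x) (dV F x) + gradAt Φ (dV (dV F) x)

/-- Indices `3 ≤ j ≤ N₊ - 4` of the trace functions and `2 ≤ j ≤ N₋ - 3` of the normal derivative
functions of an edge, where `N₊`, `N₋` are the dimensions of `S⁺ = S(p, p - 1, 1 / n)`,
`S⁻ = S(p - 1, p - 2, 1 / n)` and B-splines are numbered from `0`. -/
abbrev EdgeIdx (p n : ℕ) : Type :=
  {j : ℕ // 3 ≤ j ∧ j + 3 < splineDim p (p - 1) n} ⊕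
    {j : ℕ // 2 ≤ j ∧ j + 2 < splineDim (p - 1) (p - 2) n}

/-- The trace `b⁺` belonging to an edge index. -/
def EdgeIdx.plus {p n : ℕ} : EdgeIdx p n → ℝ → ℝ
  | .inl j => bspline p (p - 1) n j
  | .inr _ => 0

/-- The normal derivative `b⁻` belonging to an edge index. -/
def EdgeIdx.minus {p n : ℕ} : EdgeIdx p n → ℝ → ℝ
  | .inl _ => 0
  | .inr j => bspline (p - 1) (p - 2) n j

/-- Indices `2 ≤ i, j ≤ N - 3` (numbered from `0`) of the patch interior functions. -/
abbrev InteriorIdx (p r n : ℕ) : Type :=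
  {q : ℕ × ℕ // (2 ≤ q.1 ∧ q.1 + 2 < splineDim p r n) ∧ 2 ≤ q.2 ∧ q.2 + 2 < splineDim p r n}

namespace MultiPatch

variable {p r n K : ℕ} (M : MultiPatch p r n K)

/-- Boundary edges. -/
def IsBoundaryEdge (k : Fin K) (s : Edge) : Prop := edgeSet (M.F k) s ⊆ frontier M.Ω

/-- The interfaces: pairs of coinciding edges of two patches `k < l`. -/
abbrev Interface : Type :=
  {q : (Fin K × Edge) × (Fin K × Edge) //
    q.1.1 < q.2.1 ∧ edgeSet (M.F q.1.1) q.1.2 = edgeSet (M.F q.2.1) q.2.2}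

/-- The vertices of the multi-patch domain, as points of the plane. -/
abbrev Vertex : Type := {V : Plane // ∃ (k : Fin K) (c : Corner), M.F k c.pt = V}

/-- The boundary edges `(k, s)`. -/
abbrev BoundaryEdge : Type := {q : Fin K × Edge // M.IsBoundaryEdge q.1 q.2}

/-! ### Gluing data -/

/-- The gluing function `α` of an edge: the determinant of the transversal and tangential
derivatives, in the order that makes it positive. -/
def alpha (k : Fin K) (s : Edge) (t : ℝ) : ℝ := |det2 (dTrans s (M.F k) t) (dTang s (M.F k) t)|

/-- The gluing function `β` of an edge. -/
def beta (k : Fin K) (s : Edge) (t : ℝ) : ℝ :=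
  inner ℝ (dTrans s (M.F k) t) (dTang s (M.F k) t) / ‖dTang s (M.F k) t‖ ^ 2

variable (P : (ℝ → ℝ) → ℝ → ℝ)

open Classical in
/-- Approximated gluing function, with the artificial value `1` on boundary edges. -/
def alphaT (k : Fin K) (s : Edge) : ℝ → ℝ :=
  if M.IsBoundaryEdge k s then fun _ => 1 else P (M.alpha k s)

open Classical in
/-- Approximated gluing function, with the artificial value `0` on boundary edges. -/
def betaT (k : Fin K) (s : Edge) : ℝ → ℝ :=
  if M.IsBoundaryEdge k s then fun _ => 0 else P (M.beta k s)

/-! ### Patch-local functions and spaces (in the parameter square) -/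

/-- The expansion `f_s[b⁺, b⁻]` along the edge `s` of the patch `k`, with `h = 1 / n`. -/
def edgeFn (k : Fin K) (s : Edge) (bp bm : ℝ → ℝ) : ℝ × ℝ → ℝ := fun x =>
  bp (s.param x) * (bspline p r n 0 (s.dist x) + bspline p r n 1 (s.dist x)) +
    (M.alphaT P k s (s.param x) * bm (s.param x)
      + M.betaT P k s (s.param x) * derivWithin bp (Icc 0 1) (s.param x))
      * ((1 / n : ℝ) / p) * bspline p r n 1 (s.dist x)

/-- Patch interior space. -/
def interiorSpace (p r n : ℕ) : Submodule ℝ (ℝ × ℝ → ℝ) :=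
  Submodule.span ℝ (range fun q : InteriorIdx p r n => tensorBspline p r n q.1.1 q.1.2)

/-- Edge space. -/
def edgeSpace (k : Fin K) (s : Edge) : Submodule ℝ (ℝ × ℝ → ℝ) :=
  Submodule.span ℝ (range fun j : EdgeIdx p n => M.edgeFn P k s j.plus j.minus)

/-- Tensor-product B-splines numbered from the vertex `c`. -/
def cornerBspline (p r n : ℕ) (c : Corner) (i j : ℕ) : ℝ × ℝ → ℝ :=
  fun x => tensorBspline p r n i j (mirror c.1 x.1, mirror c.2 x.2)

/-- The span of the six functions belonging to the horizontal edge at the vertex `c`. -/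
def horizontalSpan (k : Fin K) (c : Corner) : Submodule ℝ (ℝ × ℝ → ℝ) :=
  Submodule.span ℝ
    ({g | ∃ j < 3, g = M.edgeFn P k c.hEdge (fun t => bspline p (p - 1) n j (mirror c.1 t)) 0} ∪
     {g | ∃ j < 2, g = M.edgeFn P k c.hEdge 0 (fun t => bspline (p - 1) (p - 2) n j (mirror c.1 t))} ∪
     {cornerBspline p r n c 0 2})

/-- The span of the six functions belonging to the vertical edge at the vertex `c`. -/
def verticalSpan (k : Fin K) (c : Corner) : Submodule ℝ (ℝ × ℝ → ℝ) :=
  Submodule.span ℝ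
    ({g | ∃ j < 3, g = M.edgeFn P k c.vEdge (fun t => bspline p (p - 1) n j (mirror c.2 t)) 0} ∪
     {g | ∃ j < 2, g = M.edgeFn P k c.vEdge 0 (fun t => bspline (p - 1) (p - 2) n j (mirror c.2 t))} ∪
     {cornerBspline p r n c 2 0})

/-- The span of the six B-splines of the correction term at the vertex `c`. -/
def correctionSpan (p r n : ℕ) (c : Corner) : Submodule ℝ (ℝ × ℝ → ℝ) :=
  Submodule.span ℝ {g | ∃ i j, i + j ≤ 2 ∧ g = cornerBspline p r n c i j}

/-- The function in `W` that interpolates the `C²`-data `Φ` at the vertex `c` of the patch `k`. -/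
def interpolant (k : Fin K) (c : Corner) (W : Submodule ℝ (ℝ × ℝ → ℝ)) (Φ : C2Index → ℝ) :
    ℝ × ℝ → ℝ :=
  Classical.epsilon fun g => g ∈ W ∧ HasC2Data (M.F k) c.pt g Φ

/-- The vertex function `g_s[Φ]`: the sum of the interpolants belonging to the two edges minus
the interpolant of the correction term. -/
def vertexFn (k : Fin K) (c : Corner) (Φ : C2Index → ℝ) : ℝ × ℝ → ℝ :=
  M.interpolant k c (M.horizontalSpan P k c) Φ + M.interpolant k c (M.verticalSpan P k c) Φ
    - M.interpolant k c (correctionSpan p r n c) Φ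

/-- Vertex space. -/
def vertexSpace (k : Fin K) (c : Corner) : Submodule ℝ (ℝ × ℝ → ℝ) :=
  Submodule.span ℝ (range fun q : C2Index => M.vertexFn P k c (Pi.single q 1))

/-! ### Global functions -/

/-- Continuous functions on the closed domain. -/
abbrev C0 : Type := C(closure M.Ω, ℝ)

open Classical in
/-- The pull-back `φ ∘ F k`, meaningful on the closed square. -/
def pull (k : Fin K) (φ : M.C0) : ℝ × ℝ → ℝ := fun x =>
  if h : M.F k x ∈ closure M.Ω then φ ⟨M.F k x, h⟩ else 0

/-- Approximate normal derivative at the point with parameter `t` of an edge: the derivative of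
`φ`, from the side of the patch `k`, in the direction `-(1 / α̃) ∂_d F + (β̃ / α̃) ∂_t F`, where
`d` is the transversal and `t` the tangential parameter. -/
def approxNormalDeriv (k : Fin K) (s : Edge) (φ : M.C0) (t : ℝ) : ℝ :=
  -(1 / M.alphaT P k s t) * dTrans s (M.pull k φ) t
    + M.betaT P k s t / M.alphaT P k s t * dTang s (M.pull k φ) t

open Classical in
/-- The transition between the parameters of the two edges of an interface. -/
def transition (κ : M.Interface) (t : ℝ) : ℝ :=
  if M.F κ.1.1.1 (κ.1.1.2.frame 0 0) = M.F κ.1.2.1 (κ.1.2.2.frame 0 0) then t else 1 - t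

/-- `φ` vanishes on the patch `k`. -/
def VanishesOn (k : Fin K) (φ : M.C0) : Prop := ∀ x ∈ square, M.pull k φ x = 0

/-- The pull-back of `φ` to the patch `k` is the function `g`. -/
def PullsTo (k : Fin K) (φ : M.C0) (g : ℝ × ℝ → ℝ) : Prop := ∀ x ∈ square, M.pull k φ x = g x

/-- The patch `k` has the vertex `V`. -/
def HasVertex (k : Fin K) (V : Plane) : Prop := ∃ c : Corner, M.F k c.pt = V

/-- `φ` is `C²` at the vertex `V`: value, gradient and Hessian agree on all patches at `V`. -/
def IsC2At (V : Plane) (φ : M.C0) : Prop :=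
  ∃ Φ : C2Index → ℝ, ∀ (k : Fin K) (c : Corner), M.F k c.pt = V →
    HasC2Data (M.F k) c.pt (M.pull k φ) Φ

/-- Index set of all the subspaces. -/
inductive Comp
  | interior (k : Fin K)
  | interface (κ : M.Interface)
  | vertex (V : M.Vertex)
  | boundary (σ : M.BoundaryEdge)

/-- The patch interior, interface, vertex and boundary edge spaces. -/
def component : M.Comp → Set M.C0
  | .interior k =>
      {φ | (∃ g ∈ interiorSpace p r n, M.PullsTo k φ g) ∧ ∀ l ≠ k, M.VanishesOn l φ}
  | .interface κ =>
      {φ | (∃ g ∈ M.edgeSpace P κ.1.1.1 κ.1.1.2, M.PullsTo κ.1.1.1 φ g) ∧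
        (∃ g ∈ M.edgeSpace P κ.1.2.1 κ.1.2.2, M.PullsTo κ.1.2.1 φ g) ∧
        (∀ m, m ≠ κ.1.1.1 → m ≠ κ.1.2.1 → M.VanishesOn m φ) ∧
        ∀ t ∈ Icc (0 : ℝ) 1, M.approxNormalDeriv P κ.1.1.1 κ.1.1.2 φ t =
          -M.approxNormalDeriv P κ.1.2.1 κ.1.2.2 φ (M.transition κ t)}
  | .vertex V =>
      {φ | (∀ k c, M.F k (Corner.pt c) = V.1 → ∃ g ∈ M.vertexSpace P k c, M.PullsTo k φ g) ∧
        (∀ l, ¬ M.HasVertex l V.1 → M.VanishesOn l φ) ∧ M.IsC2At V.1 φ}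
  | .boundary σ =>
      {φ | (∃ g ∈ M.edgeSpace P σ.1.1 σ.1.2, M.PullsTo σ.1.1 φ g) ∧
        ∀ l ≠ σ.1.1, M.VanishesOn l φ}

/-- The approximate `C¹` space: the sum of all the subspaces. -/
def approxSpace : Submodule ℝ M.C0 := Submodule.span ℝ (⋃ c, M.component P c)

/-- Index sets of the coupled functions of the subspaces. -/
def LocalIdx : M.Comp → Type
  | .interior _ => InteriorIdx p r n
  | .interface _ => EdgeIdx p n
  | .vertex _ => C2Index
  | .boundary _ => EdgeIdx p n

/-- `φ` is the global function that the coupling yields for an index. Across an interface the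
functions `f[b⁺, b⁻]` and `f[b⁺, -b⁻]` are coupled, because `b⁻` is minus the derivative in the
direction of the outward normal of the respective patch. -/
def IsCoupled : (c : M.Comp) → M.LocalIdx c → M.C0 → Prop
  | .interior k, (q : InteriorIdx p r n), φ =>
      M.PullsTo k φ (tensorBspline p r n q.1.1 q.1.2) ∧ ∀ l ≠ k, M.VanishesOn l φ
  | .interface κ, (j : EdgeIdx p n), φ =>
      M.PullsTo κ.1.1.1 φ (M.edgeFn P κ.1.1.1 κ.1.1.2 j.plus j.minus) ∧
      M.PullsTo κ.1.2.1 φ (M.edgeFn P κ.1.2.1 κ.1.2.2 (fun t => j.plus (M.transition κ t))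
        (fun t => -j.minus (M.transition κ t))) ∧
      ∀ m, m ≠ κ.1.1.1 → m ≠ κ.1.2.1 → M.VanishesOn m φ
  | .vertex V, (q : C2Index), φ =>
      (∀ k c, M.F k (Corner.pt c) = V.1 → M.PullsTo k φ (M.vertexFn P k c (Pi.single q 1))) ∧
      ∀ l, ¬ M.HasVertex l V.1 → M.VanishesOn l φ
  | .boundary σ, (j : EdgeIdx p n), φ =>
      M.PullsTo σ.1.1 φ (M.edgeFn P σ.1.1 σ.1.2 j.plus j.minus) ∧
      ∀ l ≠ σ.1.1, M.VanishesOn l φ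

end MultiPatch

end ApproxC1

end

open ApproxC1

/-! A function on a patch is probed by three kinds of data: its two-jet at each vertex, its trace
and transversal derivative along each edge, and the rest in the interior. The four families of
functions are triangular with respect to these data. Vertex functions carry prescribed jets at their
own vertex; all other functions have zero two-jets at every vertex (`Admissible.localFn_jet`). An
edge function has trace b⁺ and transversal derivative α̃ b⁻ + β̃ (b⁺)' on its own edge and zero
trace and derivative on the other three edges, while interior functions have zero trace and
derivative on all four (`Admissible.localFn_edge`).

Independence follows by peeling. In a vanishing combination the vertex coefficients go first, since
the chain rule is injective on C²-data where the Jacobian is nonzero (`pullJet_injective`). Then,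
edge by edge, the trace kills the b⁺ coefficients, and the transversal derivative divided by α̃
kills the b⁻ coefficients. Only tensor-product B-splines remain on each patch, and these are
independent.

Existence is a gluing problem: the closed domain is a topological quotient of the disjoint union of
squares, so pull-backs only have to agree on common points (`exists_glue`), that is, at vertices and
along shared edges. For vertex functions the point is the correction term: on an edge through the
vertex it cancels one of the two interpolants (`CornerFn.combine`), so the trace is a combination of
the first three B-splines of S(p, p-1, h). Such a combination is determined by its two-jet at the
end point, and this jet depends only on the C²-data and on the parametrized edge, which the two
patches have in common.

That the coupled functions span each subspace rests on two facts. The approximate normal derivative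
of f[b⁺, b⁻] is exactly -b⁻ (`Admissible.approxNormalDeriv_eq`), so continuity and the normal
derivative condition determine the second pull-back on an interface from the first. The coefficients
of a combination of vertex functions are its C²-data (`Admissible.vertex_sum_jet`), so being C² at
the vertex means having the same coefficients on all patches.

The univariate input is obtained by replacing B-splines on each mesh cell by the polynomials
`elemPoly`: matching across knots, order of vanishing at the left end of a cell, and reflection
symmetry. -/

noncomputable section
namespace ApproxC1
open Polynomial

/-! ## Polynomial pieces of B-splines -/

/-- The polynomial that the B-spline `coxDeBoor ξ q i` equals on the knot interval
`[ξ μ, ξ (μ + 1))`. -/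
def elemPoly (ξ : ℕ → ℝ) (μ : ℕ) : ℕ → ℕ → ℝ[X]
  | 0, i => if i = μ then 1 else 0
  | q + 1, i =>
      C (ξ (i + q + 1) - ξ i)⁻¹ * (X - C (ξ i)) * elemPoly ξ μ q i
        + C (ξ (i + q + 2) - ξ (i + 1))⁻¹ * (C (ξ (i + q + 2)) - X) * elemPoly ξ μ q (i + 1)

theorem eval_elemPoly_succ (ξ : ℕ → ℝ) (μ q i : ℕ) (x : ℝ) :
    (elemPoly ξ μ (q + 1) i).eval x =
      (x - ξ i) / (ξ (i + q + 1) - ξ i) * (elemPoly ξ μ q i).eval x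
        + (ξ (i + q + 2) - x) / (ξ (i + q + 2) - ξ (i + 1)) * (elemPoly ξ μ q (i + 1)).eval x := by
  simp only [elemPoly, eval_add, eval_mul, eval_C, eval_sub, eval_X]
  ring

theorem eval_derivative_elemPoly_succ (ξ : ℕ → ℝ) (μ q i : ℕ) (x : ℝ) :
    (derivative (elemPoly ξ μ (q + 1) i)).eval x =
      (ξ (i + q + 1) - ξ i)⁻¹ * (elemPoly ξ μ q i).eval x
        + (x - ξ i) / (ξ (i + q + 1) - ξ i) * (derivative (elemPoly ξ μ q i)).eval x
        - (ξ (i + q + 2) - ξ (i + 1))⁻¹ * (elemPoly ξ μ q (i + 1)).eval x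
        + (ξ (i + q + 2) - x) / (ξ (i + q + 2) - ξ (i + 1))
          * (derivative (elemPoly ξ μ q (i + 1))).eval x := by
  simp only [elemPoly, derivative_add, derivative_mul, derivative_C, derivative_sub, derivative_X,
    eval_add, eval_mul, eval_C, eval_sub, eval_X, eval_zero, eval_one]
  ring

/-- Both sides satisfy the same recursion in the degree, so only the characteristic functions of
degree 0 have to be compared. -/
theorem coxDeBoor_eq_eval_of_base {ξ : ℕ → ℝ} {μ : ℕ} {x : ℝ}
    (h : ∀ i, coxDeBoor ξ 0 i x = if i = μ then 1 else 0) (q i : ℕ) :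
    coxDeBoor ξ q i x = (elemPoly ξ μ q i).eval x := by
  induction q generalizing i with
  | zero => rw [h, elemPoly]; split_ifs <;> simp
  | succ q ih => rw [eval_elemPoly_succ, coxDeBoor, ih, ih]

theorem coxDeBoor_eq_eval {ξ : ℕ → ℝ} (hξ : Monotone ξ) (h1 : ∀ i, ξ i ≤ 1) {μ : ℕ} {x : ℝ}
    (hx : ξ μ ≤ x) (hx' : x < ξ (μ + 1)) (q i : ℕ) :
    coxDeBoor ξ q i x = (elemPoly ξ μ q i).eval x := by
  refine coxDeBoor_eq_eval_of_base (fun i => ?_) q i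
  have hx1 : x ≠ 1 := fun h => absurd (h1 (μ + 1)) (by linarith)
  rw [coxDeBoor]
  congr 1
  simp only [hx1, false_and, or_false, eq_iff_iff]
  constructor
  · rintro ⟨a, b⟩
    by_contra hne
    rcases lt_or_gt_of_ne hne with h | h
    · have := hξ (show i + 1 ≤ μ by omega); linarith
    · have := hξ (show μ + 1 ≤ i by omega); linarith
  · rintro rfl; exact ⟨hx, hx'⟩

theorem coxDeBoor_one_eq_eval {ξ : ℕ → ℝ} (hξ : Monotone ξ) (h1 : ∀ i, ξ i ≤ 1) {μ : ℕ}
    (hμ : ξ μ < 1) (hμ' : ξ (μ + 1) = 1) (q i : ℕ) :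
    coxDeBoor ξ q i 1 = (elemPoly ξ μ q i).eval 1 := by
  refine coxDeBoor_eq_eval_of_base (fun i => ?_) q i
  rw [coxDeBoor]
  congr 1
  rw [eq_iff_iff]
  constructor
  · rintro (⟨-, b⟩ | ⟨-, a, b⟩)
    · exact absurd (h1 (i + 1)) (by linarith)
    · by_contra hne
      rcases lt_or_gt_of_ne hne with h | h
      · have := hξ (show i + 1 ≤ μ by omega); linarith
      · have := hξ (show μ + 1 ≤ i by omega); linarith
  · rintro rfl; exact Or.inr ⟨rfl, hμ, hμ'⟩

theorem elemPoly_eq_zero_of_lt (ξ : ℕ → ℝ) {μ i : ℕ} (h : μ < i) (q : ℕ) :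
    elemPoly ξ μ q i = 0 := by
  induction q generalizing i with
  | zero => rw [elemPoly, if_neg (by omega)]
  | succ q ih => rw [elemPoly, ih h, ih (by omega)]; simp

/-- At a knot τ of multiplicity m, a single piece of each degree q ≤ m survives on the cell to the
right of τ: in the recursion one factor τ - ξ i vanishes and the other quotient is 1.
`eval_elemPoly_left` is the mirror image for the cell to the left. -/
theorem eval_elemPoly_right {ξ : ℕ → ℝ} {τ : ℝ} {μ m : ℕ}
    (hτ : ∀ k, μ < k → k ≤ μ + m → ξ k = τ) (hτ' : τ < ξ (μ + m + 1)) {q : ℕ} (hq : q ≤ m) (i : ℕ) :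
    (elemPoly ξ (μ + m) q i).eval τ = if i + q = μ + m then 1 else 0 := by
  induction q generalizing i with
  | zero => rw [elemPoly]; split_ifs <;> first | omega | simp
  | succ q ih =>
    rw [eval_elemPoly_succ, ih (by omega), ih (by omega)]
    by_cases h1 : i + q = μ + m
    · rw [hτ i (by omega) (by omega), if_neg (by omega : ¬ i + 1 + q = μ + m),
        if_neg (by omega : ¬ i + (q + 1) = μ + m)]
      simp
    · by_cases h2 : i + 1 + q = μ + m
      · rw [if_neg h1, if_pos h2, if_pos (by omega : i + (q + 1) = μ + m),
          hτ (i + 1) (by omega) (by omega), show i + q + 2 = μ + m + 1 by omega]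
        have : ξ (μ + m + 1) - τ ≠ 0 := by linarith
        simp [div_self this]
      · rw [if_neg h1, if_neg h2, if_neg (by omega)]; simp

theorem eval_elemPoly_left {ξ : ℕ → ℝ} {τ : ℝ} {μ m : ℕ}
    (hτ : ∀ k, μ < k → k ≤ μ + m → ξ k = τ) (hτ' : ξ μ < τ) {q : ℕ} (hq : q ≤ m) (i : ℕ) :
    (elemPoly ξ μ q i).eval τ = if i = μ then 1 else 0 := by
  induction q generalizing i with
  | zero => rw [elemPoly]; split_ifs <;> simp
  | succ q ih =>
    rw [eval_elemPoly_succ, ih (by omega), ih (by omega)]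
    by_cases h1 : i = μ
    · subst h1
      rw [hτ (i + q + 1) (by omega) (by omega)]
      have : τ - ξ i ≠ 0 := by linarith
      simp [div_self this]
    · by_cases h2 : i + 1 = μ
      · rw [hτ (i + q + 2) (by omega) (by omega)]; simp [h1]
      · simp [h1, h2]

/-- Continuity at a knot of multiplicity m. In degree exactly m the surviving index is μ from either
side, and the recursion transports equality of values to all higher degrees. -/
theorem eval_elemPoly_adjacent {ξ : ℕ → ℝ} {τ : ℝ} {μ m : ℕ}
    (hτ : ∀ k, μ < k → k ≤ μ + m → ξ k = τ) (h0 : ξ μ < τ) (h1 : τ < ξ (μ + m + 1))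
    {q : ℕ} (hq : m ≤ q) (i : ℕ) :
    (elemPoly ξ μ q i).eval τ = (elemPoly ξ (μ + m) q i).eval τ := by
  induction q, hq using Nat.le_induction generalizing i with
  | base =>
    rw [eval_elemPoly_left hτ h0 le_rfl, eval_elemPoly_right hτ h1 le_rfl]
    simp
  | succ q _ ih => rw [eval_elemPoly_succ, eval_elemPoly_succ, ih, ih]

theorem eval_derivative_elemPoly_one (ξ : ℕ → ℝ) (μ i : ℕ) (x : ℝ) :
    (derivative (elemPoly ξ μ 1 i)).eval x =
      (if i = μ then (ξ (i + 1) - ξ i)⁻¹ else 0)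
        - if i + 1 = μ then (ξ (i + 2) - ξ (i + 1))⁻¹ else 0 := by
  rw [eval_derivative_elemPoly_succ]
  simp only [elemPoly]
  split_ifs <;> simp

/-- Continuity of the first derivative at a simple knot. The differentiated recursion propagates it
upwards because values already match in degree 1 and above; degree 2 is checked by hand. -/
theorem eval_derivative_elemPoly_adjacent {ξ : ℕ → ℝ} (hξ : Monotone ξ) {d : ℝ} {μ : ℕ}
    (hd : 0 < d) (h0 : ξ (μ + 1) - ξ μ = d) (h1 : ξ (μ + 2) - ξ (μ + 1) = d)
    {q : ℕ} (hq : 2 ≤ q) (i : ℕ) :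
    (derivative (elemPoly ξ μ q i)).eval (ξ (μ + 1)) =
      (derivative (elemPoly ξ (μ + 1) q i)).eval (ξ (μ + 1)) := by
  have hτ : ∀ k, μ < k → k ≤ μ + 1 → ξ k = ξ (μ + 1) := fun k hk hk' => by
    rw [show k = μ + 1 by omega]
  have hv : ∀ q, 1 ≤ q → ∀ i, (elemPoly ξ μ q i).eval (ξ (μ + 1))
      = (elemPoly ξ (μ + 1) q i).eval (ξ (μ + 1)) := fun q hq i =>
    eval_elemPoly_adjacent hτ (by linarith) (by show ξ (μ + 1) < ξ (μ + 2); linarith) hq i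
  induction q, hq using Nat.le_induction generalizing i with
  | base =>
    rw [eval_derivative_elemPoly_succ, eval_derivative_elemPoly_succ ξ (μ + 1), hv 1 le_rfl i,
      hv 1 le_rfl (i + 1)]
    simp only [eval_derivative_elemPoly_one]
    have e1 : ξ (μ + 1) = ξ μ + d := by linarith
    have e2 : ξ (μ + 2) = ξ μ + 2 * d := by linarith
    -- Only the indices μ - 2, μ - 1, μ and μ + 1 can have a nonzero contribution to the two cells
    -- in degree 2.
    by_cases c1 : i + 2 = μ
    · subst c1
      simp [show i + 1 + 2 = i + 2 + 1 by omega, show i ≠ i + 2 + 1 by omega]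
    by_cases c2 : i + 1 = μ
    · subst c2
      have hm := hξ (show i ≤ i + 1 by omega)
      have : ξ (i + 1 + 1) - ξ i ≠ 0 := by linarith
      have hd' := hd.ne'
      have e3 : ξ (i + 1 + 2) - ξ (i + 1) = 2 * d := by linarith
      have e4 : ξ (i + 1 + 2) - ξ (i + 1 + 1) = d := by linarith
      have e5 : ξ (i + 2) - ξ (i + 1) = d := h0
      simp [show ¬ (i = i + 1 + 1) by omega, div_self this, e3, e4, e5]
      field_simp
      ring
    by_cases c3 : i = μ
    · subst c3
      have hd' := hd.ne'
      have hm := hξ (show i + 2 ≤ i + 3 by omega)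
      have : ξ (i + 3) - ξ (i + 1) ≠ 0 := by linarith
      have e3 : ξ (i + 2) - ξ i = 2 * d := by linarith
      simp [h0, h1, e3, show i + 1 + 2 = i + 3 by omega, div_self this,
        show ¬ (i + 1 + 1 = i) by omega]
      field_simp
      ring
    by_cases c4 : i = μ + 1
    · subst c4
      simp [show ¬ (μ + 1 + 1 = μ) by omega, show ¬ (μ + 1 + 1 + 1 = μ) by omega]
    simp [c1, c2, c3, c4]
  | succ q hq ih =>
    rw [eval_derivative_elemPoly_succ, eval_derivative_elemPoly_succ ξ (μ + 1),
      hv q (by omega), hv q (by omega), ih, ih]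

/-- A B-spline starts like a truncated power at its first knot, the exponent dropping by the number
s of further copies of that knot. The two summands of the recursion have the same order there and
positive leading factors, so they cannot cancel. This triangularity gives both linear independence
and the jets at 0. -/
theorem elemPoly_leading {ξ : ℕ → ℝ} (hξ : Monotone ξ) {q i s : ℕ} (hs : s ≤ q)
    (h0 : ξ (i + s) = ξ i) (h1 : ξ i < ξ (i + s + 1)) :
    ∃ Q : ℝ[X], elemPoly ξ (i + s) q i = (X - C (ξ i)) ^ (q - s) * Q ∧ 0 < Q.eval (ξ i) := by
  induction q generalizing i s with
  | zero =>
    obtain rfl : s = 0 := by omega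
    exact ⟨1, by simp [elemPoly], by simp⟩
  | succ q ih =>
    have hpos : ∀ k, i + s + 1 ≤ k → 0 < ξ k - ξ i := fun k hk => by
      have := hξ hk; linarith
    rcases Nat.eq_zero_or_pos s with rfl | hs0
    · obtain ⟨Q, hQ, hQ'⟩ := ih (i := i) (s := 0) (by omega) h0 h1
      refine ⟨C (ξ (i + q + 1) - ξ i)⁻¹ * Q, ?_, ?_⟩
      · rw [elemPoly, hQ, elemPoly_eq_zero_of_lt ξ (by omega : i + 0 < i + 1)]
        simp only [Nat.sub_zero, pow_succ]; ring
      · rw [eval_mul, eval_C]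
        exact mul_pos (inv_pos.2 (hpos _ (by omega))) hQ'
    · have hi1 : ξ (i + 1) = ξ i :=
        le_antisymm (h0 ▸ hξ (by omega)) (hξ (by omega))
      obtain ⟨R, hR, hR'⟩ := ih (i := i + 1) (s := s - 1) (by omega)
        (by rw [hi1, ← h0]; congr 1; omega) (by rw [hi1]; convert h1 using 2; omega)
      rw [hi1, show i + 1 + (s - 1) = i + s by omega] at hR
      rw [hi1] at hR'
      have hp2 := hpos (i + q + 2) (by omega)
      -- For s = q + 1 the denominator of the first summand is 0, and the summand drops out by the
      -- convention 0⁻¹ = 0.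
      rcases Nat.lt_or_ge q s with hsq | hsq
      · obtain rfl : s = q + 1 := by omega
        refine ⟨C (ξ (i + q + 2) - ξ i)⁻¹ * (C (ξ (i + q + 2)) - X) * R, ?_, ?_⟩
        · rw [elemPoly, hR, show i + q + 1 = i + (q + 1) by omega, h0, hi1]
          simp
        · simp only [eval_mul, eval_C, eval_sub, eval_X]
          exact mul_pos (mul_pos (inv_pos.2 hp2) hp2) hR'
      · obtain ⟨Q, hQ, hQ'⟩ := ih (i := i) (s := s) hsq h0 h1
        refine ⟨C (ξ (i + q + 1) - ξ i)⁻¹ * Q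
          + C (ξ (i + q + 2) - ξ i)⁻¹ * (C (ξ (i + q + 2)) - X) * R, ?_, ?_⟩
        · rw [elemPoly, hR, hQ, hi1, show q - (s - 1) = q - s + 1 by omega,
            show q + 1 - s = q - s + 1 by omega, pow_succ]
          ring
        · simp only [eval_add, eval_mul, eval_C, eval_sub, eval_X]
          exact add_pos (mul_pos (inv_pos.2 (hpos _ (by omega))) hQ')
            (mul_pos (mul_pos (inv_pos.2 hp2) hp2) hR')

/-- The substitution x ↦ 1 - x exchanges the two summands of the recursion when the knots are
symmetric. L is the sum of the indices of two mirrored knots. -/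
theorem elemPoly_comp_reflect {ξ : ℕ → ℝ} {L : ℕ} (hξ : ∀ k k', k + k' = L → ξ k' = 1 - ξ k)
    {μ μ' : ℕ} (hμ : μ + μ' + 1 = L) {q i i' : ℕ} (hi : i + i' + q + 1 = L) :
    (elemPoly ξ μ q i).comp (1 - X) = elemPoly ξ μ' q i' := by
  induction q generalizing i i' with
  | zero =>
    rw [elemPoly, elemPoly]
    split_ifs <;> first | omega | simp
  | succ q ih =>
    rw [elemPoly, elemPoly, add_comp, mul_comp, mul_comp, mul_comp, mul_comp,
      ih (i := i) (i' := i' + 1) (by omega), ih (i := i + 1) (i' := i') (by omega),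
      hξ i (i' + q + 2) (by omega), hξ (i + q + 1) (i' + 1) (by omega),
      hξ (i + 1) (i' + q + 1) (by omega), hξ (i + q + 2) i' (by omega)]
    simp only [C_comp, sub_comp, X_comp, C_sub, C_1]
    rw [show (1 - ξ (i + 1) - (1 - ξ (i + q + 2))) = ξ (i + q + 2) - ξ (i + 1) by ring,
      show (1 - ξ i - (1 - ξ (i + q + 1))) = ξ (i + q + 1) - ξ i by ring]
    ring

/-! ## The uniform open knot vector -/

/-- The last index whose knot is `m / n`. -/
def elemIdx (p r m : ℕ) : ℕ := p + (p - r) * m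

theorem knot_le_one (p r n i : ℕ) : knot p r n i ≤ 1 := by
  unfold knot
  split_ifs
  · norm_num
  · exact div_le_one_of_le₀ (by exact_mod_cast min_le_left _ _) (by positivity)

theorem knot_mono (p r n : ℕ) : Monotone (knot p r n) := by
  intro i j hij
  unfold knot
  split_ifs with h1 h2
  · exact le_rfl
  · positivity
  · omega
  · have : (i - p - 1) / (p - r) ≤ (j - p - 1) / (p - r) := Nat.div_le_div_right (by omega)
    gcongr

theorem knot_of_le {p r n i : ℕ} (h : i ≤ p) : knot p r n i = 0 := by simp [knot, h]

/-- The knots with index in `(elemIdx p r m, elemIdx p r (m + 1)]` equal `(m + 1) / n`. -/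
theorem knot_eq {p r n m k : ℕ} (hm : m < n) (h1 : elemIdx p r m < k)
    (h2 : k ≤ elemIdx p r (m + 1)) : knot p r n k = ((m + 1 : ℕ) : ℝ) / n := by
  unfold elemIdx at *
  have e : (k - p - 1) / (p - r) = m := by
    rw [mul_add] at h2
    apply Nat.div_eq_of_lt_le
    · rw [mul_comm]; omega
    · rw [mul_comm, mul_add]; omega
  rw [knot, if_neg (by have := Nat.zero_le ((p - r) * m); omega), e, min_eq_right (by omega)]

theorem knot_elemIdx {p r n m : ℕ} (hrp : r < p) (hm : m ≤ n) :
    knot p r n (elemIdx p r m) = (m : ℝ) / n := by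
  rcases m with _ | m
  · simp [elemIdx, knot]
  · refine knot_eq (by omega) ?_ le_rfl
    unfold elemIdx
    rw [mul_add]; omega

theorem knot_elemIdx_succ {p r n m : ℕ} (hrp : r < p) (hm : m < n) :
    knot p r n (elemIdx p r m + 1) = ((m + 1 : ℕ) : ℝ) / n := by
  refine knot_eq hm (by omega) ?_
  unfold elemIdx
  rw [mul_add]; omega

theorem knot_reflect {p r n : ℕ} (hrp : r < p) (hn : 1 ≤ n) {k k' : ℕ}
    (h : k + k' = splineDim p r n + p) : knot p r n k' = 1 - knot p r n k := by
  have hn' : (n : ℝ) ≠ 0 := by positivity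
  obtain ⟨N, rfl⟩ : ∃ N, n = N + 1 := ⟨n - 1, by omega⟩
  unfold splineDim at h
  simp only [Nat.add_sub_cancel] at h
  obtain ⟨d, hd⟩ : ∃ d, p - r = d + 1 := ⟨p - r - 1, by omega⟩
  -- The mirror image of the initial block of zeros is the final block of ones, where the minimum in
  -- `knot` is attained by n.
  have key : ∀ k k', k ≤ p → k + k' = p + 1 + (p - r) * N + p → knot p r (N + 1) k' = 1 := by
    intro k k' hk h
    have : N ≤ (k' - p - 1) / (p - r) := by
      rw [Nat.le_div_iff_mul_le (by omega), mul_comm]; omega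
    rw [knot, if_neg (by have := Nat.zero_le ((p - r) * N); omega), min_eq_left (by omega)]
    exact div_self hn'
  by_cases hk : k ≤ p
  · rw [key k k' hk h, knot_of_le hk]; ring
  by_cases hk' : k' ≤ p
  · rw [key k' k hk' (by omega), knot_of_le hk']; ring
  -- For interior knots, a is the number of the block and b the place in the block; mirroring sends
  -- block a to block N - 1 - a.
  obtain ⟨a, b, hb, hab⟩ : ∃ a b, b < p - r ∧ k = p + 1 + (p - r) * a + b :=
    ⟨(k - p - 1) / (p - r), (k - p - 1) % (p - r), Nat.mod_lt _ (by omega), by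
      have := Nat.div_add_mod (k - p - 1) (p - r); omega⟩
  have haN : a < N := by
    by_contra hc
    have := Nat.mul_le_mul_left (p - r) (not_lt.1 hc)
    omega
  obtain ⟨a', rfl⟩ : ∃ a', N = a + a' + 1 := ⟨N - a - 1, by omega⟩
  simp only [mul_add, mul_one] at h
  rw [knot_eq (k := k) (m := a) (by omega) (by unfold elemIdx; omega)
    (by unfold elemIdx; rw [mul_add]; omega),
    knot_eq (k := k') (m := a') (by omega) (by unfold elemIdx; omega)
    (by unfold elemIdx; rw [mul_add]; omega)]
  field_simp
  push_cast
  ring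

/-! ## Piecewise polynomials -/

/-- Continuous piecewise polynomials on the uniform mesh of `[0, 1]`. -/
def IsPP (n : ℕ) (f : ℝ → ℝ) : Prop :=
  ∃ P : ℕ → ℝ[X], ∀ m < n, ∀ x ∈ Icc ((m : ℝ) / n) ((m + 1 : ℕ) / n), f x = (P m).eval x

/-- Continuously differentiable piecewise polynomials on the uniform mesh of `[0, 1]`. -/
def IsPP1 (n : ℕ) (f : ℝ → ℝ) : Prop :=
  ∃ P : ℕ → ℝ[X], (∀ m < n, ∀ x ∈ Icc ((m : ℝ) / n) ((m + 1 : ℕ) / n), f x = (P m).eval x) ∧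
    ∀ m, m + 1 < n → (derivative (P m)).eval (((m + 1 : ℕ) : ℝ) / n)
      = (derivative (P (m + 1))).eval (((m + 1 : ℕ) : ℝ) / n)

/-- The definition gives the polynomial on half-open cells. The right end point is added by
continuity at an interior knot, whose multiplicity p - r is at most the degree p, and by the closed
convention at 1. -/
theorem bspline_eq_eval {p r n m : ℕ} (hrp : r < p) (hm : m < n) (i : ℕ) {x : ℝ}
    (hx : x ∈ Icc ((m : ℝ) / n) ((m + 1 : ℕ) / n)) :
    bspline p r n i x = (elemPoly (knot p r n) (elemIdx p r m) p i).eval x := by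
  have hn : (0 : ℝ) < n := by exact_mod_cast (by omega : 0 < n)
  have step : ∀ m, m < n → ((m : ℕ) : ℝ) / n < ((m + 1 : ℕ) : ℝ) / n := fun m _ => by
    gcongr; exact_mod_cast Nat.lt_succ_self m
  rcases hx.2.lt_or_eq with h | h
  · exact coxDeBoor_eq_eval (knot_mono _ _ _) (knot_le_one _ _ _)
      (by rw [knot_elemIdx hrp hm.le]; exact hx.1) (by rw [knot_elemIdx_succ hrp hm]; exact h) _ _
  · rcases (Nat.succ_le_of_lt hm).lt_or_eq with hm' | hm'
    · have hidx : elemIdx p r (m + 1) = elemIdx p r m + (p - r) := by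
        unfold elemIdx; rw [mul_add]; omega
      rw [h, eval_elemPoly_adjacent (m := p - r) (fun k hk hk' => knot_eq hm hk (by rw [hidx]; exact hk'))
        (by rw [knot_elemIdx hrp hm.le]; exact step m hm)
        (by rw [← hidx, knot_elemIdx_succ hrp hm']; exact step _ hm') (by omega), ← hidx]
      exact coxDeBoor_eq_eval (knot_mono _ _ _) (knot_le_one _ _ _)
        (by rw [knot_elemIdx hrp hm]) (by rw [knot_elemIdx_succ hrp hm']; exact step _ hm') _ _
    · have e1 : (((m + 1 : ℕ) : ℝ)) / n = 1 := by
        rw [← hm']; exact div_self (by rw [← hm'] at hn; exact hn.ne')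
      rw [h, e1]
      exact coxDeBoor_one_eq_eval (knot_mono _ _ _) (knot_le_one _ _ _)
        (by rw [knot_elemIdx hrp hm.le, ← e1]; exact step m hm)
        (by rw [knot_elemIdx_succ hrp hm, e1]) _ _

theorem IsPP1.isPP {n : ℕ} {f : ℝ → ℝ} (h : IsPP1 n f) : IsPP n f :=
  let ⟨P, hP, _⟩ := h; ⟨P, hP⟩

theorem isPP_bspline {p r : ℕ} (hrp : r < p) (n i : ℕ) : IsPP n (bspline p r n i) :=
  ⟨_, fun _ hm _ hx => bspline_eq_eval hrp hm i hx⟩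

/-- For maximal regularity the interior knots are simple and equally spaced, so the pieces match to
first order. -/
theorem isPP1_bspline {p : ℕ} (hp : 2 ≤ p) (n i : ℕ) : IsPP1 n (bspline p (p - 1) n i) := by
  refine ⟨_, fun _ hm _ hx => bspline_eq_eval (by omega) hm i hx, fun m hm => ?_⟩
  have hn : (0 : ℝ) < n := by exact_mod_cast (by omega : 0 < n)
  have hidx : elemIdx p (p - 1) (m + 1) = elemIdx p (p - 1) m + 1 := by
    unfold elemIdx; rw [mul_add]; omega
  have hk := knot_elemIdx_succ (n := n) (by omega : p - 1 < p) (by omega : m < n)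
  have hk2 := knot_elemIdx_succ (n := n) (by omega : p - 1 < p) hm
  rw [hidx] at hk2
  have := eval_derivative_elemPoly_adjacent (knot_mono p (p - 1) n) (d := 1 / n)
    (μ := elemIdx p (p - 1) m) (by positivity)
    (by rw [hk, knot_elemIdx (by omega) (by omega)]; push_cast; field_simp; ring)
    (by rw [hk, show elemIdx p (p - 1) m + 2 = elemIdx p (p - 1) m + 1 + 1 from rfl, hk2]
        push_cast; field_simp; ring) hp i
  rw [hk] at this
  rw [hidx]
  exact this

theorem isPP_const (n : ℕ) (a : ℝ) : IsPP n (fun _ => a) := ⟨fun _ => C a, by simp⟩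

theorem IsPP.add {n : ℕ} {f g : ℝ → ℝ} (hf : IsPP n f) (hg : IsPP n g) :
    IsPP n (fun x => f x + g x) := by
  obtain ⟨P, hP⟩ := hf
  obtain ⟨Q, hQ⟩ := hg
  exact ⟨fun m => P m + Q m, fun m hm x hx => by
    rw [eval_add, ← hP m hm x hx, ← hQ m hm x hx]⟩

theorem IsPP.mul {n : ℕ} {f g : ℝ → ℝ} (hf : IsPP n f) (hg : IsPP n g) :
    IsPP n (fun x => f x * g x) := by
  obtain ⟨P, hP⟩ := hf
  obtain ⟨Q, hQ⟩ := hg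
  exact ⟨fun m => P m * Q m, fun m hm x hx => by
    rw [eval_mul, ← hP m hm x hx, ← hQ m hm x hx]⟩

theorem isPP_of_mem_splineSpace {p r n : ℕ} (hrp : r < p) {f : ℝ → ℝ}
    (hf : f ∈ splineSpace p r n) : IsPP n f := by
  unfold splineSpace at hf
  induction hf using Submodule.span_induction with
  | mem f h => obtain ⟨i, -, rfl⟩ := h; exact isPP_bspline hrp n i
  | zero => exact isPP_const n 0
  | add f g _ _ hf hg => exact hf.add hg
  | smul a f _ hf => exact (isPP_const n a).mul hf

theorem exists_mem_elem {n : ℕ} (hn : 1 ≤ n) {x : ℝ} (hx : x ∈ Icc (0 : ℝ) 1) :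
    ∃ m < n, x ∈ Icc ((m : ℝ) / n) ((m + 1 : ℕ) / n) := by
  have hn' : (0 : ℝ) < n := by positivity
  rcases hx.2.lt_or_eq with h | rfl
  · have h0 : 0 ≤ x * n := mul_nonneg hx.1 hn'.le
    refine ⟨⌊x * n⌋₊, ?_, ?_, ?_⟩
    · rw [Nat.floor_lt h0]; nlinarith
    · rw [div_le_iff₀ hn']; exact Nat.floor_le h0
    · rw [le_div_iff₀ hn']; push_cast; exact (Nat.lt_floor_add_one _).le
  · refine ⟨n - 1, by omega, ?_, ?_⟩
    · rw [div_le_one hn']; exact_mod_cast Nat.sub_le n 1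
    · rw [le_div_iff₀ hn', Nat.sub_add_cancel hn]; simp

theorem elem_subset {n m : ℕ} (hm : m < n) :
    Icc ((m : ℝ) / n) ((m + 1 : ℕ) / n) ⊆ Icc (0 : ℝ) 1 := by
  have hn : (0 : ℝ) < n := by exact_mod_cast (by omega : 0 < n)
  refine Icc_subset_Icc (by positivity) ?_
  rw [div_le_one hn]; exact_mod_cast hm

theorem IsPP.continuousOn {n : ℕ} (hn : 1 ≤ n) {f : ℝ → ℝ} (hf : IsPP n f) :
    ContinuousOn f (Icc 0 1) := by
  obtain ⟨P, hP⟩ := hf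
  have : ContinuousOn f (⋃ m : Fin n, Icc ((m : ℝ) / n) (((m : ℕ) + 1 : ℕ) / n)) := by
    refine (locallyFinite_of_finite _).continuousOn_iUnion (fun _ => isClosed_Icc) fun m => ?_
    exact (P m).continuous.continuousOn.congr (hP m m.2)
  refine this.mono fun x hx => ?_
  obtain ⟨m, hm, h⟩ := exists_mem_elem hn hx
  exact mem_iUnion.2 ⟨⟨m, hm⟩, h⟩
end ApproxC1
end

noncomputable section
namespace ApproxC1
open Polynomial Filter Topology

/-! ## Reflection and linear independence of B-splines -/

theorem bspline_reflect {p r n i i' : ℕ} (hrp : r < p) (hn : 1 ≤ n)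
    (hi : i + i' + 1 = splineDim p r n) {x : ℝ} (hx : x ∈ Icc (0 : ℝ) 1) :
    bspline p r n i (1 - x) = bspline p r n i' x := by
  have hn' : (0 : ℝ) < n := by positivity
  obtain ⟨m, hm, hxm⟩ := exists_mem_elem hn hx
  obtain ⟨m', hm'⟩ : ∃ m', m + m' + 1 = n := ⟨n - m - 1, by omega⟩
  have hmn : (m : ℝ) + m' + 1 = n := by exact_mod_cast hm'
  have h1 : 1 - x ∈ Icc ((m' : ℝ) / n) ((m' + 1 : ℕ) / n) := by
    obtain ⟨ha, hb⟩ := hxm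
    rw [div_le_iff₀ hn'] at ha
    rw [le_div_iff₀ hn'] at hb
    push_cast at hb
    constructor
    · rw [div_le_iff₀ hn']; linarith
    · rw [le_div_iff₀ hn']; push_cast; linarith
  rw [bspline_eq_eval hrp hm _ hxm, bspline_eq_eval hrp (by omega) _ h1,
    ← elemPoly_comp_reflect (ξ := knot p r n) (fun k k' h => knot_reflect hrp hn h)
      (μ := elemIdx p r m') (μ' := elemIdx p r m) (q := p) (i := i) (i' := i') ?_ (by omega)]
  · simp
  · unfold elemIdx splineDim
    rw [← hm', Nat.add_sub_cancel, mul_add]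
    omega

/-- Strong induction on the index, looking at the first nonempty cell to the right of knot i. There
the earlier coefficients are already 0, the later B-splines vanish to higher order at the left end
of the cell, and the B-spline i has a nonzero leading coefficient. -/
theorem linearIndependent_bspline {p r n : ℕ} (hrp : r < p) (hn : 1 ≤ n) (c : ℕ → ℝ)
    (h : ∀ x ∈ Icc (0 : ℝ) 1, ∑ i ∈ Finset.range (splineDim p r n), c i * bspline p r n i x = 0) :
    ∀ i < splineDim p r n, c i = 0 := by
  have hn' : (0 : ℝ) < n := by positivity
  have hE : ∀ m < n, ∑ i ∈ Finset.range (splineDim p r n),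
      C (c i) * elemPoly (knot p r n) (elemIdx p r m) p i = 0 := by
    intro m hm
    refine eq_zero_of_infinite_isRoot _ (Infinite.mono ?_
      (Icc_infinite (show (m : ℝ) / n < (m + 1 : ℕ) / n by
        gcongr; exact_mod_cast Nat.lt_succ_self m)))
    intro x hx
    rw [mem_ofPred_eq, IsRoot, eval_finsetSum, ← h x (elem_subset hm hx)]
    refine Finset.sum_congr rfl fun i _ => ?_
    rw [eval_mul, eval_C, bspline_eq_eval hrp hm _ hx]
  intro i
  induction i using Nat.strong_induction_on with
  | _ i ih =>
  intro hi
  -- Here m numbers the cell that starts at knot i, and s counts the copies of that knot with larger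
  -- index.
  obtain ⟨m, s, hm, hs, his, hk⟩ : ∃ m s, m < n ∧ s ≤ p ∧ i + s = elemIdx p r m ∧
      knot p r n i = (m : ℝ) / n := by
    by_cases hip : i ≤ p
    · exact ⟨0, p - i, hn, by omega, by unfold elemIdx; omega, by simp [knot_of_le hip]⟩
    have hb := Nat.mod_lt (i - p - 1) (by omega : 0 < p - r)
    have hab := Nat.div_add_mod (i - p - 1) (p - r)
    set a := (i - p - 1) / (p - r)
    set b := (i - p - 1) % (p - r)
    have ha : a + 1 < n := by
      by_contra hc
      have := Nat.mul_le_mul_left (p - r) (show n - 1 ≤ a by omega)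
      unfold splineDim at hi
      omega
    refine ⟨a + 1, p - r - 1 - b, ha, by omega, ?_, ?_⟩
    · unfold elemIdx; rw [mul_add]; omega
    · exact knot_eq (by omega) (by unfold elemIdx; omega) (by unfold elemIdx; rw [mul_add]; omega)
  have hks := knot_elemIdx (n := n) hrp hm.le
  have hks' := knot_elemIdx_succ (n := n) hrp hm
  have hlt : (m : ℝ) / n < (m + 1 : ℕ) / n := by gcongr; exact_mod_cast Nat.lt_succ_self m
  obtain ⟨Q, hQ, hQ'⟩ := elemPoly_leading (knot_mono p r n) hs (i := i) (by rw [his, hks, hk])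
    (by rw [his, hks', hk]; exact hlt)
  -- The term i is minus the sum of all the others, and each of these is divisible by one more power
  -- of X - ξ i than the piece i.
  have hdvd : (X - C (knot p r n i)) ^ (p - s + 1) ∣ C (c i) * ((X - C (knot p r n i)) ^ (p - s) * Q) := by
    rw [← hQ, his, ← dvd_add_left (c := ∑ j ∈ (Finset.range (splineDim p r n)).erase i,
      C (c j) * elemPoly (knot p r n) (elemIdx p r m) p j),
      Finset.add_sum_erase _ (fun j => C (c j) * elemPoly (knot p r n) (elemIdx p r m) p j)
        (Finset.mem_range.2 hi), hE m hm]
    · exact dvd_zero _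
    · refine Finset.dvd_sum fun j hj => ?_
      rcases lt_or_gt_of_ne (Finset.ne_of_mem_erase hj) with hji | hji
      · rw [ih j hji (Finset.mem_range.1 (Finset.mem_of_mem_erase hj))]; simp
      rcases Nat.lt_or_ge (elemIdx p r m) j with hj' | hj'
      · rw [elemPoly_eq_zero_of_lt _ hj']; simp
      have hkj : knot p r n j = knot p r n i := by
        refine le_antisymm ?_ (knot_mono _ _ _ hji.le)
        rw [hk, ← hks]; exact knot_mono _ _ _ hj'
      obtain ⟨R, hR, -⟩ := elemPoly_leading (knot_mono p r n) (q := p) (i := j)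
        (s := elemIdx p r m - j) (by omega)
        (by rw [hkj, hk, ← hks]; congr 1; omega)
        (by rw [hkj, hk, show j + (elemIdx p r m - j) + 1 = elemIdx p r m + 1 by omega, hks']
            exact hlt)
      rw [show j + (elemIdx p r m - j) = elemIdx p r m by omega, hkj] at hR
      rw [hR]
      exact Dvd.dvd.mul_left (Dvd.dvd.mul_right (pow_dvd_pow _ (by omega)) _) _
  rw [pow_succ, mul_left_comm] at hdvd
  have := (mul_dvd_mul_iff_left (pow_ne_zero _ (X_sub_C_ne_zero _))).1 hdvd
  rw [dvd_iff_isRoot, IsRoot, eval_mul, eval_C] at this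
  exact (mul_eq_zero.1 this).resolve_right hQ'.ne'

/-! ## Jets at the left end point of `[0, 1]` -/

theorem mirror_mirror (e x) : mirror e (mirror e x) = x := by
  unfold mirror; split_ifs <;> ring

theorem mirror_mem {e : Bool} {x : ℝ} (hx : x ∈ Icc (0 : ℝ) 1) : mirror e x ∈ Icc (0 : ℝ) 1 := by
  unfold mirror; split_ifs
  · exact ⟨by linarith [hx.2], by linarith [hx.1]⟩
  · exact hx

/-- The derivative of `mirror e`. -/
def sgn (e : Bool) : ℝ := if e then -1 else 1

theorem sgn_mul_self (e : Bool) : sgn e * sgn e = 1 := by cases e <;> simp [sgn]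

theorem derivWithin_mirror {X : Type*} [NormedAddCommGroup X] [NormedSpace ℝ X] (f : ℝ → X)
    (e : Bool) (x : ℝ) : derivWithin (fun t => f (mirror e t)) (Icc 0 1) x
      = sgn e • derivWithin f (Icc 0 1) (mirror e x) := by
  cases e
  · simp [mirror, sgn]
  · simp [mirror, sgn, derivWithin_comp_const_sub]

theorem uniqueDiff01 {x : ℝ} (hx : x ∈ Icc (0 : ℝ) 1) : UniqueDiffWithinAt ℝ (Icc (0 : ℝ) 1) x :=
  uniqueDiffOn_Icc zero_lt_one x hx

theorem zero_mem01 : (0 : ℝ) ∈ Icc (0 : ℝ) 1 := ⟨le_rfl, zero_le_one⟩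

/-- `f` has at `0` the value `a`, the first derivative `b` and the second derivative `c`,
with all derivatives taken within `[0, 1]`. -/
def HasJet1 (f : ℝ → ℝ) (a b c : ℝ) : Prop :=
  ∃ f' : ℝ → ℝ, (∀ᶠ u in 𝓝[Icc 0 1] 0, HasDerivWithinAt f (f' u) (Icc 0 1) u) ∧
    HasDerivWithinAt f' c (Icc 0 1) 0 ∧ f 0 = a ∧ f' 0 = b

theorem HasJet1.hasDerivWithinAt {f : ℝ → ℝ} {a b c : ℝ} (h : HasJet1 f a b c) :
    HasDerivWithinAt f b (Icc 0 1) 0 := by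
  obtain ⟨f', h1, -, -, rfl⟩ := h
  exact h1.self_of_nhdsWithin zero_mem01

theorem HasJet1.unique {f : ℝ → ℝ} {a b c a' b' c' : ℝ} (h : HasJet1 f a b c)
    (h' : HasJet1 f a' b' c') : a = a' ∧ b = b' ∧ c = c' := by
  obtain ⟨f', h1, h2, rfl, rfl⟩ := h
  obtain ⟨g', k1, k2, rfl, rfl⟩ := h'
  have e : f' =ᶠ[𝓝[Icc 0 1] 0] g' := by
    filter_upwards [h1, k1, self_mem_nhdsWithin] with u hu ku hm
    exact (uniqueDiff01 hm).eq_deriv _ hu ku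
  exact ⟨rfl, e.self_of_nhdsWithin zero_mem01, (uniqueDiff01 zero_mem01).eq_deriv _
    (h2.congr_of_eventuallyEq e.symm (e.self_of_nhdsWithin zero_mem01).symm) k2⟩

theorem HasJet1.congr {f g : ℝ → ℝ} {a b c : ℝ} (h : HasJet1 f a b c)
    (hfg : ∀ x ∈ Icc (0 : ℝ) 1, g x = f x) : HasJet1 g a b c := by
  obtain ⟨f', h1, h2, rfl, rfl⟩ := h
  refine ⟨f', ?_, h2, hfg 0 zero_mem01, rfl⟩
  filter_upwards [h1, self_mem_nhdsWithin] with u hu hm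
  exact hu.congr hfg (hfg u hm)

theorem HasJet1.add {f g : ℝ → ℝ} {a b c a' b' c' : ℝ} (h : HasJet1 f a b c)
    (h' : HasJet1 g a' b' c') : HasJet1 (fun x => f x + g x) (a + a') (b + b') (c + c') := by
  obtain ⟨f', h1, h2, rfl, rfl⟩ := h
  obtain ⟨g', k1, k2, rfl, rfl⟩ := h'
  refine ⟨fun x => f' x + g' x, ?_, h2.add k2, rfl, rfl⟩
  filter_upwards [h1, k1] with u hu ku
  exact hu.add ku

theorem HasJet1.const_mul {f : ℝ → ℝ} {a b c : ℝ} (k : ℝ) (h : HasJet1 f a b c) :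
    HasJet1 (fun x => k * f x) (k * a) (k * b) (k * c) := by
  obtain ⟨f', h1, h2, rfl, rfl⟩ := h
  refine ⟨fun x => k * f' x, ?_, h2.const_mul k, rfl, rfl⟩
  filter_upwards [h1] with u hu
  exact hu.const_mul k

theorem HasJet1.mul {f g : ℝ → ℝ} {a b c a' b' c' : ℝ} (h : HasJet1 f a b c)
    (h' : HasJet1 g a' b' c') :
    HasJet1 (fun x => f x * g x) (a * a') (b * a' + a * b') (c * a' + b * b' + (b * b' + a * c')) := by
  have hf := h.hasDerivWithinAt
  have hg := h'.hasDerivWithinAt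
  obtain ⟨f', h1, h2, rfl, rfl⟩ := h
  obtain ⟨g', k1, k2, rfl, rfl⟩ := h'
  refine ⟨fun x => f' x * g x + f x * g' x, ?_, (h2.mul hg).add (hf.mul k2), rfl, rfl⟩
  filter_upwards [h1, k1] with u hu ku
  exact hu.mul ku

theorem hasJet1_zero : HasJet1 (fun _ => 0) 0 0 0 :=
  ⟨fun _ => 0, Eventually.of_forall fun _ => hasDerivWithinAt_const .., hasDerivWithinAt_const ..,
    rfl, rfl⟩

theorem hasJet1_of_eval {f : ℝ → ℝ} {δ : ℝ} (hδ : 0 < δ) {Q : ℝ[X]}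
    (h : ∀ x ∈ Icc 0 δ, f x = Q.eval x) :
    HasJet1 f (Q.eval 0) ((derivative Q).eval 0) ((derivative (derivative Q)).eval 0) := by
  refine ⟨fun x => (derivative Q).eval x, ?_, (Q.derivative.hasDerivAt 0).hasDerivWithinAt,
    h 0 ⟨le_rfl, hδ.le⟩, rfl⟩
  have hmem : Iio δ ∈ 𝓝 (0 : ℝ) := Iio_mem_nhds hδ
  filter_upwards [mem_nhdsWithin_of_mem_nhds hmem, self_mem_nhdsWithin] with u hu hm
  refine (Q.hasDerivAt u).hasDerivWithinAt.congr_of_eventuallyEq ?_ (h u ⟨hm.1, hu.le⟩)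
  filter_upwards [mem_nhdsWithin_of_mem_nhds (Iio_mem_nhds hu), self_mem_nhdsWithin] with v hv hm'
  exact h v ⟨hm'.1, hv.le⟩

theorem IsPP.hasJet1 {n : ℕ} (hn : 1 ≤ n) {f : ℝ → ℝ} (hf : IsPP n f) :
    ∃ b c, HasJet1 f (f 0) b c := by
  obtain ⟨P, hP⟩ := hf
  have h : ∀ x ∈ Icc (0 : ℝ) (1 / n), f x = (P 0).eval x := fun x hx => hP 0 hn x (by simpa using hx)
  have := hasJet1_of_eval (by positivity) h
  rw [← h 0 ⟨le_rfl, by positivity⟩] at this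
  exact ⟨_, _, this⟩

theorem IsPP.comp_mirror {n : ℕ} {f : ℝ → ℝ} (hf : IsPP n f) (e : Bool) :
    IsPP n (fun x => f (mirror e x)) := by
  cases e
  · simpa [mirror] using hf
  obtain ⟨P, hP⟩ := hf
  refine ⟨fun m => (P (n - 1 - m)).comp (1 - X), fun m hm x hx => ?_⟩
  obtain ⟨m', rfl⟩ : ∃ m', n = m + m' + 1 := ⟨n - m - 1, by omega⟩
  have hn' : (0 : ℝ) < (m + m' + 1 : ℕ) := by positivity
  obtain ⟨ha, hb⟩ := hx
  rw [div_le_iff₀ hn'] at ha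
  rw [le_div_iff₀ hn'] at hb
  simp only [mirror, if_true]
  rw [show m + m' + 1 - 1 - m = m' by omega]
  rw [hP m' (by omega)]
  · simp
  · push_cast at ha hb
    constructor
    · rw [div_le_iff₀ hn']; push_cast; linarith
    · rw [le_div_iff₀ hn']; push_cast; linarith

/-- At an interior mesh point the derivatives within the two adjacent cells coincide and are joined
by taking the union; at 0 and 1 one cell is already a neighbourhood within [0, 1]. -/
theorem IsPP1.hasDerivWithinAt {n : ℕ} {f : ℝ → ℝ} {P : ℕ → ℝ[X]}
    (h1 : ∀ m < n, ∀ x ∈ Icc ((m : ℝ) / n) ((m + 1 : ℕ) / n), f x = (P m).eval x)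
    (h2 : ∀ m, m + 1 < n → (derivative (P m)).eval (((m + 1 : ℕ) : ℝ) / n)
      = (derivative (P (m + 1))).eval (((m + 1 : ℕ) : ℝ) / n))
    {m : ℕ} (hm : m < n) {x : ℝ} (hx : x ∈ Icc ((m : ℝ) / n) ((m + 1 : ℕ) / n)) :
    HasDerivWithinAt f ((derivative (P m)).eval x) (Icc 0 1) x := by
  have hn' : (0 : ℝ) < n := by exact_mod_cast (by omega : 0 < n)
  have step : ∀ m : ℕ, (m : ℝ) / n < ((m + 1 : ℕ) : ℝ) / n := fun m => by
    gcongr; exact_mod_cast Nat.lt_succ_self m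
  have hd : ∀ l, l < n → ∀ y ∈ Icc ((l : ℝ) / n) ((l + 1 : ℕ) / n),
      HasDerivWithinAt f ((derivative (P l)).eval y) (Icc ((l : ℝ) / n) ((l + 1 : ℕ) / n)) y :=
    fun l hl y hy => ((P l).hasDerivAt y).hasDerivWithinAt.congr (h1 l hl) (h1 l hl y hy)
  have knot : ∀ l, l + 1 < n →
      HasDerivWithinAt f ((derivative (P l)).eval (((l + 1 : ℕ) : ℝ) / n)) (Icc 0 1)
        (((l + 1 : ℕ) : ℝ) / n) := by
    intro l hl
    have a := hd l (by omega) _ ⟨(step l).le, le_rfl⟩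
    have b := hd (l + 1) hl _ ⟨le_rfl, (step _).le⟩
    rw [← h2 l hl] at b
    have c := a.union b
    rw [Icc_union_Icc_eq_Icc (step l).le (step _).le] at c
    exact (c.hasDerivAt (Icc_mem_nhds (step l) (step _))).hasDerivWithinAt
  rcases hx.1.lt_or_eq with hl | hl
  · rcases hx.2.lt_or_eq with hr | hr
    · exact ((hd m hm x hx).hasDerivAt (Icc_mem_nhds hl hr)).hasDerivWithinAt
    · subst hr
      rcases (Nat.succ_le_of_lt hm).lt_or_eq with hm' | hm'
      · exact knot m hm'
      · refine (hd m hm _ hx).mono_of_mem_nhdsWithin ?_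
        refine mem_nhdsWithin.2 ⟨Ioi ((m : ℝ) / n), isOpen_Ioi, hl, fun y hy => ⟨hy.1.le, ?_⟩⟩
        have : (((m + 1 : ℕ) : ℝ)) / n = 1 := by
          rw [← hm']; exact div_self (by rw [← hm'] at hn'; exact hn'.ne')
        rw [this]; exact hy.2.2
  · subst hl
    rcases m with _ | m
    · refine (hd 0 hm _ hx).mono_of_mem_nhdsWithin ?_
      refine mem_nhdsWithin.2 ⟨Iio (((0 + 1 : ℕ) : ℝ) / n), isOpen_Iio, step 0, fun y hy => ⟨?_, hy.1.le⟩⟩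
      simpa using hy.2.1
    · rw [← h2 m hm]; exact knot m hm

theorem IsPP1.differentiableOn {n : ℕ} (hn : 1 ≤ n) {f : ℝ → ℝ} (hf : IsPP1 n f) :
    DifferentiableOn ℝ f (Icc 0 1) := by
  obtain ⟨P, h1, h2⟩ := hf
  intro x hx
  obtain ⟨m, hm, h⟩ := exists_mem_elem hn hx
  exact (IsPP1.hasDerivWithinAt h1 h2 hm h).differentiableWithinAt

theorem IsPP1.isPP_deriv {n : ℕ} {f : ℝ → ℝ} (hf : IsPP1 n f) :
    IsPP n (derivWithin f (Icc 0 1)) := by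
  obtain ⟨P, h1, h2⟩ := hf
  exact ⟨fun m => derivative (P m), fun m hm x hx =>
    (IsPP1.hasDerivWithinAt h1 h2 hm hx).derivWithin (uniqueDiff01 (elem_subset hm hx))⟩

theorem HasJet1.deriv {n : ℕ} (hn : 1 ≤ n) {f : ℝ → ℝ} (hf : IsPP1 n f) {a b c : ℝ}
    (h : HasJet1 f a b c) : ∃ d, HasJet1 (derivWithin f (Icc 0 1)) b c d := by
  obtain ⟨P, h1, h2⟩ := hf
  have e1 : ∀ x ∈ Icc (0 : ℝ) (1 / n), f x = (P 0).eval x :=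
    fun x hx => h1 0 hn x (by simpa using hx)
  have e2 : ∀ x ∈ Icc (0 : ℝ) (1 / n), derivWithin f (Icc 0 1) x = (derivative (P 0)).eval x :=
    fun x hx => (IsPP1.hasDerivWithinAt h1 h2 hn (by simpa using hx)).derivWithin
      (uniqueDiff01 (elem_subset (m := 0) hn (by simpa using hx)))
  obtain ⟨rfl, rfl, rfl⟩ := h.unique (hasJet1_of_eval (by positivity) e1)
  exact ⟨_, hasJet1_of_eval (by positivity) e2⟩

/-! ### Jets of B-splines -/

theorem bspline_eq_eval_zero {p r n : ℕ} (hrp : r < p) (hn : 1 ≤ n) (i : ℕ) :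
    ∀ x ∈ Icc (0 : ℝ) (1 / n), bspline p r n i x = (elemPoly (knot p r n) p p i).eval x :=
  fun _ hx => bspline_eq_eval (m := 0) hrp hn i (by simpa using hx)

theorem knot_succ_pos {p r n : ℕ} (hrp : r < p) (hn : 1 ≤ n) : knot p r n (p + 1) = 1 / n := by
  have := knot_elemIdx_succ (n := n) (m := 0) hrp hn
  simpa [elemIdx] using this

/-- On the first cell the degree q pieces number p - q and p + 1 - q are the first two that do not
vanish identically; their values and slopes at 0 follow from each other by the recursion. For q = p
these are the first two B-splines. -/
theorem elemPoly_zero_jets {p r n : ℕ} (hrp : r < p) (hn : 1 ≤ n) (q i : ℕ) :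
    (i + q = p → (elemPoly (knot p r n) p q i).eval 0 = 1 ∧
      (derivative (elemPoly (knot p r n) p q i)).eval 0 = -(q * n)) ∧
    (i + q = p + 1 → (elemPoly (knot p r n) p q i).eval 0 = 0 ∧
      (derivative (elemPoly (knot p r n) p q i)).eval 0 = q * n) := by
  have hn' : (0 : ℝ) < n := by positivity
  have hp1 := knot_succ_pos hrp hn
  induction q generalizing i with
  | zero =>
    constructor <;> intro h <;> simp only [elemPoly]
    · rw [if_pos (by omega)]; simp
    · rw [if_neg (by omega)]; simp
  | succ q ih =>
    rw [eval_elemPoly_succ, eval_derivative_elemPoly_succ]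
    constructor <;> intro h
    · obtain ⟨e1, e2⟩ := (ih (i + 1)).1 (by omega)
      rw [e1, e2, knot_of_le (by omega : i + q + 1 ≤ p), knot_of_le (by omega : i ≤ p),
        knot_of_le (by omega : i + 1 ≤ p), show i + q + 2 = p + 1 by omega, hp1]
      constructor
      · field_simp; simp
      · push_cast; field_simp; simp; ring
    · obtain ⟨e1, e2⟩ := (ih i).1 (by omega)
      obtain ⟨e3, e4⟩ := (ih (i + 1)).2 (by omega)
      rw [e1, e2, e3, e4, knot_of_le (by omega : i ≤ p), show i + q + 1 = p + 1 by omega, hp1]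
      refine ⟨by simp, ?_⟩
      -- For q = 0 the knot i + 1 is no longer 0, but the second summand vanishes anyway because
      -- that piece has value and derivative 0.
      rcases Nat.eq_zero_or_pos q with rfl | hq
      · simp
      have : 0 < knot p r n (i + q + 2) :=
        lt_of_lt_of_le (by rw [hp1]; positivity) (knot_mono p r n (by omega : p + 1 ≤ i + q + 2))
      rw [knot_of_le (by omega : i + 1 ≤ p), sub_zero (knot p r n (i + q + 2)), div_self this.ne']
      push_cast
      simp
      ring

theorem hasJet1_bspline_zero {p r n : ℕ} (hrp : r < p) (hn : 1 ≤ n) :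
    ∃ c, HasJet1 (bspline p r n 0) 1 (-(p * n)) c := by
  have h := hasJet1_of_eval (by positivity) (bspline_eq_eval_zero hrp hn 0)
  obtain ⟨e1, e2⟩ := (elemPoly_zero_jets hrp hn p 0).1 (by omega)
  rw [e1, e2] at h
  exact ⟨_, h⟩

theorem hasJet1_bspline_one {p r n : ℕ} (hrp : r < p) (hn : 1 ≤ n) :
    ∃ c, HasJet1 (bspline p r n 1) 0 (p * n) c := by
  have h := hasJet1_of_eval (by positivity) (bspline_eq_eval_zero hrp hn 1)
  obtain ⟨e1, e2⟩ := (elemPoly_zero_jets hrp hn p 1).2 (by omega)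
  rw [e1, e2] at h
  exact ⟨_, h⟩

theorem elemPoly_zero_leading {p r n i : ℕ} (hrp : r < p) (hn : 1 ≤ n) (hi : i ≤ p) :
    ∃ Q : ℝ[X], elemPoly (knot p r n) p p i = X ^ i * Q ∧ 0 < Q.eval 0 := by
  obtain ⟨Q, hQ, hQ'⟩ := elemPoly_leading (knot_mono p r n) (q := p) (i := i) (s := p - i)
    (by omega) (by rw [knot_of_le (by omega), knot_of_le (by omega)])
    (by rw [knot_of_le (by omega), show i + (p - i) + 1 = p + 1 by omega, knot_succ_pos hrp hn]
        positivity)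
  rw [knot_of_le hi] at hQ hQ'
  exact ⟨Q, by rw [show i + (p - i) = p by omega, show p - (p - i) = i by omega] at hQ; simpa using hQ, hQ'⟩

theorem hasJet1_bspline_two {p r n : ℕ} (hrp : r < p) (hn : 1 ≤ n) (hp : 2 ≤ p) :
    ∃ c, c ≠ 0 ∧ HasJet1 (bspline p r n 2) 0 0 c := by
  have h := hasJet1_of_eval (by positivity) (bspline_eq_eval_zero hrp hn 2)
  obtain ⟨Q, hQ, hQ'⟩ := elemPoly_zero_leading hrp hn hp
  rw [hQ] at h
  refine ⟨2 * Q.eval 0, by positivity, ?_⟩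
  convert h using 1 <;> simp
  norm_num

theorem hasJet1_bspline_of_three_le {p r n i : ℕ} (hrp : r < p) (hn : 1 ≤ n) (hi : 3 ≤ i) :
    HasJet1 (bspline p r n i) 0 0 0 := by
  have h := hasJet1_of_eval (by positivity) (bspline_eq_eval_zero hrp hn i)
  rcases Nat.lt_or_ge p i with hip | hip
  · rw [elemPoly_eq_zero_of_lt _ hip] at h
    simpa using h
  · obtain ⟨Q, hQ, -⟩ := elemPoly_zero_leading hrp hn hip
    obtain ⟨j, rfl⟩ := Nat.exists_eq_add_of_le hi
    rw [hQ] at h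
    rw [pow_add] at h
    convert h using 1 <;> simp

theorem hasJet1_bspline_of_two_le {p r n i : ℕ} (hrp : r < p) (hn : 1 ≤ n) (hi : 2 ≤ i) :
    ∃ c, HasJet1 (bspline p r n i) 0 0 c := by
  have h := hasJet1_of_eval (by positivity) (bspline_eq_eval_zero hrp hn i)
  rcases Nat.lt_or_ge p i with hip | hip
  · rw [elemPoly_eq_zero_of_lt _ hip] at h
    exact ⟨0, by simpa using h⟩
  · obtain ⟨Q, hQ, -⟩ := elemPoly_zero_leading hrp hn hip
    obtain ⟨j, rfl⟩ := Nat.exists_eq_add_of_le hi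
    rw [hQ] at h
    rw [pow_add] at h
    exact ⟨_, by convert h using 1 <;> simp⟩

end ApproxC1
end

noncomputable section
namespace ApproxC1
open Filter Topology

/-! ## Two-jets at the origin of functions on the square -/

instance : Fintype C2Index :=
  ⟨{.val, .dx, .dy, .dxx, .dxy, .dyy}, fun q => by cases q <;> decide⟩

theorem C2Index.sum_eq {X : Type*} [AddCommMonoid X] (f : C2Index → X) :
    ∑ q, f q = f .val + f .dx + f .dy + f .dxx + f .dxy + f .dyy := by
  have : (Finset.univ : Finset C2Index) = {.val, .dx, .dy, .dxx, .dxy, .dyy} := rfl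
  rw [this]
  repeat rw [Finset.sum_insert (by decide)]
  rw [Finset.sum_singleton]
  simp only [add_assoc]

/-- `gu`, `gv` are the first derivatives of `g` on the axes near the origin, and `j` consists of
the derivatives of `g` up to order two at the origin. -/
structure HasJet2With (g gu gv : ℝ × ℝ → ℝ) (j : C2Index → ℝ) : Prop where
  du_u : ∀ᶠ u in 𝓝[Icc 0 1] 0, HasDerivWithinAt (fun s => g (s, 0)) (gu (u, 0)) (Icc 0 1) u
  du_v : ∀ᶠ v in 𝓝[Icc 0 1] 0, HasDerivWithinAt (fun s => g (s, v)) (gu (0, v)) (Icc 0 1) 0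
  dv_v : ∀ᶠ v in 𝓝[Icc 0 1] 0, HasDerivWithinAt (fun s => g (0, s)) (gv (0, v)) (Icc 0 1) v
  dv_u : ∀ᶠ u in 𝓝[Icc 0 1] 0, HasDerivWithinAt (fun s => g (u, s)) (gv (u, 0)) (Icc 0 1) 0
  val : g (0, 0) = j .val
  dx : gu (0, 0) = j .dx
  dy : gv (0, 0) = j .dy
  dxx : HasDerivWithinAt (fun u => gu (u, 0)) (j .dxx) (Icc 0 1) 0
  dxy : HasDerivWithinAt (fun v => gu (0, v)) (j .dxy) (Icc 0 1) 0
  dyx : HasDerivWithinAt (fun u => gv (u, 0)) (j .dxy) (Icc 0 1) 0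
  dyy : HasDerivWithinAt (fun v => gv (0, v)) (j .dyy) (Icc 0 1) 0

/-- `j` consists of the derivatives of `g` up to order two at the origin, within the square. -/
def HasJet2 (g : ℝ × ℝ → ℝ) (j : C2Index → ℝ) : Prop := ∃ gu gv, HasJet2With g gu gv j

theorem zero_mem_square : ((0, 0) : ℝ × ℝ) ∈ square := ⟨zero_mem01, zero_mem01⟩

theorem HasJet2.congr {g g' : ℝ × ℝ → ℝ} {j : C2Index → ℝ} (h : HasJet2 g j)
    (e : ∀ x ∈ square, g' x = g x) : HasJet2 g' j := by
  obtain ⟨gu, gv, h⟩ := h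
  refine ⟨gu, gv, ?_, ?_, ?_, ?_, ?_, h.dx, h.dy, h.dxx, h.dxy, h.dyx, h.dyy⟩
  · filter_upwards [h.du_u, self_mem_nhdsWithin] with u hu hm
    exact hu.congr (fun s hs => e _ ⟨hs, zero_mem01⟩) (e _ ⟨hm, zero_mem01⟩)
  · filter_upwards [h.du_v, self_mem_nhdsWithin] with u hu hm
    exact hu.congr (fun s hs => e _ ⟨hs, hm⟩) (e _ ⟨zero_mem01, hm⟩)
  · filter_upwards [h.dv_v, self_mem_nhdsWithin] with u hu hm
    exact hu.congr (fun s hs => e _ ⟨zero_mem01, hs⟩) (e _ ⟨zero_mem01, hm⟩)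
  · filter_upwards [h.dv_u, self_mem_nhdsWithin] with u hu hm
    exact hu.congr (fun s hs => e _ ⟨hm, hs⟩) (e _ ⟨hm, zero_mem01⟩)
  · rw [e _ zero_mem_square, h.val]

theorem HasJet2.add {g g' : ℝ × ℝ → ℝ} {j j' : C2Index → ℝ} (h : HasJet2 g j)
    (h' : HasJet2 g' j') : HasJet2 (g + g') (j + j') := by
  obtain ⟨gu, gv, h⟩ := h
  obtain ⟨gu', gv', h'⟩ := h'
  refine ⟨gu + gu', gv + gv', ?_, ?_, ?_, ?_, ?_, ?_, ?_, h.dxx.add h'.dxx, h.dxy.add h'.dxy,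
    h.dyx.add h'.dyx, h.dyy.add h'.dyy⟩
  · filter_upwards [h.du_u, h'.du_u] with u a b using a.add b
  · filter_upwards [h.du_v, h'.du_v] with u a b using a.add b
  · filter_upwards [h.dv_v, h'.dv_v] with u a b using a.add b
  · filter_upwards [h.dv_u, h'.dv_u] with u a b using a.add b
  · simp [h.val, h'.val]
  · simp [h.dx, h'.dx]
  · simp [h.dy, h'.dy]

theorem HasJet2.smul {g : ℝ × ℝ → ℝ} {j : C2Index → ℝ} (a : ℝ) (h : HasJet2 g j) :
    HasJet2 (a • g) (a • j) := by
  obtain ⟨gu, gv, h⟩ := h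
  refine ⟨a • gu, a • gv, ?_, ?_, ?_, ?_, ?_, ?_, ?_, h.dxx.const_mul a, h.dxy.const_mul a,
    h.dyx.const_mul a, h.dyy.const_mul a⟩
  · filter_upwards [h.du_u] with u b using b.const_mul a
  · filter_upwards [h.du_v] with u b using b.const_mul a
  · filter_upwards [h.dv_v] with u b using b.const_mul a
  · filter_upwards [h.dv_u] with u b using b.const_mul a
  · simp [h.val]
  · simp [h.dx]
  · simp [h.dy]

theorem hasJet2_zero : HasJet2 0 0 :=
  ⟨0, 0, Eventually.of_forall fun _ => hasDerivWithinAt_const .., Eventually.of_forall fun _ =>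
    hasDerivWithinAt_const .., Eventually.of_forall fun _ => hasDerivWithinAt_const ..,
    Eventually.of_forall fun _ => hasDerivWithinAt_const .., rfl, rfl, rfl,
    hasDerivWithinAt_const .., hasDerivWithinAt_const .., hasDerivWithinAt_const ..,
    hasDerivWithinAt_const ..⟩

theorem HasJet2.sub {g g' : ℝ × ℝ → ℝ} {j j' : C2Index → ℝ} (h : HasJet2 g j)
    (h' : HasJet2 g' j') : HasJet2 (g - g') (j - j') := by
  have := h.add (h'.smul (-1))
  simpa [sub_eq_add_neg] using this

theorem HasJet2.sum {ι : Type*} (s : Finset ι) {g : ι → ℝ × ℝ → ℝ} {j : ι → C2Index → ℝ}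
    (h : ∀ i ∈ s, HasJet2 (g i) (j i)) : HasJet2 (∑ i ∈ s, g i) (∑ i ∈ s, j i) := by
  classical
  induction s using Finset.induction_on with
  | empty => simpa using hasJet2_zero
  | insert i s hi ih =>
    rw [Finset.sum_insert hi, Finset.sum_insert hi]
    exact (h i (Finset.mem_insert_self i s)).add
      (ih fun k hk => h k (Finset.mem_insert_of_mem hk))

/-- The index of the derivative with the two variables exchanged. -/
def C2Index.swap : C2Index → C2Index
  | .val => .val
  | .dx => .dy
  | .dy => .dx
  | .dxx => .dyy
  | .dxy => .dxy
  | .dyy => .dxx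

theorem HasJet2.swap {g : ℝ × ℝ → ℝ} {j : C2Index → ℝ} (h : HasJet2 g j) :
    HasJet2 (fun x => g (x.2, x.1)) (fun q => j q.swap) := by
  obtain ⟨gu, gv, h⟩ := h
  exact ⟨fun x => gv (x.2, x.1), fun x => gu (x.2, x.1), h.dv_v, h.dv_u, h.du_u, h.du_v, h.val,
    h.dy, h.dx, h.dyy, h.dyx, h.dxy, h.dxx⟩

theorem HasJet2.jet1_fst {g : ℝ × ℝ → ℝ} {j : C2Index → ℝ} (h : HasJet2 g j) :
    HasJet1 (fun u => g (u, 0)) (j .val) (j .dx) (j .dxx) := by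
  obtain ⟨gu, gv, h⟩ := h
  exact ⟨_, h.du_u, h.dxx, h.val, h.dx⟩

theorem HasJet2.jet1_snd {g : ℝ × ℝ → ℝ} {j : C2Index → ℝ} (h : HasJet2 g j) :
    HasJet1 (fun v => g (0, v)) (j .val) (j .dy) (j .dyy) := by
  obtain ⟨gu, gv, h⟩ := h
  exact ⟨_, h.dv_v, h.dyy, h.val, h.dy⟩

/-- The two-jet of a tensor product. -/
def tensJet (a b c a' b' c' : ℝ) : C2Index → ℝ
  | .val => a * a'
  | .dx => b * a'
  | .dy => a * b'
  | .dxx => c * a'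
  | .dxy => b * b'
  | .dyy => a * c'

theorem HasJet1.tens {f h : ℝ → ℝ} {a b c a' b' c' : ℝ} (hf : HasJet1 f a b c)
    (hh : HasJet1 h a' b' c') :
    HasJet2 (fun x => f x.1 * h x.2) (tensJet a b c a' b' c') := by
  have df := hf.hasDerivWithinAt
  have dh := hh.hasDerivWithinAt
  obtain ⟨f', h1, h2, rfl, rfl⟩ := hf
  obtain ⟨h', k1, k2, rfl, rfl⟩ := hh
  refine ⟨fun x => f' x.1 * h x.2, fun x => f x.1 * h' x.2, ?_, ?_, ?_, ?_, rfl, rfl, rfl,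
    h2.mul_const (h 0), dh.const_mul (f' 0), df.mul_const (h' 0), k2.const_mul (f 0)⟩
  · filter_upwards [h1] with u hu using hu.mul_const _
  · exact Eventually.of_forall fun v => df.mul_const (h v)
  · filter_upwards [k1] with u hu using hu.const_mul _
  · exact Eventually.of_forall fun v => dh.const_mul (f v)

theorem HasJet1.tens_zero_left {f h : ℝ → ℝ} {a' b' c' : ℝ} (hf : HasJet1 f 0 0 0)
    (hh : HasJet1 h a' b' c') : HasJet2 (fun x => f x.1 * h x.2) 0 := by
  convert hf.tens hh using 1
  funext q; cases q <;> simp [tensJet]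

theorem HasJet1.tens_zero_right {f h : ℝ → ℝ} {a b c : ℝ} (hf : HasJet1 f a b c)
    (hh : HasJet1 h 0 0 0) : HasJet2 (fun x => f x.1 * h x.2) 0 := by
  convert hf.tens hh using 1
  funext q; cases q <;> simp [tensJet]

theorem HasJet1.tens_zero_mixed {f h : ℝ → ℝ} {c b' c' : ℝ} (hf : HasJet1 f 0 0 c)
    (hh : HasJet1 h 0 b' c') : HasJet2 (fun x => f x.1 * h x.2) 0 := by
  convert hf.tens hh using 1
  funext q; cases q <;> simp [tensJet]

/-- The derivatives of `g` at the origin that occur in `HasC2Data`. -/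
def axisJet (g : ℝ × ℝ → ℝ) : C2Index → ℝ
  | .val => g (0, 0)
  | .dx => dU g (0, 0)
  | .dy => dV g (0, 0)
  | .dxx => dU (dU g) (0, 0)
  | .dxy => dV (dU g) (0, 0)
  | .dyy => dV (dV g) (0, 0)

/-- The iterated derivatives at the origin only see the first derivatives along the two axes near
the origin, so the information on the axes in `HasJet2With` is enough. It is also stable under sums,
which bare values of `derivWithin` are not. -/
theorem HasJet2.axisJet_eq {g : ℝ × ℝ → ℝ} {j : C2Index → ℝ} (h : HasJet2 g j) :
    axisJet g = j := by
  obtain ⟨gu, gv, h⟩ := h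
  have u0 := uniqueDiff01 zero_mem01
  have e1 : (fun u => dU g (u, 0)) =ᶠ[𝓝[Icc 0 1] 0] fun u => gu (u, 0) := by
    filter_upwards [h.du_u, self_mem_nhdsWithin] with u hu hm
    exact hu.derivWithin (uniqueDiff01 hm)
  have e2 : (fun v => dU g (0, v)) =ᶠ[𝓝[Icc 0 1] 0] fun v => gu (0, v) := by
    filter_upwards [h.du_v] with u hu
    exact hu.derivWithin u0
  have e3 : (fun v => dV g (0, v)) =ᶠ[𝓝[Icc 0 1] 0] fun v => gv (0, v) := by
    filter_upwards [h.dv_v, self_mem_nhdsWithin] with u hu hm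
    exact hu.derivWithin (uniqueDiff01 hm)
  have f1 := e1.self_of_nhdsWithin zero_mem01
  have f2 := e2.self_of_nhdsWithin zero_mem01
  have f3 := e3.self_of_nhdsWithin zero_mem01
  funext q
  cases q
  · exact h.val
  · exact f1.trans h.dx
  · exact f3.trans h.dy
  · exact (h.dxx.congr_of_eventuallyEq e1 f1).derivWithin u0
  · exact (h.dxy.congr_of_eventuallyEq e2 f2).derivWithin u0
  · exact (h.dyy.congr_of_eventuallyEq e3 f3).derivWithin u0

theorem HasJet2.unique {g : ℝ × ℝ → ℝ} {j j' : C2Index → ℝ} (h : HasJet2 g j)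
    (h' : HasJet2 g j') : j = j' := h.axisJet_eq.symm.trans h'.axisJet_eq

/-- The two-jet at the origin of the pull-back by `F` of a function with `C²`-data `Φ`. -/
def pullJet (F : ℝ × ℝ → Plane) : (C2Index → ℝ) →ₗ[ℝ] C2Index → ℝ where
  toFun Φ := fun
    | .val => Φ .val
    | .dx => gradAt Φ (dU F (0, 0))
    | .dy => gradAt Φ (dV F (0, 0))
    | .dxx => hessAt Φ (dU F (0, 0)) (dU F (0, 0)) + gradAt Φ (dU (dU F) (0, 0))
    | .dxy => hessAt Φ (dU F (0, 0)) (dV F (0, 0)) + gradAt Φ (dV (dU F) (0, 0))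
    | .dyy => hessAt Φ (dV F (0, 0)) (dV F (0, 0)) + gradAt Φ (dV (dV F) (0, 0))
  map_add' Φ Ψ := by
    funext q; cases q <;> simp [gradAt, hessAt] <;> ring
  map_smul' a Φ := by
    funext q; cases q <;> simp [gradAt, hessAt] <;> ring

theorem hasC2Data_origin_iff (F : ℝ × ℝ → Plane) (g : ℝ × ℝ → ℝ) (Φ : C2Index → ℝ) :
    HasC2Data F (0, 0) g Φ ↔ axisJet g = pullJet F Φ := by
  constructor
  · rintro ⟨h1, h2, h3, h4, h5, h6⟩
    funext q; cases q <;> assumption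
  · intro h
    exact ⟨congrFun h .val, congrFun h .dx, congrFun h .dy, congrFun h .dxx, congrFun h .dxy,
      congrFun h .dyy⟩

/-- The chain rule is block triangular: the gradient is multiplied by the Jacobian, and, once the
gradient is 0, the Hessian undergoes a congruence by the Jacobian. Both are inverted with the
adjugate, whose entries are the coefficients of the linear combinations. -/
theorem pullJet_injective {F : ℝ × ℝ → Plane} (hF : det2 (dU F (0, 0)) (dV F (0, 0)) ≠ 0) :
    Function.Injective (pullJet F) := by
  rw [injective_iff_map_eq_zero]
  intro Φ h
  have h1 := congrFun h .val
  have h2 := congrFun h .dx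
  have h3 := congrFun h .dy
  have h4 := congrFun h .dxx
  have h5 := congrFun h .dxy
  have h6 := congrFun h .dyy
  simp only [pullJet, LinearMap.coe_mk, AddHom.coe_mk, gradAt, hessAt, Pi.zero_apply] at h1 h2 h3 h4 h5 h6
  unfold det2 at hF
  generalize dU F (0, 0) = a at *
  generalize dV F (0, 0) = b at *
  have hx : Φ .dx = 0 := by
    refine (mul_eq_zero.1 (?_ : _ * (a 0 * b 1 - a 1 * b 0) = 0)).resolve_right hF
    linear_combination b 1 * h2 - a 1 * h3
  have hy : Φ .dy = 0 := by
    refine (mul_eq_zero.1 (?_ : _ * (a 0 * b 1 - a 1 * b 0) = 0)).resolve_right hF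
    linear_combination -b 0 * h2 + a 0 * h3
  rw [hx, hy] at h4 h5 h6
  have hF2 : (a 0 * b 1 - a 1 * b 0) ^ 2 ≠ 0 := pow_ne_zero 2 hF
  have hxx : Φ .dxx = 0 := by
    refine (mul_eq_zero.1 (?_ : _ * (a 0 * b 1 - a 1 * b 0) ^ 2 = 0)).resolve_right hF2
    linear_combination b 1 ^ 2 * h4 - 2 * a 1 * b 1 * h5 + a 1 ^ 2 * h6
  have hxy : Φ .dxy = 0 := by
    refine (mul_eq_zero.1 (?_ : _ * (a 0 * b 1 - a 1 * b 0) ^ 2 = 0)).resolve_right hF2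
    linear_combination -b 0 * b 1 * h4 + (a 0 * b 1 + a 1 * b 0) * h5 - a 0 * a 1 * h6
  have hyy : Φ .dyy = 0 := by
    refine (mul_eq_zero.1 (?_ : _ * (a 0 * b 1 - a 1 * b 0) ^ 2 = 0)).resolve_right hF2
    linear_combination b 0 ^ 2 * h4 - 2 * a 0 * b 0 * h5 + a 0 ^ 2 * h6
  funext q
  cases q <;> assumption

/-! ### Reflections of the square -/

/-- The reflection of the square that maps the origin to the vertex `c`. -/
def flip (c : Corner) (x : ℝ × ℝ) : ℝ × ℝ := (mirror c.1 x.1, mirror c.2 x.2)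

theorem flip_flip (c : Corner) (x : ℝ × ℝ) : flip c (flip c x) = x := by
  simp [flip, mirror_mirror]

theorem flip_mem {c : Corner} {x : ℝ × ℝ} (hx : x ∈ square) : flip c x ∈ square :=
  ⟨mirror_mem hx.1, mirror_mem hx.2⟩

theorem flip_zero (c : Corner) : flip c (0, 0) = c.pt := rfl

section

variable {X : Type*} [NormedAddCommGroup X] [NormedSpace ℝ X]

theorem dU_flip (g : ℝ × ℝ → X) (c : Corner) :
    dU (fun x => g (flip c x)) = fun x => sgn c.1 • dU g (flip c x) := by
  funext x
  exact derivWithin_mirror (fun u => g (u, mirror c.2 x.2)) c.1 x.1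

theorem dV_flip (g : ℝ × ℝ → X) (c : Corner) :
    dV (fun x => g (flip c x)) = fun x => sgn c.2 • dV g (flip c x) := by
  funext x
  exact derivWithin_mirror (fun v => g (mirror c.1 x.1, v)) c.2 x.2

theorem dU_smul (a : ℝ) (g : ℝ × ℝ → X) (x : ℝ × ℝ) : dU (fun x => a • g x) x = a • dU g x :=
  derivWithin_const_smul_field ..

theorem dV_smul (a : ℝ) (g : ℝ × ℝ → X) (x : ℝ × ℝ) : dV (fun x => a • g x) x = a • dV g x :=
  derivWithin_const_smul_field ..

end

/-- A reflection multiplies both sides of every chain rule equation by the same sign. Hence all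
vertices can be moved to the origin. -/
theorem hasC2Data_flip (F : ℝ × ℝ → Plane) (c : Corner) (g : ℝ × ℝ → ℝ) (Φ : C2Index → ℝ) :
    HasC2Data F c.pt g Φ ↔ axisJet (fun x => g (flip c x)) = pullJet (fun x => F (flip c x)) Φ := by
  rw [← hasC2Data_origin_iff]
  unfold HasC2Data
  simp only [dU_flip, dV_flip, dU_smul, dV_smul, flip_zero]
  have g1 : ∀ (a : ℝ) v, gradAt Φ (a • v) = a * gradAt Φ v := fun a v => by simp [gradAt]; ring
  have h1 : ∀ (a b : ℝ) v w, hessAt Φ (a • v) (b • w) = a * (b * hessAt Φ v w) := fun a b v w => by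
    simp [hessAt]; ring
  have hs : ∀ e, sgn e ≠ 0 := fun e => by cases e <;> simp [sgn]
  simp only [g1, h1, smul_eq_mul, ← mul_add, mul_right_inj' (hs _)]

end ApproxC1
end

noncomputable section
namespace ApproxC1
open Filter Topology

/-! ## Functions near an edge and near a vertex, in local coordinates -/

theorem add_le_splineDim {p r n : ℕ} (hrp : r < p) : p + n ≤ splineDim p r n := by
  unfold splineDim
  have := Nat.mul_le_mul_right (n - 1) (show 1 ≤ p - r by omega)
  omega

theorem hasJet1_bspline_reflect {p r n i : ℕ} (hrp : r < p) (hn : 1 ≤ n)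
    (hi : i + 4 ≤ splineDim p r n) :
    HasJet1 (fun x => bspline p r n i (mirror true x)) 0 0 0 :=
  (hasJet1_bspline_of_three_le hrp hn (i := splineDim p r n - 1 - i) (by omega)).congr fun x hx => by
    simpa [mirror] using bspline_reflect hrp hn (i' := splineDim p r n - 1 - i) (by omega) hx

theorem bspline_apply_zero {p r n i : ℕ} (hrp : r < p) (hn : 1 ≤ n) :
    bspline p r n i 0 = if i = 0 then 1 else 0 := by
  rcases i with _ | _ | i
  · obtain ⟨_, _, _, _, h, _⟩ := hasJet1_bspline_zero hrp hn
    simpa using h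
  · obtain ⟨_, _, _, _, h, _⟩ := hasJet1_bspline_one hrp hn
    simpa using h
  · obtain ⟨_, _, _, _, h, _⟩ := hasJet1_bspline_of_two_le hrp hn (i := i + 2) (by omega)
    simpa using h

theorem bspline_apply_one {p r n i : ℕ} (hrp : r < p) (hn : 1 ≤ n) (hi : i + 2 ≤ splineDim p r n) :
    bspline p r n i 1 = 0 := by
  have := bspline_reflect hrp hn (i := i) (i' := splineDim p r n - 1 - i) (by omega) zero_mem01
  rw [sub_zero, bspline_apply_zero hrp hn, if_neg (by omega)] at this
  exact this

/-- Linear combinations of the first three B-splines. -/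
def lead (p r n : ℕ) (e : ℕ → ℝ) (u : ℝ) : ℝ :=
  e 0 * bspline p r n 0 u + e 1 * bspline p r n 1 u + e 2 * bspline p r n 2 u

theorem lead_eq_zero {p r n : ℕ} (hrp : r < p) (hn : 1 ≤ n) (hp : 2 ≤ p) {e : ℕ → ℝ}
    (h : HasJet1 (lead p r n e) 0 0 0) (u : ℝ) : lead p r n e u = 0 := by
  obtain ⟨x, h0⟩ := hasJet1_bspline_zero hrp hn
  obtain ⟨y, h1⟩ := hasJet1_bspline_one hrp hn
  obtain ⟨z, hz, h2⟩ := hasJet1_bspline_two hrp hn hp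
  obtain ⟨a, b, c⟩ := h.unique (((h0.const_mul (e 0)).add (h1.const_mul (e 1))).add (h2.const_mul (e 2)))
  have hpn : (p : ℝ) * n ≠ 0 := by
    have : 0 < p * n := Nat.mul_pos (by omega) hn
    exact_mod_cast this.ne'
  have e0 : e 0 = 0 := by linarith
  have e1 : e 1 = 0 := by
    rw [e0] at b
    exact (mul_eq_zero.1 (by linarith : e 1 * (p * n) = 0)).resolve_right hpn
  have e2 : e 2 = 0 := by
    rw [e0, e1] at c
    exact (mul_eq_zero.1 (by linarith : e 2 * z = 0)).resolve_right hz
  simp [lead, e0, e1, e2]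

/-- The two-jets of the first three B-splines form a triangular matrix with nonzero diagonal. This
uniqueness makes the correction term cancel on the axes and the traces of vertex functions on
neighbouring patches agree. -/
theorem lead_eq_of_hasJet1 {p r n : ℕ} (hrp : r < p) (hn : 1 ≤ n) (hp : 2 ≤ p) {e e' : ℕ → ℝ}
    {a b c : ℝ} (h : HasJet1 (lead p r n e) a b c) (h' : HasJet1 (lead p r n e') a b c) (u : ℝ) :
    lead p r n e u = lead p r n e' u := by
  have k : ∀ v, lead p r n (fun i => e i - e' i) v = lead p r n e v - lead p r n e' v := fun v => by
    unfold lead; ring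
  have := lead_eq_zero hrp hn hp (e := fun i => e i - e' i)
    ((h.add (h'.const_mul (-1))).congr (fun x _ => by rw [k]; ring) |> fun t => by
      convert t using 1 <;> ring) u
  rw [k] at this
  linarith

/-- The slope function `α b⁻ + β (b⁺)'`. -/
def slope (A B bp bm : ℝ → ℝ) (t : ℝ) : ℝ := A t * bm t + B t * derivWithin bp (Icc 0 1) t

/-- The function with trace `f` and slope `y` on the edge `x.2 = 0`. -/
def strip (p r n : ℕ) (f y : ℝ → ℝ) (x : ℝ × ℝ) : ℝ :=
  f x.1 * (bspline p r n 0 x.2 + bspline p r n 1 x.2) + y x.1 * ((1 / n : ℝ) / p) * bspline p r n 1 x.2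

/-- Reversing the edge parameter changes the sign of (b⁺)', which is absorbed into the second gluing
function. -/
theorem slope_mirror (A B bp bm : ℝ → ℝ) (e : Bool) (t : ℝ) :
    slope A B bp bm (mirror e t) = slope (fun t => A (mirror e t)) (fun t => sgn e * B (mirror e t))
      (fun t => bp (mirror e t)) (fun t => bm (mirror e t)) t := by
  unfold slope
  rw [derivWithin_mirror, smul_eq_mul]
  linear_combination (-B (mirror e t) * derivWithin bp (Icc 0 1) (mirror e t)) * sgn_mul_self e

theorem isPP1_zero (n : ℕ) : IsPP1 n (fun _ => 0) := ⟨fun _ => 0, by simp, by simp⟩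

theorem IsPP1.congr {n : ℕ} {f g : ℝ → ℝ} (hf : IsPP1 n f) (h : ∀ x ∈ Icc (0 : ℝ) 1, g x = f x) :
    IsPP1 n g := by
  obtain ⟨P, h1, h2⟩ := hf
  exact ⟨P, fun m hm x hx => by rw [h x (elem_subset hm hx), h1 m hm x hx], h2⟩

theorem isPP_slope {n : ℕ} {A B bp bm : ℝ → ℝ} (hA : IsPP n A) (hB : IsPP n B) (hbp : IsPP1 n bp)
    (hbm : IsPP n bm) : IsPP n (slope A B bp bm) := (hA.mul hbm).add (hB.mul hbp.isPP_deriv)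

theorem hasJet1_slope {n : ℕ} (hn : 1 ≤ n) {A B bp bm : ℝ → ℝ} (hA : IsPP n A) (hB : IsPP n B)
    (hbp : IsPP1 n bp) {a b c m0 m1 m2 : ℝ} (jp : HasJet1 bp a b c) (jm : HasJet1 bm m0 m1 m2) :
    ∃ A1 B1 d, HasJet1 (slope A B bp bm) (A 0 * m0 + B 0 * b)
      ((A1 * m0 + A 0 * m1) + (B1 * b + B 0 * c)) d := by
  obtain ⟨A1, A2, jA⟩ := hA.hasJet1 hn
  obtain ⟨B1, B2, jB⟩ := hB.hasJet1 hn
  obtain ⟨d, jd⟩ := jp.deriv hn hbp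
  exact ⟨A1, B1, _, (jA.mul jm).add (jB.mul jd)⟩

section Strip

variable {p r n : ℕ}

/-- The slopes -pn and pn of the first two B-splines cancel in their sum. With `hasJet1_cross_one`,
where h/p normalizes the slope pn, this is a Hermite pair across the edge: trace and transversal
derivative can be prescribed separately. -/
theorem hasJet1_cross_zero (hrp : r < p) (hn : 1 ≤ n) :
    ∃ w, HasJet1 (fun d => bspline p r n 0 d + bspline p r n 1 d) 1 0 w := by
  obtain ⟨x, h0⟩ := hasJet1_bspline_zero hrp hn
  obtain ⟨y, h1⟩ := hasJet1_bspline_one hrp hn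
  exact ⟨_, by simpa using h0.add h1⟩

theorem hasJet1_cross_one (hrp : r < p) (hn : 1 ≤ n) :
    ∃ z, HasJet1 (fun d => ((1 / n : ℝ) / p) * bspline p r n 1 d) 0 1 z := by
  obtain ⟨y, h1⟩ := hasJet1_bspline_one hrp hn
  have hp' : (p : ℝ) ≠ 0 := by exact_mod_cast (by omega : p ≠ 0)
  have hn' : (n : ℝ) ≠ 0 := by positivity
  have h := h1.const_mul ((1 / n : ℝ) / p)
  rw [mul_zero, show ((1 / n : ℝ) / p) * (p * n) = 1 by field_simp] at h
  exact ⟨_, h⟩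

theorem exists_hasJet2_strip (hrp : r < p) (hn : 1 ≤ n) : ∃ w z, ∀ {f y : ℝ → ℝ} {a b c a' b' c' : ℝ},
    HasJet1 f a b c → HasJet1 y a' b' c' →
      HasJet2 (strip p r n f y) (tensJet a b c 1 0 w + tensJet a' b' c' 0 1 z) := by
  obtain ⟨w, hw⟩ := hasJet1_cross_zero hrp hn
  obtain ⟨z, hz⟩ := hasJet1_cross_one hrp hn
  exact ⟨w, z, fun hf hy => ((hf.tens hw).add (hy.tens hz)).congr fun x _ => by
    simp only [strip, Pi.add_apply]; ring⟩

/-- The factor of y across the edge vanishes at 0, so only the value and the first derivative of y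
enter the two-jet. -/
theorem hasJet2_strip_zero (hrp : r < p) (hn : 1 ≤ n) {f y : ℝ → ℝ} {c : ℝ}
    (hf : HasJet1 f 0 0 0) (hy : HasJet1 y 0 0 c) : HasJet2 (strip p r n f y) 0 := by
  obtain ⟨w, z, h⟩ := exists_hasJet2_strip hrp hn
  convert h hf hy using 1
  funext q; cases q <;> simp [tensJet]

/-- With at least six B-splines, the first two have index at least 3 when counted from the opposite
edge, so their two-jets vanish there. -/
theorem hasJet2_strip_far (hrp : r < p) (hn : 1 ≤ n) (hN : 6 ≤ p + n) {f y : ℝ → ℝ}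
    {a b c a' b' c' : ℝ} (hf : HasJet1 f a b c) (hy : HasJet1 y a' b' c') :
    HasJet2 (fun x => strip p r n f y (x.1, mirror true x.2)) 0 := by
  have hN := add_le_splineDim hrp (n := n)
  have h0 := hasJet1_bspline_reflect hrp hn (i := 0) (by omega)
  have h1 := hasJet1_bspline_reflect hrp hn (i := 1) (by omega)
  have hw := h0.add h1
  have hz := h1.const_mul ((1 / n : ℝ) / p)
  simp only [add_zero, mul_zero] at hw hz
  convert ((hf.tens_zero_right hw).add (hy.tens_zero_right hz)).congr fun x _ => ?_ using 1
  · simp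
  · simp only [strip, Pi.add_apply]; ring

theorem strip_bottom (hrp : r < p) (hn : 1 ≤ n) (f y : ℝ → ℝ) (t : ℝ) :
    strip p r n f y (t, 0) = f t := by
  simp [strip, bspline_apply_zero hrp hn]

theorem strip_top (hrp : r < p) (hn : 1 ≤ n) (hN : 6 ≤ p + n) (f y : ℝ → ℝ) (t : ℝ) :
    strip p r n f y (t, 1) = 0 := by
  have hN := add_le_splineDim hrp (n := n)
  simp [strip, bspline_apply_one hrp hn (i := 0) (by omega),
    bspline_apply_one hrp hn (i := 1) (by omega)]

theorem continuousOn_strip (hrp : r < p) (hn : 1 ≤ n) {f y : ℝ → ℝ} (hf : IsPP n f) (hy : IsPP n y) :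
    ContinuousOn (strip p r n f y) square := by
  have h1 : MapsTo (Prod.fst : ℝ × ℝ → ℝ) square (Icc 0 1) := fun x hx => hx.1
  have h2 : MapsTo (Prod.snd : ℝ × ℝ → ℝ) square (Icc 0 1) := fun x hx => hx.2
  have c0 := ((isPP_bspline hrp n 0).continuousOn hn).comp continuousOn_snd h2
  have c1 := ((isPP_bspline hrp n 1).continuousOn hn).comp continuousOn_snd h2
  exact (((hf.continuousOn hn).comp continuousOn_fst h1).mul (c0.add c1)).add
    ((((hy.continuousOn hn).comp continuousOn_fst h1).mul continuousOn_const).mul c1)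

end Strip

/-! ### Systems of six functions at a vertex -/

/-- Six functions on the square with linearly independent two-jets at the origin that vanish near
the other vertices and on the opposite edges, and whose traces on the two axes are spanned by the
first three B-splines of regularities `ρ` and `σ`. -/
structure CornerSystem (p n ρ σ : ℕ) (G : C2Index → ℝ × ℝ → ℝ) : Prop where
  jets : ∃ j : C2Index → C2Index → ℝ, (∀ q, HasJet2 (G q) (j q)) ∧ LinearIndependent ℝ j
  far : ∀ d ≠ (false, false), ∀ q, HasJet2 (fun x => G q (flip d x)) 0
  axis_fst : ∀ q, ∃ e, ∀ u, G q (u, 0) = lead p ρ n e u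
  axis_snd : ∀ q, ∃ e, ∀ v, G q (0, v) = lead p σ n e v
  far_fst : ∀ q, ∀ v ∈ Icc (0 : ℝ) 1, G q (1, v) = 0
  far_snd : ∀ q, ∀ u ∈ Icc (0 : ℝ) 1, G q (u, 1) = 0
  cont : ∀ q, ContinuousOn (G q) square

theorem square_swap {x : ℝ × ℝ} (h : x ∈ square) : (x.2, x.1) ∈ square := ⟨h.2, h.1⟩

theorem C2Index.swap_swap (q : C2Index) : q.swap.swap = q := by cases q <;> rfl

theorem CornerSystem.swap {p n ρ σ : ℕ} {G : C2Index → ℝ × ℝ → ℝ} (h : CornerSystem p n ρ σ G) :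
    CornerSystem p n σ ρ (fun q x => G q (x.2, x.1)) where
  jets := by
    obtain ⟨j, hj, hli⟩ := h.jets
    refine ⟨fun q q' => j q q'.swap, fun q => (hj q).swap, ?_⟩
    exact hli.map' (LinearMap.funLeft ℝ ℝ C2Index.swap) (LinearMap.ker_eq_bot.2
      (LinearMap.funLeft_injective_of_surjective _ _ _ fun q => ⟨q.swap, q.swap_swap⟩))
  far d hd q := by
    have := (h.far (d.2, d.1) (fun h' => hd (by
      rw [Prod.mk.injEq] at h'; exact Prod.ext h'.2 h'.1)) q).swap
    exact this
  axis_fst := h.axis_snd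
  axis_snd := h.axis_fst
  far_fst := h.far_snd
  far_snd := h.far_fst
  cont q := (h.cont q).comp (continuous_snd.prodMk continuous_fst).continuousOn fun _ => square_swap

/-- The properties of a function in the span of a vertex system, with two-jet `j` at the origin. -/
structure CornerFn (p n ρ σ : ℕ) (g : ℝ × ℝ → ℝ) (j : C2Index → ℝ) : Prop where
  jet : HasJet2 g j
  far : ∀ d ≠ (false, false), HasJet2 (fun x => g (flip d x)) 0
  axis_fst : ∃ e, ∀ u, g (u, 0) = lead p ρ n e u
  axis_snd : ∃ e, ∀ v, g (0, v) = lead p σ n e v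
  far_fst : ∀ v ∈ Icc (0 : ℝ) 1, g (1, v) = 0
  far_snd : ∀ u ∈ Icc (0 : ℝ) 1, g (u, 1) = 0
  cont : ContinuousOn g square

theorem CornerFn.of_sum {p n ρ σ : ℕ} {G : C2Index → ℝ × ℝ → ℝ} (h : CornerSystem p n ρ σ G)
    {j : C2Index → C2Index → ℝ} (hj : ∀ q, HasJet2 (G q) (j q)) (a : C2Index → ℝ) :
    CornerFn p n ρ σ (∑ q, a q • G q) (∑ q, a q • j q) where
  jet := HasJet2.sum _ fun q _ => (hj q).smul (a q)
  far d hd := by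
    have := HasJet2.sum Finset.univ fun q _ => (h.far d hd q).smul (a q)
    simp only [smul_zero, Finset.sum_const_zero] at this
    exact this.congr fun x _ => by simp
  axis_fst := by
    choose e he using h.axis_fst
    refine ⟨fun i => ∑ q, a q * e q i, fun u => ?_⟩
    simp only [Finset.sum_apply, Pi.smul_apply, smul_eq_mul, he, lead, Finset.sum_mul,
      ← Finset.sum_add_distrib]
    exact Finset.sum_congr rfl fun q _ => by ring
  axis_snd := by
    choose e he using h.axis_snd
    refine ⟨fun i => ∑ q, a q * e q i, fun u => ?_⟩
    simp only [Finset.sum_apply, Pi.smul_apply, smul_eq_mul, he, lead, Finset.sum_mul,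
      ← Finset.sum_add_distrib]
    exact Finset.sum_congr rfl fun q _ => by ring
  far_fst v hv := by simp [h.far_fst _ v hv]
  far_snd v hv := by simp [h.far_snd _ v hv]
  cont := by
    have : (∑ q, a q • G q) = fun x => ∑ q, a q • G q x := by funext x; simp
    rw [this]
    exact continuousOn_finsetSum _ fun q _ => (h.cont q).const_smul (a q)

/-- A function chosen by interpolation of `C²`-data in the span of a vertex system. -/
theorem CornerSystem.exists_cornerFn {p n ρ σ : ℕ} {G : C2Index → ℝ × ℝ → ℝ}
    (h : CornerSystem p n ρ σ G) (F : ℝ × ℝ → Plane) (c : Corner) (Φ : C2Index → ℝ)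
    {W : Submodule ℝ (ℝ × ℝ → ℝ)} (hW : W = Submodule.span ℝ (range fun q x => G q (flip c x))) :
    ∃ g, CornerFn p n ρ σ g (pullJet (fun x => F (flip c x)) Φ) ∧
      ∀ x, Classical.epsilon (fun g => g ∈ W ∧ HasC2Data F c.pt g Φ) x = g (flip c x) := by
  obtain ⟨j, hj, hli⟩ := h.jets
  have mem : ∀ g ∈ W, ∃ a : C2Index → ℝ, ∀ x, g (flip c x) = (∑ q, a q • G q) x := by
    intro g hg
    rw [hW, Submodule.mem_span_range_iff_exists_fun] at hg
    obtain ⟨a, rfl⟩ := hg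
    exact ⟨a, fun x => by simp [flip_flip]⟩
  -- Six independent jets span the six-dimensional space of jets, so an interpolant exists. Its
  -- uniqueness is not needed: the conclusion holds for every function in W with these data.
  have ex : ∃ g, g ∈ W ∧ HasC2Data F c.pt g Φ := by
    have htop : (pullJet (fun x => F (flip c x)) Φ) ∈ Submodule.span ℝ (range j) := by
      rw [hli.span_eq_top_of_card_eq_finrank' (by simp)]; trivial
    rw [Submodule.mem_span_range_iff_exists_fun] at htop
    obtain ⟨a, ha⟩ := htop
    refine ⟨∑ q, a q • fun x => G q (flip c x), ?_, ?_⟩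
    · rw [hW]
      exact Submodule.sum_mem _ fun q _ => Submodule.smul_mem _ _ (Submodule.subset_span ⟨q, rfl⟩)
    · rw [hasC2Data_flip, ← ha]
      exact ((CornerFn.of_sum h hj a).jet.congr fun x _ => by simp [flip_flip]).axisJet_eq
  obtain ⟨hm, hd⟩ := Classical.epsilon_spec ex
  obtain ⟨a, ha⟩ := mem _ hm
  have hc := CornerFn.of_sum h hj a
  refine ⟨∑ q, a q • G q, ?_, fun x => by rw [← ha (flip c x), flip_flip]⟩
  rw [hasC2Data_flip, (hc.jet.congr fun x _ => ha x).axisJet_eq] at hd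
  rw [← hd]
  exact hc

/-- The sum of the interpolants of two edges minus the interpolant of the correction term. -/
theorem CornerFn.combine {p n ρ : ℕ} (hp : 2 ≤ p) (hn : 1 ≤ n) (hρ : ρ < p)
    {g₁ g₂ g₃ : ℝ × ℝ → ℝ} {j : C2Index → ℝ} (h₁ : CornerFn p n (p - 1) ρ g₁ j)
    (h₂ : CornerFn p n ρ (p - 1) g₂ j) (h₃ : CornerFn p n ρ ρ g₃ j) :
    CornerFn p n (p - 1) (p - 1) (g₁ + g₂ - g₃) j where
  jet := by simpa using (h₁.jet.add h₂.jet).sub h₃.jet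
  far d hd := by
    have := ((h₁.far d hd).add (h₂.far d hd)).sub (h₃.far d hd)
    simp only [add_zero, sub_zero] at this
    exact this
  axis_fst := by
    obtain ⟨e, he⟩ := h₁.axis_fst
    obtain ⟨e₂, he₂⟩ := h₂.axis_fst
    obtain ⟨e₃, he₃⟩ := h₃.axis_fst
    -- On the first axis g₂ and g₃ are combinations of the same three B-splines of regularity ρ with
    -- the same jet, so they cancel and the smoother trace of g₁ remains. On the second axis g₁ and
    -- g₃ cancel in the same way.
    have k₂ := h₂.jet.jet1_fst
    have k₃ := h₃.jet.jet1_fst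
    simp only [he₂, he₃] at k₂ k₃
    refine ⟨e, fun u => ?_⟩
    simp [he, he₂, he₃, lead_eq_of_hasJet1 hρ hn hp k₂ k₃ u]
  axis_snd := by
    obtain ⟨e, he⟩ := h₂.axis_snd
    obtain ⟨e₁, he₁⟩ := h₁.axis_snd
    obtain ⟨e₃, he₃⟩ := h₃.axis_snd
    have k₁ := h₁.jet.jet1_snd
    have k₃ := h₃.jet.jet1_snd
    simp only [he₁, he₃] at k₁ k₃
    refine ⟨e, fun u => ?_⟩
    simp [he, he₁, he₃, lead_eq_of_hasJet1 hρ hn hp k₁ k₃ u]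
  far_fst v hv := by simp [h₁.far_fst v hv, h₂.far_fst v hv, h₃.far_fst v hv]
  far_snd v hv := by simp [h₁.far_snd v hv, h₂.far_snd v hv, h₃.far_snd v hv]
  cont := (h₁.cont.add h₂.cont).sub h₃.cont

end ApproxC1
end

/-! ### The generators at a vertex and the independence of their two-jets -/

noncomputable section
namespace ApproxC1
open Filter Topology

/-- The six generators belonging to an edge at a vertex, for gluing functions `A`, `B`. -/
def edgeGen (p r n : ℕ) (A B : ℝ → ℝ) : C2Index → ℝ × ℝ → ℝ
  | .val => strip p r n (bspline p (p - 1) n 0) (slope A B (bspline p (p - 1) n 0) 0)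
  | .dx => strip p r n (bspline p (p - 1) n 1) (slope A B (bspline p (p - 1) n 1) 0)
  | .dxx => strip p r n (bspline p (p - 1) n 2) (slope A B (bspline p (p - 1) n 2) 0)
  | .dy => strip p r n 0 (slope A B 0 (bspline (p - 1) (p - 2) n 0))
  | .dxy => strip p r n 0 (slope A B 0 (bspline (p - 1) (p - 2) n 1))
  | .dyy => tensorBspline p r n 0 2

/-- The six generators of the correction term. -/
def corrGen (p r n : ℕ) : C2Index → ℝ × ℝ → ℝ
  | .val => tensorBspline p r n 0 0
  | .dx => tensorBspline p r n 1 0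
  | .dy => tensorBspline p r n 0 1
  | .dxx => tensorBspline p r n 2 0
  | .dxy => tensorBspline p r n 1 1
  | .dyy => tensorBspline p r n 0 2

section

variable {p r n : ℕ}

theorem hasJet2_tensor_far (hrp : r < p) (hn : 1 ≤ n) (hN : 6 ≤ p + n) {i k : ℕ} (hi : i ≤ 2)
    (hk : k ≤ 2) {d : Corner} (hd : d ≠ (false, false)) :
    HasJet2 (fun x => tensorBspline p r n i k (flip d x)) 0 := by
  have hN := add_le_splineDim hrp (n := n)
  have hi' := hasJet1_bspline_reflect hrp hn (i := i) (by omega)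
  have hk' := hasJet1_bspline_reflect hrp hn (i := k) (by omega)
  obtain ⟨_, _, ji⟩ := (isPP_bspline hrp n i).hasJet1 hn
  obtain ⟨_, _, jk⟩ := ((isPP_bspline hrp n k).comp_mirror d.2).hasJet1 hn
  rcases d with ⟨_ | _, _ | _⟩
  · exact absurd rfl hd
  · exact ji.tens_zero_right hk'
  · exact hi'.tens_zero_left jk
  · exact hi'.tens_zero_left jk

theorem continuousOn_tensorBspline (hrp : r < p) (hn : 1 ≤ n) (i k : ℕ) :
    ContinuousOn (tensorBspline p r n i k) square :=
  (((isPP_bspline hrp n i).continuousOn hn).comp continuousOn_fst fun _ hx => hx.1).mul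
    (((isPP_bspline hrp n k).continuousOn hn).comp continuousOn_snd fun _ hx => hx.2)

theorem corner_corrGen (hrp : r < p) (hp : 2 ≤ p) (hn : 1 ≤ n) (hN : 6 ≤ p + n) :
    CornerSystem p n r r (corrGen p r n) where
  jets := by
    obtain ⟨x, h0⟩ := hasJet1_bspline_zero hrp hn
    obtain ⟨y, h1⟩ := hasJet1_bspline_one hrp hn
    obtain ⟨z, hz, h2⟩ := hasJet1_bspline_two hrp hn hp
    have hpn : (p : ℝ) * n ≠ 0 := by
      have : 0 < p * n := Nat.mul_pos (by omega) hn
      exact_mod_cast this.ne'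
    generalize (p : ℝ) * n = m at *
    refine ⟨fun
      | .val => tensJet 1 (-m) x 1 (-m) x
      | .dx => tensJet 0 m y 1 (-m) x
      | .dy => tensJet 1 (-m) x 0 m y
      | .dxx => tensJet 0 0 z 1 (-m) x
      | .dxy => tensJet 0 m y 0 m y
      | .dyy => tensJet 1 (-m) x 0 0 z, ?_, ?_⟩
    · intro q
      cases q
      · exact h0.tens h0
      · exact h1.tens h0
      · exact h0.tens h1
      · exact h2.tens h0
      · exact h1.tens h1
      · exact h0.tens h2
    · rw [Fintype.linearIndependent_iff]
      intro a ha
      have e := fun q => congrFun ha q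
      simp only [C2Index.sum_eq, Pi.add_apply, Pi.smul_apply, smul_eq_mul, Pi.zero_apply] at e
      -- The jet of the product of B-splines i and k starts at order i in u and k in v, so the
      -- coefficients are eliminated one after the other by increasing total order.
      have a1 : a .val = 0 := by simpa [tensJet] using e .val
      have a2 : a .dx = 0 := by simpa [tensJet, a1, hpn] using e .dx
      have a3 : a .dy = 0 := by simpa [tensJet, a1, a2, hpn] using e .dy
      have a4 : a .dxx = 0 := by simpa [tensJet, a1, a2, a3, hz] using e .dxx
      have a5 : a .dxy = 0 := by simpa [tensJet, a1, a2, a3, a4, hpn] using e .dxy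
      have a6 : a .dyy = 0 := by simpa [tensJet, a1, a2, a3, a4, a5, hz] using e .dyy
      intro q; cases q <;> assumption
  far d hd q := by cases q <;> exact hasJet2_tensor_far hrp hn hN (by omega) (by omega) hd
  axis_fst q := by
    have b0 := bspline_apply_zero (n := n) (i := 0) hrp hn
    have b1 := bspline_apply_zero (n := n) (i := 1) hrp hn
    have b2 := bspline_apply_zero (n := n) (i := 2) hrp hn
    simp only [if_true, one_ne_zero, if_false, OfNat.ofNat_ne_zero] at b0 b1 b2
    cases q
    · exact ⟨Pi.single 0 1, fun u => by simp [corrGen, tensorBspline, b0, lead]⟩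
    · exact ⟨Pi.single 1 1, fun u => by simp [corrGen, tensorBspline, b0, lead]⟩
    · exact ⟨0, fun u => by simp [corrGen, tensorBspline, b1, lead]⟩
    · exact ⟨Pi.single 2 1, fun u => by simp [corrGen, tensorBspline, b0, lead]⟩
    · exact ⟨0, fun u => by simp [corrGen, tensorBspline, b1, lead]⟩
    · exact ⟨0, fun u => by simp [corrGen, tensorBspline, b2, lead]⟩
  axis_snd q := by
    have b0 := bspline_apply_zero (n := n) (i := 0) hrp hn
    have b1 := bspline_apply_zero (n := n) (i := 1) hrp hn
    have b2 := bspline_apply_zero (n := n) (i := 2) hrp hn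
    simp only [if_true, one_ne_zero, if_false, OfNat.ofNat_ne_zero] at b0 b1 b2
    cases q
    · exact ⟨Pi.single 0 1, fun u => by simp [corrGen, tensorBspline, b0, lead]⟩
    · exact ⟨0, fun u => by simp [corrGen, tensorBspline, b1, lead]⟩
    · exact ⟨Pi.single 1 1, fun u => by simp [corrGen, tensorBspline, b0, lead]⟩
    · exact ⟨0, fun u => by simp [corrGen, tensorBspline, b2, lead]⟩
    · exact ⟨0, fun u => by simp [corrGen, tensorBspline, b1, lead]⟩
    · exact ⟨Pi.single 2 1, fun u => by simp [corrGen, tensorBspline, b0, lead]⟩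
  far_fst q v hv := by
    have hN := add_le_splineDim hrp (n := n)
    have b0 := bspline_apply_one hrp hn (i := 0) (n := n) (by omega)
    have b1 := bspline_apply_one hrp hn (i := 1) (n := n) (by omega)
    have b2 := bspline_apply_one hrp hn (i := 2) (n := n) (by omega)
    cases q <;> simp [corrGen, tensorBspline, b0, b1, b2]
  far_snd q v hv := by
    have hN := add_le_splineDim hrp (n := n)
    have b0 := bspline_apply_one hrp hn (i := 0) (n := n) (by omega)
    have b1 := bspline_apply_one hrp hn (i := 1) (n := n) (by omega)
    have b2 := bspline_apply_one hrp hn (i := 2) (n := n) (by omega)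
    cases q <;> simp [corrGen, tensorBspline, b0, b1, b2]
  cont q := by cases q <;> exact continuousOn_tensorBspline hrp hn _ _

/-- A strip whose trace and slope vanish at the end `1` of the edge. -/
theorem hasJet2_strip_flip (hrp : r < p) (hn : 1 ≤ n) (hN : 6 ≤ p + n) {f y : ℝ → ℝ}
    (hf : IsPP n f) (hy : IsPP n y) {c : ℝ} (jf : HasJet1 (fun x => f (mirror true x)) 0 0 0)
    (jy : HasJet1 (fun x => y (mirror true x)) 0 0 c) {d : Corner} (hd : d ≠ (false, false)) :
    HasJet2 (fun x => strip p r n f y (flip d x)) 0 := by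
  obtain ⟨_, _, jf0⟩ := hf.hasJet1 hn
  obtain ⟨_, _, jy0⟩ := hy.hasJet1 hn
  rcases d with ⟨_ | _, _ | _⟩
  · exact absurd rfl hd
  · exact hasJet2_strip_far hrp hn hN jf0 jy0
  · exact hasJet2_strip_zero hrp hn jf jy
  · exact hasJet2_strip_far hrp hn hN jf jy

theorem IsPP1.comp_reflect_bspline (hp : 2 ≤ p) (hn : 1 ≤ n) {i : ℕ} (hi : i + 1 ≤ splineDim p (p - 1) n) :
    IsPP1 n (fun x => bspline p (p - 1) n i (mirror true x)) :=
  (isPP1_bspline hp n (splineDim p (p - 1) n - 1 - i)).congr fun x hx => by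
    simpa [mirror] using bspline_reflect (by omega) hn
      (i' := splineDim p (p - 1) n - 1 - i) (by omega) hx

/-- Three traces give the pure u-derivatives, two normal derivative functions give the first
derivative in v and the mixed one, and the extra tensor product supplies the second derivative in v.
The second and third groups cannot disturb the equations of the preceding ones. -/
theorem corner_edgeGen (hrp : r < p) (hp : 2 ≤ p) (hn : 1 ≤ n) (hN : 6 ≤ p + n) {A B : ℝ → ℝ}
    (hA : IsPP n A) (hB : IsPP n B) (hA0 : A 0 ≠ 0) :
    CornerSystem p n (p - 1) r (edgeGen p r n A B) := by
  have hp1 : p - 1 < p := by omega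
  have hm1 : p - 2 < p - 1 := by omega
  have hNp := add_le_splineDim hp1 (n := n)
  have hNm := add_le_splineDim hm1 (n := n)
  have hNr := add_le_splineDim hrp (n := n)
  have z1 : IsPP1 n (0 : ℝ → ℝ) := isPP1_zero n
  have z0 : IsPP n (0 : ℝ → ℝ) := isPP_const n 0
  have j0 : HasJet1 (0 : ℝ → ℝ) 0 0 0 := hasJet1_zero
  have b0 := bspline_apply_zero (n := n) (i := 0) hrp hn
  have b1 := bspline_apply_zero (n := n) (i := 1) hrp hn
  have b2 := bspline_apply_zero (n := n) (i := 2) hrp hn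
  simp only [if_true, one_ne_zero, if_false, OfNat.ofNat_ne_zero] at b0 b1 b2
  have jp : ∀ i ≤ 2, HasJet1 (fun x => bspline p (p - 1) n i (mirror true x)) 0 0 0 := fun i hi =>
    hasJet1_bspline_reflect hp1 hn (by omega)
  have jm : ∀ i ≤ 1, HasJet1 (fun x => bspline (p - 1) (p - 2) n i (mirror true x)) 0 0 0 := fun i hi =>
    hasJet1_bspline_reflect hm1 hn (by omega)
  have sp : ∀ i ≤ 2, ∃ c, HasJet1 (fun x => slope A B (bspline p (p - 1) n i) 0 (mirror true x)) 0 0 c := by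
    intro i hi
    obtain ⟨A1, B1, d, h⟩ := hasJet1_slope hn (hA.comp_mirror true)
      ((isPP_const n (sgn true)).mul (hB.comp_mirror true))
      (IsPP1.comp_reflect_bspline hp hn (i := i) (by omega)) (jp i hi) j0
    simp only [mul_zero, add_zero] at h
    exact ⟨d, h.congr fun x _ => slope_mirror ..⟩
  have sm : ∀ i ≤ 1, ∃ c, HasJet1 (fun x => slope A B 0 (bspline (p - 1) (p - 2) n i) (mirror true x)) 0 0 c := by
    intro i hi
    obtain ⟨A1, B1, d, h⟩ := hasJet1_slope hn (hA.comp_mirror true)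
      ((isPP_const n (sgn true)).mul (hB.comp_mirror true)) z1 j0 (jm i hi)
    simp only [mul_zero, add_zero] at h
    exact ⟨d, h.congr fun x _ => slope_mirror ..⟩
  have pb : ∀ i, IsPP n (bspline p (p - 1) n i) := fun i => isPP_bspline hp1 n i
  have pp : ∀ i, IsPP n (slope A B (bspline p (p - 1) n i) 0) := fun i =>
    isPP_slope hA hB (isPP1_bspline hp n i) z0
  have pm : ∀ i, IsPP n (slope A B 0 (bspline (p - 1) (p - 2) n i)) := fun i =>
    isPP_slope hA hB z1 (isPP_bspline hm1 n i)
  refine ⟨?_, ?_, ?_, ?_, ?_, ?_, ?_⟩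
  · obtain ⟨x0, h0⟩ := hasJet1_bspline_zero hp1 hn
    obtain ⟨x1, h1⟩ := hasJet1_bspline_one hp1 hn
    obtain ⟨x2, hx2, h2⟩ := hasJet1_bspline_two hp1 hn hp
    obtain ⟨y0, k0⟩ := hasJet1_bspline_zero hm1 hn
    obtain ⟨y1, k1⟩ := hasJet1_bspline_one hm1 hn
    obtain ⟨u0, l0⟩ := hasJet1_bspline_zero hrp hn
    obtain ⟨z, hz, l2⟩ := hasJet1_bspline_two hrp hn hp
    obtain ⟨w, z', hs⟩ := exists_hasJet2_strip hrp hn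
    obtain ⟨_, _, _, s0⟩ := hasJet1_slope hn hA hB (isPP1_bspline hp n 0) h0 j0
    obtain ⟨_, _, _, s1⟩ := hasJet1_slope hn hA hB (isPP1_bspline hp n 1) h1 j0
    obtain ⟨_, _, _, s2⟩ := hasJet1_slope hn hA hB (isPP1_bspline hp n 2) h2 j0
    obtain ⟨_, _, _, t0⟩ := hasJet1_slope hn hA hB z1 j0 k0
    obtain ⟨A1, _, _, t1⟩ := hasJet1_slope hn hA hB z1 j0 k1
    have g0 := hs h0 s0
    have g1 := hs h1 s1
    have g2 := hs h2 s2
    have g3 := hs j0 t0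
    have g4 := hs j0 t1
    have g5 := l0.tens l2
    have hpn : (p : ℝ) * n ≠ 0 := by
      have : 0 < p * n := Nat.mul_pos (by omega) hn
      exact_mod_cast this.ne'
    have hpm : ((p - 1 : ℕ) : ℝ) * n ≠ 0 := by
      have : 0 < (p - 1) * n := Nat.mul_pos (by omega) hn
      exact_mod_cast this.ne'
    refine ⟨fun
      | .val => _
      | .dx => _
      | .dy => _
      | .dxx => _
      | .dxy => _
      | .dyy => _, fun
      | .val => g0
      | .dx => g1
      | .dy => g3
      | .dxx => g2
      | .dxy => g4
      | .dyy => g5, ?_⟩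
    rw [Fintype.linearIndependent_iff]
    intro a ha
    have e := fun q => congrFun ha q
    simp only [C2Index.sum_eq, Pi.add_apply, Pi.smul_apply, smul_eq_mul, Pi.zero_apply] at e
    generalize (p : ℝ) * n = m at *
    generalize ((p - 1 : ℕ) : ℝ) * n = m' at *
    -- The order of elimination is value, ∂u, ∂uu, then ∂v with pivot A 0, the mixed derivative with
    -- pivot A 0 times the slope (p - 1)n, and finally ∂vv.
    have a1 : a .val = 0 := by simpa [tensJet] using e .val
    have a2 : a .dx = 0 := by simpa [tensJet, a1, hpn] using e .dx
    have a3 : a .dxx = 0 := by simpa [tensJet, a1, a2, hx2] using e .dxx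
    have a4 : a .dy = 0 := by simpa [tensJet, a1, a2, a3, hA0] using e .dy
    have a5 : a .dxy = 0 := by simpa [tensJet, a1, a2, a3, a4, hA0, hpm] using e .dxy
    have a6 : a .dyy = 0 := by simpa [tensJet, a1, a2, a3, a4, a5, hz] using e .dyy
    intro q; cases q <;> assumption
  · intro d hd q
    have tz : HasJet1 (fun x => (0 : ℝ → ℝ) (mirror true x)) 0 0 0 := hasJet1_zero
    cases q
    · exact hasJet2_strip_flip hrp hn hN (pb 0) (pp 0) (jp 0 (by omega)) (sp 0 (by omega)).choose_spec hd
    · exact hasJet2_strip_flip hrp hn hN (pb 1) (pp 1) (jp 1 (by omega)) (sp 1 (by omega)).choose_spec hd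
    · exact hasJet2_strip_flip hrp hn hN z0 (pm 0) tz (sm 0 (by omega)).choose_spec hd
    · exact hasJet2_strip_flip hrp hn hN (pb 2) (pp 2) (jp 2 (by omega)) (sp 2 (by omega)).choose_spec hd
    · exact hasJet2_strip_flip hrp hn hN z0 (pm 1) tz (sm 1 (by omega)).choose_spec hd
    · exact hasJet2_tensor_far hrp hn hN (by omega) (by omega) hd
  · intro q
    cases q
    · exact ⟨Pi.single 0 1, fun u => by simp [edgeGen, strip_bottom hrp hn, lead]⟩
    · exact ⟨Pi.single 1 1, fun u => by simp [edgeGen, strip_bottom hrp hn, lead]⟩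
    · exact ⟨0, fun u => by simp [edgeGen, strip_bottom hrp hn, lead]⟩
    · exact ⟨Pi.single 2 1, fun u => by simp [edgeGen, strip_bottom hrp hn, lead]⟩
    · exact ⟨0, fun u => by simp [edgeGen, strip_bottom hrp hn, lead]⟩
    · exact ⟨0, fun u => by simp [edgeGen, tensorBspline, b2, lead]⟩
  · have key : ∀ f y : ℝ → ℝ, ∃ e, ∀ v, strip p r n f y (0, v) = lead p r n e v := fun f y =>
      ⟨fun | 0 => f 0 | 1 => f 0 + y 0 * ((1 / n : ℝ) / p) | _ => 0, fun v => by
        simp only [strip, lead]; ring⟩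
    intro q
    cases q
    · exact key _ _
    · exact key _ _
    · exact key _ _
    · exact key _ _
    · exact key _ _
    · exact ⟨Pi.single 2 1, fun u => by simp [edgeGen, tensorBspline, b0, lead]⟩
  · have key : ∀ {f y : ℝ → ℝ} {c : ℝ}, HasJet1 (fun x => f (mirror true x)) 0 0 0 →
        HasJet1 (fun x => y (mirror true x)) 0 0 c → ∀ v, strip p r n f y (1, v) = 0 := by
      intro f y c ⟨_, _, _, hf, _⟩ ⟨_, _, _, hy, _⟩ v
      simp only [mirror, if_true, sub_zero] at hf hy
      simp [strip, hf, hy]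
    have tz : HasJet1 (fun x => (0 : ℝ → ℝ) (mirror true x)) 0 0 0 := hasJet1_zero
    intro q v _
    cases q
    · exact key (jp 0 (by omega)) (sp 0 (by omega)).choose_spec v
    · exact key (jp 1 (by omega)) (sp 1 (by omega)).choose_spec v
    · exact key tz (sm 0 (by omega)).choose_spec v
    · exact key (jp 2 (by omega)) (sp 2 (by omega)).choose_spec v
    · exact key tz (sm 1 (by omega)).choose_spec v
    · simp [edgeGen, tensorBspline, bspline_apply_one hrp hn (i := 0) (by omega)]
  · intro q u _
    cases q
    case dyy => simp [edgeGen, tensorBspline, bspline_apply_one hrp hn (i := 2) (by omega)]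
    all_goals exact strip_top hrp hn hN _ _ _
  · intro q
    cases q
    · exact continuousOn_strip hrp hn (pb 0) (pp 0)
    · exact continuousOn_strip hrp hn (pb 1) (pp 1)
    · exact continuousOn_strip hrp hn z0 (pm 0)
    · exact continuousOn_strip hrp hn (pb 2) (pp 2)
    · exact continuousOn_strip hrp hn z0 (pm 1)
    · exact continuousOn_tensorBspline hrp hn _ _

end

end ApproxC1
end

noncomputable section
namespace ApproxC1
open Filter Topology

/-! ## Edge and vertex functions of a patch -/

theorem Corner.hEdge_param_dist (c : Corner) (x : ℝ × ℝ) :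
    c.hEdge.param x = x.1 ∧ c.hEdge.dist x = mirror c.2 x.2 := by
  rcases c with ⟨_, _ | _⟩ <;> simp [Corner.hEdge, Edge.param, Edge.dist, mirror]

theorem Corner.vEdge_param_dist (c : Corner) (x : ℝ × ℝ) :
    c.vEdge.param x = x.2 ∧ c.vEdge.dist x = mirror c.1 x.1 := by
  rcases c with ⟨_ | _, _⟩ <;> simp [Corner.vEdge, Edge.param, Edge.dist, mirror]

theorem Edge.param_frame (s : Edge) (d t : ℝ) : s.param (s.frame d t) = t := by
  cases s <;> rfl

theorem Edge.dist_frame (s : Edge) (d t : ℝ) : s.dist (s.frame d t) = d := by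
  cases s <;> simp [Edge.dist, Edge.frame]

theorem Edge.frame_mem (s : Edge) {d t : ℝ} (hd : d ∈ Icc (0 : ℝ) 1) (ht : t ∈ Icc (0 : ℝ) 1) :
    s.frame d t ∈ square := by
  have hd' : 1 - d ∈ Icc (0 : ℝ) 1 := ⟨by linarith [hd.2], by linarith [hd.1]⟩
  cases s
  · exact ⟨ht, hd⟩
  · exact ⟨hd', ht⟩
  · exact ⟨ht, hd'⟩
  · exact ⟨hd, ht⟩

theorem Edge.param_mem (s : Edge) {x : ℝ × ℝ} (hx : x ∈ square) : s.param x ∈ Icc (0 : ℝ) 1 := by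
  cases s
  · exact hx.1
  · exact hx.2
  · exact hx.1
  · exact hx.2

theorem Edge.dist_mem (s : Edge) {x : ℝ × ℝ} (hx : x ∈ square) : s.dist x ∈ Icc (0 : ℝ) 1 := by
  obtain ⟨⟨h1, h2⟩, h3, h4⟩ := hx
  cases s
  · exact ⟨h3, h4⟩
  · exact ⟨sub_nonneg.2 h2, sub_le_self _ h1⟩
  · exact ⟨sub_nonneg.2 h4, sub_le_self _ h3⟩
  · exact ⟨h1, h2⟩

theorem Edge.continuous_param (s : Edge) : Continuous s.param := by
  cases s
  exacts [continuous_fst, continuous_snd, continuous_fst, continuous_snd]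

theorem Edge.continuous_dist (s : Edge) : Continuous s.dist := by
  cases s
  exacts [continuous_snd, continuous_const.sub continuous_fst, continuous_const.sub continuous_snd,
    continuous_fst]

/-- In the coordinates of a vertex, the parameter of an edge and the distance from it are the two
coordinates up to reflections. -/
theorem Edge.coords_flip (s : Edge) (c : Corner) : ∃ d : Corner,
    (∀ x, (s.param (flip c x), s.dist (flip c x)) = flip d x) ∨
      ∀ x, (s.param (flip c x), s.dist (flip c x)) = flip d (x.2, x.1) := by
  rcases c with ⟨a, b⟩
  cases s
  · exact ⟨(a, b), Or.inl fun x => by simp [Edge.param, Edge.dist, flip]⟩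
  · refine ⟨(b, !a), Or.inr fun x => ?_⟩
    cases a <;> simp [Edge.param, Edge.dist, flip, mirror]
  · refine ⟨(a, !b), Or.inl fun x => ?_⟩
    cases b <;> simp [Edge.param, Edge.dist, flip, mirror]
  · exact ⟨(b, a), Or.inr fun x => by simp [Edge.param, Edge.dist, flip]⟩

/-- The coordinates of an edge along another edge. -/
theorem Edge.coords_frame {s s' : Edge} (h : s' ≠ s) :
    (∃ e e', ∀ d t, s.param (s'.frame d t) = mirror e d ∧ s.dist (s'.frame d t) = mirror e' t) ∨
      ∀ d t, s.param (s'.frame d t) = t ∧ s.dist (s'.frame d t) = mirror true d := by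
  have key : ∀ e e', (∀ d t, s.param (s'.frame d t) = mirror e d ∧ s.dist (s'.frame d t) = mirror e' t) →
      (∃ e e', ∀ d t, s.param (s'.frame d t) = mirror e d ∧ s.dist (s'.frame d t) = mirror e' t) ∨
      ∀ d t, s.param (s'.frame d t) = t ∧ s.dist (s'.frame d t) = mirror true d :=
    fun e e' h => Or.inl ⟨e, e', h⟩
  cases s <;> cases s' <;> first
    | exact absurd rfl h
    | (refine Or.inr fun d t => ?_; simp [Edge.param, Edge.dist, Edge.frame, mirror]; done)
    | (refine key false false fun d t => ?_; simp [Edge.param, Edge.dist, Edge.frame, mirror]; done)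
    | (refine key false true fun d t => ?_; simp [Edge.param, Edge.dist, Edge.frame, mirror]; done)
    | (refine key true false fun d t => ?_; simp [Edge.param, Edge.dist, Edge.frame, mirror]; done)
    | (refine key true true fun d t => ?_; simp [Edge.param, Edge.dist, Edge.frame, mirror])

/-- Traces `b⁺` and normal derivatives `b⁻` of functions whose support does not touch the ends
of the edge. -/
structure EdgePair (n : ℕ) (bp bm : ℝ → ℝ) : Prop where
  plus_pp : ∀ e, IsPP1 n (fun t => bp (mirror e t))
  minus_pp : IsPP n bm
  plus_jet : ∀ e, HasJet1 (fun t => bp (mirror e t)) 0 0 0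
  minus_jet : ∀ e, ∃ c, HasJet1 (fun t => bm (mirror e t)) 0 0 c

theorem EdgePair.plus_isPP1 {n : ℕ} {bp bm : ℝ → ℝ} (h : EdgePair n bp bm) : IsPP1 n bp :=
  h.plus_pp false

theorem slope_comp_mirror (A B bp bm : ℝ → ℝ) (e : Bool) (t : ℝ) :
    slope A B (fun t => bp (mirror e t)) (fun t => bm (mirror e t)) t =
      slope (fun t => A (mirror e t)) (fun t => sgn e * B (mirror e t)) bp bm (mirror e t) := by
  have := slope_mirror A B (fun t => bp (mirror e t)) (fun t => bm (mirror e t)) e (mirror e t)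
  simpa only [mirror_mirror] using this

theorem mirror_comp (e e' : Bool) (x : ℝ) : mirror e (mirror e' x) = mirror (xor e e') x := by
  cases e <;> cases e' <;> simp [mirror]

/-- This is the passage to the second patch of an interface, including the change of sign of b⁻. -/
theorem EdgePair.comp_mirror {n : ℕ} {bp bm : ℝ → ℝ} (h : EdgePair n bp bm) (e : Bool) :
    EdgePair n (fun t => bp (mirror e t)) (fun t => -bm (mirror e t)) where
  plus_pp e' := by simpa only [mirror_comp] using h.plus_pp (xor e e')
  minus_pp := by simpa using (isPP_const n (-1)).mul (h.minus_pp.comp_mirror e)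
  plus_jet e' := by simpa only [mirror_comp] using h.plus_jet (xor e e')
  minus_jet e' := by
    obtain ⟨c, hc⟩ := h.minus_jet (xor e e')
    exact ⟨_, by simpa only [mirror_comp, mul_zero, neg_one_mul] using hc.const_mul (-1)⟩

theorem EdgePair.slope_jet {n : ℕ} (hn : 1 ≤ n) {A B bp bm : ℝ → ℝ} (h : EdgePair n bp bm)
    (hA : IsPP n A) (hB : IsPP n B) (e : Bool) :
    ∃ c, HasJet1 (fun t => slope A B bp bm (mirror e t)) 0 0 c := by
  obtain ⟨c, hc⟩ := h.minus_jet e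
  obtain ⟨A1, B1, d, hd⟩ := hasJet1_slope hn (hA.comp_mirror e)
    ((isPP_const n (sgn e)).mul (hB.comp_mirror e)) (h.plus_pp e) (h.plus_jet e) hc
  simp only [mul_zero, add_zero] at hd
  exact ⟨d, hd.congr fun x _ => slope_mirror ..⟩

/-- The index ranges omit equally many B-splines at both ends, so the reflection permutes the edge
indices. -/
theorem EdgeIdx.reflect {p n : ℕ} (hp : 2 ≤ p) (hn : 1 ≤ n) (j : EdgeIdx p n) :
    ∃ j' : EdgeIdx p n, (∀ t ∈ Icc (0 : ℝ) 1, j.plus (1 - t) = j'.plus t) ∧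
      ∀ t ∈ Icc (0 : ℝ) 1, j.minus (1 - t) = j'.minus t := by
  rcases j with ⟨j, h1, h2⟩ | ⟨j, h1, h2⟩
  · exact ⟨.inl ⟨splineDim p (p - 1) n - 1 - j, by omega, by omega⟩,
      fun t ht => bspline_reflect (by omega) hn (by dsimp only; omega) ht, fun t _ => rfl⟩
  · exact ⟨.inr ⟨splineDim (p - 1) (p - 2) n - 1 - j, by omega, by omega⟩,
      fun t _ => rfl, fun t ht => bspline_reflect (by omega) hn (by dsimp only; omega) ht⟩

theorem EdgeIdx.plus_isPP1 {p n : ℕ} (hp : 2 ≤ p) (j : EdgeIdx p n) : IsPP1 n j.plus := by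
  rcases j with j | j
  · exact isPP1_bspline hp n _
  · exact isPP1_zero n

theorem EdgeIdx.minus_isPP {p n : ℕ} (hp : 2 ≤ p) (j : EdgeIdx p n) : IsPP n j.minus := by
  rcases j with j | j
  · exact isPP_const n 0
  · exact isPP_bspline (by omega) n _

theorem EdgeIdx.plus_jet {p n : ℕ} (hp : 2 ≤ p) (hn : 1 ≤ n) (j : EdgeIdx p n) :
    HasJet1 j.plus 0 0 0 := by
  rcases j with ⟨j, h1, h2⟩ | j
  · exact hasJet1_bspline_of_three_le (by omega) hn h1
  · exact hasJet1_zero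

theorem EdgeIdx.minus_jet {p n : ℕ} (hp : 2 ≤ p) (hn : 1 ≤ n) (j : EdgeIdx p n) :
    ∃ c, HasJet1 j.minus 0 0 c := by
  rcases j with j | ⟨j, h1, h2⟩
  · exact ⟨0, hasJet1_zero⟩
  · exact hasJet1_bspline_of_two_le (by omega) hn h1

theorem EdgeIdx.edgePair {p n : ℕ} (hp : 2 ≤ p) (hn : 1 ≤ n) (j : EdgeIdx p n) :
    EdgePair n j.plus j.minus := by
  obtain ⟨j', hj, hj'⟩ := j.reflect hp hn
  refine ⟨fun e => ?_, j.minus_isPP hp, fun e => ?_, fun e => ?_⟩ <;> cases e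
  · exact j.plus_isPP1 hp
  · exact (j'.plus_isPP1 hp).congr fun x hx => by simpa [mirror] using hj x hx
  · exact j.plus_jet hp hn
  · exact (j'.plus_jet hp hn).congr fun x hx => by simpa [mirror] using hj x hx
  · exact j.minus_jet hp hn
  · obtain ⟨c, hc⟩ := j'.minus_jet hp hn
    exact ⟨c, hc.congr fun x hx => by simpa [mirror] using hj' x hx⟩

namespace MultiPatch

variable {p r n K : ℕ} {M : MultiPatch p r n K} {P : (ℝ → ℝ) → ℝ → ℝ}

/-- The properties of the degrees and of the gluing functions that the construction uses. -/
structure Admissible (M : MultiPatch p r n K) (P : (ℝ → ℝ) → ℝ → ℝ) : Prop where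
  r_lt : r < p
  two_le : 2 ≤ p
  one_le : 1 ≤ n
  six_le : 6 ≤ p + n
  alpha_pp : ∀ k s, IsPP n (M.alphaT P k s)
  beta_pp : ∀ k s, IsPP n (M.betaT P k s)
  alpha_ne : ∀ k s, ∀ t ∈ Icc (0 : ℝ) 1, M.alphaT P k s t ≠ 0

theorem Admissible.of_projection {p' r' : ℕ} (hr : 1 ≤ r) (hrp : r < p) (hn : 1 ≤ n)
    (hpn : 6 ≤ p + n) (hr' : r' < p') (hP : IsProjectionOnto (splineSpace p' r' n) P)
    (hα : ∀ k s, ¬ M.IsBoundaryEdge k s → ∀ t ∈ Icc (0 : ℝ) 1, M.alphaT P k s t ≠ 0) :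
    M.Admissible P where
  r_lt := hrp
  two_le := by omega
  one_le := hn
  six_le := hpn
  alpha_pp k s := by
    unfold alphaT
    split_ifs
    · exact isPP_const n 1
    · exact isPP_of_mem_splineSpace hr' (hP.1 _)
  beta_pp k s := by
    unfold betaT
    split_ifs
    · exact isPP_const n 0
    · exact isPP_of_mem_splineSpace hr' (hP.1 _)
  alpha_ne k s := by
    by_cases h : M.IsBoundaryEdge k s
    · intro t _
      rw [alphaT, if_pos h]
      exact one_ne_zero
    · exact hα k s h

/-- The slope of the edge function with trace `bp` and normal derivative `bm`. -/
abbrev edgeSlope (M : MultiPatch p r n K) (P : (ℝ → ℝ) → ℝ → ℝ) (k : Fin K) (s : Edge)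
    (bp bm : ℝ → ℝ) : ℝ → ℝ := slope (M.alphaT P k s) (M.betaT P k s) bp bm

theorem edgeFn_eq_strip (k : Fin K) (s : Edge) (bp bm : ℝ → ℝ) (x : ℝ × ℝ) :
    M.edgeFn P k s bp bm x = strip p r n bp (M.edgeSlope P k s bp bm) (s.param x, s.dist x) := rfl

/-- In the coordinates of the vertex every adjacent edge looks like the model edge v = 0, with
reflected gluing functions and a sign in front of β̃. The vertical edges only need an additional
exchange of coordinates. -/
theorem edgeFn_hEdge (k : Fin K) (c : Corner) (bp bm : ℝ → ℝ) :
    M.edgeFn P k c.hEdge (fun t => bp (mirror c.1 t)) (fun t => bm (mirror c.1 t)) = fun x =>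
      strip p r n bp (slope (fun t => M.alphaT P k c.hEdge (mirror c.1 t))
        (fun t => sgn c.1 * M.betaT P k c.hEdge (mirror c.1 t)) bp bm) (flip c x) := by
  funext x
  rw [edgeFn_eq_strip, (c.hEdge_param_dist x).1, (c.hEdge_param_dist x).2]
  simp only [strip, edgeSlope, slope_comp_mirror, flip]

theorem edgeFn_vEdge (k : Fin K) (c : Corner) (bp bm : ℝ → ℝ) :
    M.edgeFn P k c.vEdge (fun t => bp (mirror c.2 t)) (fun t => bm (mirror c.2 t)) = fun x =>
      strip p r n bp (slope (fun t => M.alphaT P k c.vEdge (mirror c.2 t))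
        (fun t => sgn c.2 * M.betaT P k c.vEdge (mirror c.2 t)) bp bm)
        ((flip c x).2, (flip c x).1) := by
  funext x
  rw [edgeFn_eq_strip, (c.vEdge_param_dist x).1, (c.vEdge_param_dist x).2]
  simp only [strip, edgeSlope, slope_comp_mirror, flip]

theorem horizontalSpan_eq (k : Fin K) (c : Corner) : M.horizontalSpan P k c =
    Submodule.span ℝ (range fun q x => edgeGen p r n (fun t => M.alphaT P k c.hEdge (mirror c.1 t))
      (fun t => sgn c.1 * M.betaT P k c.hEdge (mirror c.1 t)) q (flip c x)) := by
  unfold horizontalSpan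
  congr 1
  have e1 := fun j => M.edgeFn_hEdge (P := P) k c (bspline p (p - 1) n j) 0
  have e2 := fun j => M.edgeFn_hEdge (P := P) k c 0 (bspline (p - 1) (p - 2) n j)
  ext g
  constructor
  · rintro ((⟨j, hj, rfl⟩ | ⟨j, hj, rfl⟩) | rfl)
    · interval_cases j
      exacts [⟨.val, (e1 0).symm⟩, ⟨.dx, (e1 1).symm⟩, ⟨.dxx, (e1 2).symm⟩]
    · interval_cases j
      exacts [⟨.dy, (e2 0).symm⟩, ⟨.dxy, (e2 1).symm⟩]
    · exact ⟨.dyy, rfl⟩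
  · rintro ⟨q, rfl⟩
    cases q
    · exact Or.inl (Or.inl ⟨0, by omega, (e1 0).symm⟩)
    · exact Or.inl (Or.inl ⟨1, by omega, (e1 1).symm⟩)
    · exact Or.inl (Or.inr ⟨0, by omega, (e2 0).symm⟩)
    · exact Or.inl (Or.inl ⟨2, by omega, (e1 2).symm⟩)
    · exact Or.inl (Or.inr ⟨1, by omega, (e2 1).symm⟩)
    · exact Or.inr rfl

theorem verticalSpan_eq (k : Fin K) (c : Corner) : M.verticalSpan P k c =
    Submodule.span ℝ (range fun q x => edgeGen p r n (fun t => M.alphaT P k c.vEdge (mirror c.2 t))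
      (fun t => sgn c.2 * M.betaT P k c.vEdge (mirror c.2 t)) q ((flip c x).2, (flip c x).1)) := by
  unfold verticalSpan
  congr 1
  have e1 := fun j => M.edgeFn_vEdge (P := P) k c (bspline p (p - 1) n j) 0
  have e2 := fun j => M.edgeFn_vEdge (P := P) k c 0 (bspline (p - 1) (p - 2) n j)
  have e3 : cornerBspline p r n c 2 0 = fun x => tensorBspline p r n 0 2 ((flip c x).2, (flip c x).1) := by
    funext x; simp only [cornerBspline, tensorBspline, flip]; ring
  ext g
  constructor
  · rintro ((⟨j, hj, rfl⟩ | ⟨j, hj, rfl⟩) | rfl)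
    · interval_cases j
      exacts [⟨.val, (e1 0).symm⟩, ⟨.dx, (e1 1).symm⟩, ⟨.dxx, (e1 2).symm⟩]
    · interval_cases j
      exacts [⟨.dy, (e2 0).symm⟩, ⟨.dxy, (e2 1).symm⟩]
    · exact ⟨.dyy, e3.symm⟩
  · rintro ⟨q, rfl⟩
    cases q
    · exact Or.inl (Or.inl ⟨0, by omega, (e1 0).symm⟩)
    · exact Or.inl (Or.inl ⟨1, by omega, (e1 1).symm⟩)
    · exact Or.inl (Or.inr ⟨0, by omega, (e2 0).symm⟩)
    · exact Or.inl (Or.inl ⟨2, by omega, (e1 2).symm⟩)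
    · exact Or.inl (Or.inr ⟨1, by omega, (e2 1).symm⟩)
    · exact Or.inr e3.symm

theorem correctionSpan_eq (c : Corner) : correctionSpan p r n c =
    Submodule.span ℝ (range fun q x => corrGen p r n q (flip c x)) := by
  unfold correctionSpan
  congr 1
  ext g
  constructor
  · rintro ⟨i, j, hij, rfl⟩
    have hi : i ≤ 2 := by omega
    have hj : j ≤ 2 := by omega
    interval_cases i <;> interval_cases j <;> first | omega | skip
    exacts [⟨.val, rfl⟩, ⟨.dy, rfl⟩, ⟨.dyy, rfl⟩, ⟨.dx, rfl⟩, ⟨.dxy, rfl⟩, ⟨.dxx, rfl⟩]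
  · rintro ⟨q, rfl⟩
    cases q
    exacts [⟨0, 0, by omega, rfl⟩, ⟨1, 0, by omega, rfl⟩, ⟨0, 1, by omega, rfl⟩,
      ⟨2, 0, by omega, rfl⟩, ⟨1, 1, by omega, rfl⟩, ⟨0, 2, by omega, rfl⟩]

/-- The patch parametrization in the coordinates of a vertex. -/
abbrev cornerMap (M : MultiPatch p r n K) (k : Fin K) (c : Corner) : ℝ × ℝ → Plane :=
  fun x => M.F k (flip c x)

theorem Admissible.exists_cornerFn (h : M.Admissible P) (k : Fin K) (c : Corner) (Φ : C2Index → ℝ) :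
    ∃ g, CornerFn p n (p - 1) (p - 1) g (pullJet (M.cornerMap k c) Φ) ∧
      ∀ x, M.vertexFn P k c Φ x = g (flip c x) := by
  have pA : ∀ s e, IsPP n (fun t => M.alphaT P k s (mirror e t)) := fun s e =>
    (h.alpha_pp k s).comp_mirror e
  have pB : ∀ s e, IsPP n (fun t => sgn e * M.betaT P k s (mirror e t)) := fun s e =>
    (isPP_const n _).mul ((h.beta_pp k s).comp_mirror e)
  have nA : ∀ s e, M.alphaT P k s (mirror e 0) ≠ 0 := fun s e =>
    h.alpha_ne k s _ (mirror_mem zero_mem01)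
  obtain ⟨g₁, h₁, e₁⟩ := (corner_edgeGen h.r_lt h.two_le h.one_le h.six_le (pA c.hEdge c.1)
    (pB c.hEdge c.1) (nA _ _)).exists_cornerFn (M.F k) c Φ (M.horizontalSpan_eq (P := P) k c)
  obtain ⟨g₂, h₂, e₂⟩ := (corner_edgeGen h.r_lt h.two_le h.one_le h.six_le (pA c.vEdge c.2)
    (pB c.vEdge c.2) (nA _ _)).swap.exists_cornerFn (M.F k) c Φ (M.verticalSpan_eq (P := P) k c)
  obtain ⟨g₃, h₃, e₃⟩ := (corner_corrGen h.r_lt h.two_le h.one_le h.six_le).exists_cornerFn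
    (M.F k) c Φ (correctionSpan_eq (p := p) (r := r) (n := n) c)
  refine ⟨_, CornerFn.combine h.two_le h.one_le h.r_lt h₁ h₂ h₃, fun x => ?_⟩
  simp only [vertexFn, interpolant, Pi.sub_apply, Pi.add_apply, e₁, e₂, e₃]

/-! ### Edge functions along all edges -/

theorem Admissible.slope_pp (h : M.Admissible P) (k : Fin K) (s : Edge) {bp bm : ℝ → ℝ}
    (hb : EdgePair n bp bm) : IsPP n (M.edgeSlope P k s bp bm) :=
  isPP_slope (h.alpha_pp k s) (h.beta_pp k s) hb.plus_isPP1 hb.minus_pp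

/-- At the two ends of the edge the trace vanishes to second order and the slope to first order; at
the other two vertices the factors across the edge have zero two-jets. -/
theorem Admissible.edgeFn_jet (h : M.Admissible P) (k : Fin K) (s : Edge) {bp bm : ℝ → ℝ}
    (hb : EdgePair n bp bm) (c : Corner) : HasJet2 (fun x => M.edgeFn P k s bp bm (flip c x)) 0 := by
  have key : ∀ d : Corner, HasJet2 (fun x => strip p r n bp (M.edgeSlope P k s bp bm) (flip d x)) 0 := by
    intro d
    by_cases hd : d = (false, false)
    · subst hd
      obtain ⟨c, hc⟩ := hb.slope_jet h.one_le (h.alpha_pp k s) (h.beta_pp k s) false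
      exact hasJet2_strip_zero h.r_lt h.one_le (hb.plus_jet false) hc
    · obtain ⟨c, hc⟩ := hb.slope_jet h.one_le (h.alpha_pp k s) (h.beta_pp k s) true
      exact hasJet2_strip_flip h.r_lt h.one_le h.six_le hb.plus_isPP1.isPP (h.slope_pp k s hb)
        (hb.plus_jet true) hc hd
  obtain ⟨d, hd | hd⟩ := s.coords_flip c
  · exact (key d).congr fun x _ => by rw [edgeFn_eq_strip, hd]
  · exact (key d).swap.congr fun x _ => by rw [edgeFn_eq_strip, hd]

theorem Admissible.edgeFn_trace (h : M.Admissible P) (k : Fin K) (s : Edge) (bp bm : ℝ → ℝ) (t : ℝ) :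
    M.edgeFn P k s bp bm (s.frame 0 t) = bp t := by
  rw [edgeFn_eq_strip, s.param_frame, s.dist_frame, strip_bottom h.r_lt h.one_le]

theorem Admissible.edgeFn_trans (h : M.Admissible P) (k : Fin K) (s : Edge) (bp bm : ℝ → ℝ) (t : ℝ) :
    HasDerivWithinAt (fun d => M.edgeFn P k s bp bm (s.frame d t)) (M.edgeSlope P k s bp bm t)
      (Icc 0 1) 0 := by
  obtain ⟨w, hw⟩ := hasJet1_cross_zero h.r_lt h.one_le
  obtain ⟨z, hz⟩ := hasJet1_cross_one h.r_lt h.one_le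
  have := (hw.hasDerivWithinAt.const_mul (bp t)).add
    (hz.hasDerivWithinAt.const_mul (M.edgeSlope P k s bp bm t))
  rw [mul_zero, mul_one, zero_add] at this
  refine this.congr (fun d _ => ?_) ?_ <;>
  · rw [edgeFn_eq_strip, s.param_frame, s.dist_frame]
    simp only [strip, Pi.add_apply]; ring

/-- On an adjacent edge, value and derivative vanish because trace and slope do so at the end of
`s`; on the opposite edge because the first two B-splines do so at 1. -/
theorem Admissible.edgeFn_other (h : M.Admissible P) (k : Fin K) {s s' : Edge} (hs : s' ≠ s)
    {bp bm : ℝ → ℝ} (hb : EdgePair n bp bm) (t : ℝ) :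
    HasDerivWithinAt (fun d => M.edgeFn P k s bp bm (s'.frame d t)) 0 (Icc 0 1) 0 ∧
      M.edgeFn P k s bp bm (s'.frame 0 t) = 0 := by
  have hN := add_le_splineDim h.r_lt (n := n)
  have h6 := h.six_le
  rcases Edge.coords_frame hs with ⟨e, e', he⟩ | he
  · obtain ⟨c, hc⟩ := hb.slope_jet h.one_le (h.alpha_pp k s) (h.beta_pp k s) e
    have hp := hb.plus_jet e
    have e0 : ∀ d, M.edgeFn P k s bp bm (s'.frame d t) = bp (mirror e d) *
        (bspline p r n 0 (mirror e' t) + bspline p r n 1 (mirror e' t)) +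
        M.edgeSlope P k s bp bm (mirror e d) * (((1 / n : ℝ) / p) * bspline p r n 1 (mirror e' t)) := by
      intro d
      rw [edgeFn_eq_strip, (he d t).1, (he d t).2]
      simp only [strip]; ring
    have := (hp.hasDerivWithinAt.mul_const
      (bspline p r n 0 (mirror e' t) + bspline p r n 1 (mirror e' t))).add
        (hc.hasDerivWithinAt.mul_const (((1 / n : ℝ) / p) * bspline p r n 1 (mirror e' t)))
    simp only [zero_mul, add_zero] at this
    refine ⟨this.congr (fun d _ => e0 d) (e0 0), ?_⟩
    obtain ⟨_, _, _, h1, _⟩ := hp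
    obtain ⟨_, _, _, h2, _⟩ := hc
    dsimp only at h1 h2
    rw [e0, h1, edgeSlope, h2]; simp
  · have h0 := hasJet1_bspline_reflect h.r_lt h.one_le (i := 0) (n := n) (by omega)
    have h1 := hasJet1_bspline_reflect h.r_lt h.one_le (i := 1) (n := n) (by omega)
    have e0 : ∀ d, M.edgeFn P k s bp bm (s'.frame d t) = bp t *
        (bspline p r n 0 (mirror true d) + bspline p r n 1 (mirror true d)) +
        (M.edgeSlope P k s bp bm t * ((1 / n : ℝ) / p)) * bspline p r n 1 (mirror true d) := by
      intro d
      rw [edgeFn_eq_strip, (he d t).1, (he d t).2]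
      simp only [strip]
    have := ((h0.hasDerivWithinAt.add h1.hasDerivWithinAt).const_mul (bp t)).add
      (h1.hasDerivWithinAt.const_mul (M.edgeSlope P k s bp bm t * ((1 / n : ℝ) / p)))
    simp only [mul_zero, add_zero] at this
    refine ⟨this.congr (fun d _ => e0 d) (e0 0), ?_⟩
    rw [edgeFn_eq_strip, (he 0 t).1, (he 0 t).2]
    simpa [mirror] using strip_top h.r_lt h.one_le h.six_le _ _ _

theorem Admissible.edgeFn_cont (h : M.Admissible P) (k : Fin K) (s : Edge) {bp bm : ℝ → ℝ}
    (hb : EdgePair n bp bm) : ContinuousOn (M.edgeFn P k s bp bm) square :=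
  (continuousOn_strip h.r_lt h.one_le hb.plus_isPP1.isPP (h.slope_pp k s hb)).comp
    (s.continuous_param.prodMk s.continuous_dist).continuousOn
    fun _ hx => ⟨s.param_mem hx, s.dist_mem hx⟩

end MultiPatch

/-! ### Patch interior functions along the edges -/

theorem InteriorIdx.jet_left {p r n i : ℕ} (hrp : r < p) (hn : 1 ≤ n) (hi : 2 ≤ i)
    (hi' : i + 2 < splineDim p r n) (e : Bool) :
    ∃ c, HasJet1 (fun x => bspline p r n i (mirror e x)) 0 0 c := by
  cases e
  · exact hasJet1_bspline_of_two_le hrp hn hi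
  · obtain ⟨c, hc⟩ := hasJet1_bspline_of_two_le hrp hn (i := splineDim p r n - 1 - i) (by omega)
    exact ⟨c, hc.congr fun x hx => by
      simpa [mirror] using bspline_reflect hrp hn (i' := splineDim p r n - 1 - i) (by omega) hx⟩

theorem InteriorIdx.jet {p r n : ℕ} (hrp : r < p) (hn : 1 ≤ n) (q : InteriorIdx p r n) (c : Corner) :
    HasJet2 (fun x => tensorBspline p r n q.1.1 q.1.2 (flip c x)) 0 := by
  obtain ⟨a, ha⟩ := InteriorIdx.jet_left hrp hn q.2.1.1 q.2.1.2 c.1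
  obtain ⟨b, hb⟩ := InteriorIdx.jet_left hrp hn q.2.2.1 q.2.2.2 c.2
  exact ha.tens_zero_mixed hb

theorem InteriorIdx.edge {p r n : ℕ} (hrp : r < p) (hn : 1 ≤ n) (q : InteriorIdx p r n) (s : Edge)
    (t : ℝ) :
    HasDerivWithinAt (fun d => tensorBspline p r n q.1.1 q.1.2 (s.frame d t)) 0 (Icc 0 1) 0 ∧
      tensorBspline p r n q.1.1 q.1.2 (s.frame 0 t) = 0 := by
  obtain ⟨a, ha⟩ := InteriorIdx.jet_left hrp hn q.2.1.1 q.2.1.2 false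
  obtain ⟨b, hb⟩ := InteriorIdx.jet_left hrp hn q.2.2.1 q.2.2.2 false
  obtain ⟨a', ha'⟩ := InteriorIdx.jet_left hrp hn q.2.1.1 q.2.1.2 true
  obtain ⟨b', hb'⟩ := InteriorIdx.jet_left hrp hn q.2.2.1 q.2.2.2 true
  cases s
  · obtain ⟨_, _, _, h1, _⟩ := id hb
    exact ⟨by have := hb.hasDerivWithinAt.const_mul (bspline p r n q.1.1 t); rwa [mul_zero] at this,
      mul_eq_zero_of_right _ h1⟩
  · obtain ⟨_, _, _, h1, _⟩ := id ha'
    exact ⟨by have := ha'.hasDerivWithinAt.mul_const (bspline p r n q.1.2 t); rwa [zero_mul] at this,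
      mul_eq_zero_of_left h1 _⟩
  · obtain ⟨_, _, _, h1, _⟩ := id hb'
    exact ⟨by have := hb'.hasDerivWithinAt.const_mul (bspline p r n q.1.1 t); rwa [mul_zero] at this,
      mul_eq_zero_of_right _ h1⟩
  · obtain ⟨_, _, _, h1, _⟩ := id ha
    exact ⟨by have := ha.hasDerivWithinAt.mul_const (bspline p r n q.1.2 t); rwa [zero_mul] at this,
      mul_eq_zero_of_left h1 _⟩

end ApproxC1
end

noncomputable section
namespace ApproxC1
open Filter Topology

/-! ## Global functions -/

/-- The end point of an edge at the parameter `0` or `1`. -/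
def Edge.corner : Edge → Bool → Corner
  | .bottom, e => (e, false)
  | .right, e => (true, e)
  | .top, e => (e, true)
  | .left, e => (false, e)

theorem Edge.frame_mirror (s : Edge) (e : Bool) :
    (∀ u, s.frame 0 (mirror e u) = flip (s.corner e) (u, 0)) ∨
      ∀ u, s.frame 0 (mirror e u) = flip (s.corner e) (0, u) := by
  cases s
  · exact Or.inl fun u => by
      cases e <;> simp [Edge.frame, Edge.corner, flip, mirror]
  · exact Or.inr fun u => by
      cases e <;> simp [Edge.frame, Edge.corner, flip, mirror]
  · exact Or.inl fun u => by
      cases e <;> simp [Edge.frame, Edge.corner, flip, mirror]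
  · exact Or.inr fun u => by
      cases e <;> simp [Edge.frame, Edge.corner, flip, mirror]

theorem Edge.pt_corner (s : Edge) (e : Bool) : (s.corner e).pt = s.frame 0 (mirror e 0) := by
  rcases s.frame_mirror e with h | h <;> rw [h, flip_zero]

theorem Edge.frame_of_ne_corner (s : Edge) {c : Corner} (h : ∀ e, s.corner e ≠ c) {t : ℝ}
    (ht : t ∈ Icc (0 : ℝ) 1) :
    ∃ u ∈ Icc (0 : ℝ) 1, s.frame 0 t = flip c (1, u) ∨ s.frame 0 t = flip c (u, 1) := by
  rcases c with ⟨a, b⟩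
  have h0 := h a
  have h1 := h b
  cases s <;> simp only [Edge.corner, ne_eq, Prod.mk.injEq, true_and, and_true] at h0 h1
  · exact ⟨mirror a t, mirror_mem ht, Or.inr (by
      cases b <;> simp_all [Edge.frame, flip, mirror])⟩
  · exact ⟨mirror b t, mirror_mem ht, Or.inl (by
      cases a <;> simp_all [Edge.frame, flip, mirror])⟩
  · exact ⟨mirror a t, mirror_mem ht, Or.inr (by
      cases b <;> simp_all [Edge.frame, flip, mirror])⟩
  · exact ⟨mirror b t, mirror_mem ht, Or.inl (by
      cases a <;> simp_all [Edge.frame, flip, mirror])⟩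

theorem Edge.frame_injective {s s' : Edge} {t t' : ℝ} (ht : t ∈ Ioo (0 : ℝ) 1) (ht' : t' ∈ Ioo (0 : ℝ) 1)
    (h : s.frame 0 t = s'.frame 0 t') : s = s' := by
  obtain ⟨h1, h2⟩ := ht
  obtain ⟨h3, h4⟩ := ht'
  cases s <;> cases s' <;> simp only [Edge.frame, Prod.mk.injEq] at h <;> first
    | rfl
    | (exfalso; obtain ⟨ha, hb⟩ := h; linarith)

theorem Corner.pt_mem (c : Corner) : c.pt ∈ square := by
  rw [← flip_zero]; exact flip_mem zero_mem_square

theorem Corner.pt_injective : Function.Injective Corner.pt := by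
  rintro ⟨a, b⟩ ⟨a', b'⟩ h
  rw [Corner.pt, Corner.pt, Prod.mk.injEq] at h
  cases a <;> cases b <;> cases a' <;> cases b' <;> simp_all [mirror]

theorem flip_eq_flip_flip (c d : Corner) (x : ℝ × ℝ) :
    flip d x = flip c (flip (xor c.1 d.1, xor c.2 d.2) x) := by
  simp [flip, mirror_comp]

theorem continuousOn_tensorSplineSpace {p r n : ℕ} (hrp : r < p) (hn : 1 ≤ n) {w : ℝ × ℝ → ℝ}
    (hw : w ∈ tensorSplineSpace p r n) : ContinuousOn w square := by
  unfold tensorSplineSpace at hw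
  induction hw using Submodule.span_induction with
  | mem w h => obtain ⟨i, -, j, -, rfl⟩ := h; exact continuousOn_tensorBspline hrp hn i j
  | zero => exact continuousOn_const
  | add f g _ _ hf hg => exact hf.add hg
  | smul a f _ hf => exact hf.const_smul a

theorem isCompact_square : IsCompact square := isCompact_Icc.prod isCompact_Icc

namespace MultiPatch

variable {p r n K : ℕ} {M : MultiPatch p r n K} {P : (ℝ → ℝ) → ℝ → ℝ}

theorem continuousOn_F (hrp : r < p) (hn : 1 ≤ n) (M : MultiPatch p r n K) (k : Fin K) :
    ContinuousOn (M.F k) square := by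
  have h : ∀ i, ContinuousOn (fun x => M.F k x i) square := fun i => by
    obtain ⟨w, hw, hFw⟩ := M.spline k i
    exact (continuousOn_tensorSplineSpace hrp hn hw).congr hFw
  exact (PiLp.continuous_toLp 2 (fun _ : Fin 2 => ℝ)).comp_continuousOn (continuousOn_pi.2 h)

theorem F_mem (M : MultiPatch p r n K) (k : Fin K) {x : ℝ × ℝ} (hx : x ∈ square) :
    M.F k x ∈ closure M.Ω := by
  rw [M.closure_eq]; exact mem_iUnion.2 ⟨k, x, hx, rfl⟩

theorem pull_apply (k : Fin K) (φ : M.C0) {x : ℝ × ℝ} (hx : x ∈ square) :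
    M.pull k φ x = φ ⟨M.F k x, M.F_mem k hx⟩ := by rw [pull, dif_pos]

/-- The pull-back to a patch as a linear map. -/
def pullL (M : MultiPatch p r n K) (k : Fin K) : M.C0 →ₗ[ℝ] ℝ × ℝ → ℝ where
  toFun := M.pull k
  map_add' φ ψ := by funext x; simp only [pull, Pi.add_apply]; split_ifs <;> simp
  map_smul' a φ := by funext x; simp only [pull, Pi.smul_apply]; split_ifs <;> simp

theorem ext_of_pull {φ ψ : M.C0} (h : ∀ k, ∀ x ∈ square, M.pull k φ x = M.pull k ψ x) : φ = ψ := by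
  ext ⟨y, hy⟩
  have hy' := hy
  rw [M.closure_eq] at hy'
  obtain ⟨k, x, hx, rfl⟩ := mem_iUnion.1 hy'
  have := h k x hx
  rwa [pull_apply k φ hx, pull_apply k ψ hx] at this

theorem pull_sum {ι : Type*} (s : Finset ι) (k : Fin K) (a : ι → ℝ) (φ : ι → M.C0) (x : ℝ × ℝ) :
    M.pull k (∑ i ∈ s, a i • φ i) x = ∑ i ∈ s, a i * M.pull k (φ i) x := by
  have := congrFun (map_sum (M.pullL k) (fun i => a i • φ i) s) x
  simp only [map_smul, Finset.sum_apply, Pi.smul_apply, smul_eq_mul] at this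
  exact this

/-- The disjoint union of the squares is compact and maps continuously onto the closed domain, which
is Hausdorff. The map is therefore closed, hence a quotient map, and a continuous function constant
on its fibres descends. -/
theorem exists_glue (hrp : r < p) (hn : 1 ≤ n) (g : Fin K → ℝ × ℝ → ℝ)
    (hg : ∀ k, ContinuousOn (g k) square)
    (hc : ∀ k l, ∀ x ∈ square, ∀ y ∈ square, M.F k x = M.F l y → g k x = g l y) :
    ∃ φ : M.C0, ∀ k, M.PullsTo k φ (g k) := by
  have : CompactSpace square := isCompact_iff_compactSpace.1 isCompact_square
  let π : Fin K × square → closure M.Ω := fun q => ⟨M.F q.1 q.2, M.F_mem q.1 q.2.2⟩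
  have hπ : Continuous π := by
    refine Continuous.subtype_mk (continuous_prod_of_discrete_left.2 fun k => ?_) _
    exact (continuousOn_F hrp hn M k).domRestrict
  have hs : Function.Surjective π := by
    rintro ⟨y, hy⟩
    have hy' := hy
    rw [M.closure_eq] at hy'
    obtain ⟨k, x, hx, rfl⟩ := mem_iUnion.1 hy'
    exact ⟨(k, ⟨x, hx⟩), rfl⟩
  have hq : Topology.IsQuotientMap π := hπ.isClosedMap.isQuotientMap hπ hs
  let G : C(Fin K × square, ℝ) := ⟨fun q => g q.1 q.2,
    continuous_prod_of_discrete_left.2 fun k => (hg k).domRestrict⟩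
  have hG : Function.FactorsThrough G π := fun a b hab =>
    hc a.1 b.1 _ a.2.2 _ b.2.2 (Subtype.ext_iff.1 hab)
  refine ⟨hq.lift (f := ⟨π, hπ⟩) G hG, fun k x hx => ?_⟩
  rw [pull_apply k _ hx]
  exact congrArg (fun f : C(Fin K × square, ℝ) => f (k, ⟨x, hx⟩)) (hq.lift_comp (f := ⟨π, hπ⟩) G hG)

/-! ### Shared edges -/

theorem edge_unique {k : Fin K} {s s' : Edge} (h : edgeSet (M.F k) s = edgeSet (M.F k) s') : s = s' := by
  have ht : (1 / 2 : ℝ) ∈ Ioo (0 : ℝ) 1 := by norm_num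
  have : M.F k (s.frame 0 (1 / 2)) ∈ edgeSet (M.F k) s' := h ▸ ⟨_, ht, rfl⟩
  obtain ⟨t', ht', he⟩ := this
  exact Edge.frame_injective ht ht' (M.injOn k (s'.frame_mem zero_mem01 (Ioo_subset_Icc_self ht'))
    (s.frame_mem zero_mem01 (Ioo_subset_Icc_self ht)) he).symm

theorem exists_transition {k l : Fin K} {s s' : Edge} (hkl : k ≠ l)
    (h : edgeSet (M.F k) s = edgeSet (M.F l) s') :
    ∃ e, ∀ t ∈ Icc (0 : ℝ) 1, M.F k (s.frame 0 t) = M.F l (s'.frame 0 (mirror e t)) := by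
  rcases M.conforming k l s s' hkl h with h | h
  · exact ⟨false, h⟩
  · exact ⟨true, h⟩

theorem frame_param_injective {l : Fin K} {s : Edge} {t t' : ℝ} (ht : t ∈ Icc (0 : ℝ) 1)
    (ht' : t' ∈ Icc (0 : ℝ) 1) (h : M.F l (s.frame 0 t) = M.F l (s.frame 0 t')) : t = t' := by
  have := M.injOn l (s.frame_mem zero_mem01 ht) (s.frame_mem zero_mem01 ht') h
  rw [← s.param_frame 0 t, this, s.param_frame]

/-- Conformity allows the identity or the reflection; comparing the images of the end point 0
decides correctly, because the parametrizations are injective. -/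
theorem transition_eq (κ : M.Interface) : ∃ e, (∀ t, M.transition κ t = mirror e t) ∧
    ∀ t ∈ Icc (0 : ℝ) 1, M.F κ.1.1.1 (κ.1.1.2.frame 0 t)
      = M.F κ.1.2.1 (κ.1.2.2.frame 0 (mirror e t)) := by
  obtain ⟨e, he⟩ := exists_transition κ.2.1.ne κ.2.2
  refine ⟨e, fun t => ?_, he⟩
  have h0 := he 0 zero_mem01
  cases e
  · exact if_pos h0
  · rw [transition, if_neg]
    · rfl
    · intro h
      rw [h] at h0
      have := frame_param_injective zero_mem01 (mirror_mem zero_mem01) h0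
      simp [mirror] at this

theorem corner_unique {k : Fin K} {c c' : Corner} (h : M.F k c.pt = M.F k c'.pt) : c = c' :=
  Corner.pt_injective (M.injOn k c.pt_mem c'.pt_mem h)

/-- Without hanging nodes, distinct patches meet only at common vertices or on shared edges, and the
transition determines which parameters of a shared edge correspond. -/
theorem compatible_of_edges (g : Fin K → ℝ × ℝ → ℝ)
    (hc : ∀ k l (c c' : Corner), M.F k c.pt = M.F l c'.pt → g k c.pt = g l c'.pt)
    (he : ∀ k l s s' e, k ≠ l → edgeSet (M.F k) s = edgeSet (M.F l) s' →
      (∀ t ∈ Icc (0 : ℝ) 1, M.F k (s.frame 0 t) = M.F l (s'.frame 0 (mirror e t))) →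
      ∀ t ∈ Icc (0 : ℝ) 1, g k (s.frame 0 t) = g l (s'.frame 0 (mirror e t))) :
    ∀ k l, ∀ x ∈ square, ∀ y ∈ square, M.F k x = M.F l y → g k x = g l y := by
  intro k l x hx y hy hxy
  by_cases hkl : k = l
  · subst hkl
    rw [M.injOn k hx hy hxy]
  rcases M.no_hanging k l hkl x hx y hy hxy with ⟨c, c', rfl, rfl⟩ | ⟨s, s', hs, ⟨t, ht, rfl⟩, t', ht', rfl⟩
  · exact hc k l c c' hxy
  · obtain ⟨e, hE⟩ := exists_transition hkl hs
    have ht1 := Ioo_subset_Icc_self ht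
    have : t' = mirror e t := by
      rw [hE t ht1] at hxy
      exact (frame_param_injective (mirror_mem ht1) (Ioo_subset_Icc_self ht') hxy).symm
    rw [this]
    exact he k l s s' e hkl hs hE t ht1

theorem not_shared (σ : M.BoundaryEdge) {l : Fin K} {s' : Edge} (hl : l ≠ σ.1.1) :
    edgeSet (M.F l) s' ≠ edgeSet (M.F σ.1.1) σ.1.2 := fun h =>
  (M.edge_dichotomy _ _).1 σ.2 ⟨l, s', hl, h⟩

/-- The partner of an edge is unique. -/
theorem partner_unique {k l m : Fin K} {s s' s'' : Edge} (hl : l ≠ k) (hm : m ≠ k)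
    (h : edgeSet (M.F l) s' = edgeSet (M.F k) s) (h' : edgeSet (M.F m) s'' = edgeSet (M.F k) s) :
    (l, s') = (m, s'') := by
  obtain rfl := M.interface_two k l m s s' s'' hl hm h h'
  rw [edge_unique (h.trans h'.symm)]

/-- The edges of a component. -/
def compEdges : M.Comp → Set (Fin K × Edge)
  | .interior _ => ∅
  | .interface κ => {κ.1.1, κ.1.2}
  | .vertex _ => ∅
  | .boundary σ => {σ.1}

/-- An edge has at most one partner, the ordering k < l excludes the same interface listed with its
sides exchanged, and a boundary edge has no partner. -/
theorem compEdges_unique {c c' : M.Comp} {q : Fin K × Edge} (h : q ∈ compEdges c)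
    (h' : q ∈ compEdges c') : c = c' := by
  rcases c with k | κ | V | σ <;> rcases c' with k' | κ' | V' | σ' <;>
    simp only [compEdges, mem_empty_iff_false, mem_insert_iff, mem_singleton_iff] at h h'
  · have lt := κ.2.1
    have lt' := κ'.2.1
    have e := κ.2.2
    have e' := κ'.2.2
    congr 1
    refine Subtype.ext (Prod.ext_iff.2 ?_)
    rcases h with rfl | rfl <;> rcases h' with h' | h'
    · rw [← h'] at lt' e'
      exact ⟨h', partner_unique lt.ne' lt'.ne' e.symm e'.symm⟩
    · rw [← h'] at lt' e'
      have : κ.1.2.1 = κ'.1.1.1 := congrArg Prod.fst (partner_unique lt.ne' lt'.ne e.symm e')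
      rw [← this] at lt'
      exact absurd lt' lt.asymm
    · rw [← h'] at lt' e'
      have : κ.1.1.1 = κ'.1.2.1 := congrArg Prod.fst (partner_unique lt.ne lt'.ne' e e'.symm)
      rw [← this] at lt'
      exact absurd lt' lt.asymm
    · rw [← h'] at lt' e'
      exact ⟨partner_unique lt.ne lt'.ne e e', h'⟩
  · rcases h with h | h <;> subst h
    · have := κ.2.2
      have hne := κ.2.1.ne'
      rw [h'] at this hne
      exact absurd this.symm (not_shared σ' hne)
    · have := κ.2.2
      have hne := κ.2.1.ne
      rw [h'] at this hne
      exact absurd this (not_shared σ' hne)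
  · rcases h' with h' | h' <;> subst h'
    · have := κ'.2.2
      have hne := κ'.2.1.ne'
      rw [h] at this hne
      exact absurd this.symm (not_shared σ hne)
    · have := κ'.2.2
      have hne := κ'.2.1.ne
      rw [h] at this hne
      exact absurd this (not_shared σ hne)
  · rw [Subtype.ext (h.symm.trans h')]

end MultiPatch
end ApproxC1
end

noncomputable section
namespace ApproxC1
open Filter Topology
namespace MultiPatch

variable {p r n K : ℕ} {M : MultiPatch p r n K} {P : (ℝ → ℝ) → ℝ → ℝ}

/-! ## The coupled functions -/

open Classical in
/-- The pull-backs of the coupled functions to the patches. -/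
def localFn (M : MultiPatch p r n K) (P : (ℝ → ℝ) → ℝ → ℝ) :
    (c : M.Comp) → M.LocalIdx c → Fin K → ℝ × ℝ → ℝ
  | .interior k₀, (q : InteriorIdx p r n), k =>
      if k = k₀ then tensorBspline p r n q.1.1 q.1.2 else 0
  | .interface κ, (j : EdgeIdx p n), k =>
      if k = κ.1.1.1 then M.edgeFn P κ.1.1.1 κ.1.1.2 j.plus j.minus
      else if k = κ.1.2.1 then M.edgeFn P κ.1.2.1 κ.1.2.2 (fun t => j.plus (M.transition κ t))
        (fun t => -j.minus (M.transition κ t))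
      else 0
  | .vertex V, (q : C2Index), k =>
      if h : M.HasVertex k V.1 then M.vertexFn P k h.choose (Pi.single q 1) else 0
  | .boundary σ, (j : EdgeIdx p n), k =>
      if k = σ.1.1 then M.edgeFn P σ.1.1 σ.1.2 j.plus j.minus else 0

open Classical in
/-- The `C²`-data of the coupled functions at a point. -/
def compData (M : MultiPatch p r n K) : (c : M.Comp) → M.LocalIdx c → Plane → C2Index → ℝ
  | .interior _, _, _ => 0
  | .interface _, _, _ => 0
  | .vertex V, (q : C2Index), X => if X = V.1 then Pi.single q 1 else 0
  | .boundary _, _, _ => 0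

theorem Admissible.transition_pair (h : M.Admissible P) (κ : M.Interface) (j : EdgeIdx p n) :
    EdgePair n (fun t => j.plus (M.transition κ t)) (fun t => -j.minus (M.transition κ t)) := by
  obtain ⟨e, he, -⟩ := M.transition_eq κ
  simp only [he]
  exact (j.edgePair h.two_le h.one_le).comp_mirror e

theorem localFn_vertex {V : M.Vertex} (q : C2Index) {k : Fin K} {c : Corner}
    (hc : M.F k c.pt = V.1) : M.localFn P (.vertex V) q k = M.vertexFn P k c (Pi.single q 1) := by
  have hV : M.HasVertex k V.1 := ⟨c, hc⟩
  have : hV.choose = c := corner_unique (hV.choose_spec.trans hc.symm)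
  simp only [localFn]
  rw [dif_pos hV, this]

theorem localFn_vertex_of_not {V : M.Vertex} (q : C2Index) {k : Fin K}
    (hV : ¬ M.HasVertex k V.1) : M.localFn P (.vertex V) q k = 0 := by
  simp only [localFn]
  rw [dif_neg hV]

theorem Admissible.localFn_cont (h : M.Admissible P) (c : M.Comp) (j : M.LocalIdx c) (k : Fin K) :
    ContinuousOn (M.localFn P c j k) square := by
  have z : ContinuousOn (0 : ℝ × ℝ → ℝ) square := continuousOn_const
  cases c with
  | interior k₀ =>
    simp only [localFn]
    split_ifs
    · exact continuousOn_tensorBspline h.r_lt h.one_le _ _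
    · exact z
  | interface κ =>
    simp only [localFn]
    split_ifs
    · exact h.edgeFn_cont _ _ (EdgeIdx.edgePair h.two_le h.one_le j)
    · exact h.edgeFn_cont _ _ (h.transition_pair κ j)
    · exact z
  | vertex V =>
    by_cases hV : M.HasVertex k V.1
    · obtain ⟨c, hc⟩ := hV
      rw [localFn_vertex j hc]
      obtain ⟨g, hg, e⟩ := h.exists_cornerFn k c (Pi.single j 1)
      have : M.vertexFn P k c (Pi.single j 1) = g ∘ flip c := funext e
      rw [this]
      refine hg.cont.comp ?_ fun _ => flip_mem
      have hm : ∀ e, Continuous (mirror e) := fun e => by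
        cases e
        · exact continuous_id
        · exact continuous_const.sub continuous_id
      exact (((hm _).comp continuous_fst).prodMk ((hm _).comp continuous_snd)).continuousOn
    · rw [localFn_vertex_of_not j hV]; exact z
  | boundary σ =>
    simp only [localFn]
    split_ifs
    · exact h.edgeFn_cont _ _ (EdgeIdx.edgePair h.two_le h.one_le j)
    · exact z

/-- The data depend on the physical point alone and not on the patch. This one statement yields
compatibility at vertices, the C² property and the vanishing of vertex coefficients. -/
theorem Admissible.localFn_jet (h : M.Admissible P) (c : M.Comp) (j : M.LocalIdx c) (k : Fin K)
    (d : Corner) : HasJet2 (fun x => M.localFn P c j k (flip d x))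
      (pullJet (M.cornerMap k d) (M.compData c j (M.F k d.pt))) := by
  cases c with
  | interior k₀ =>
    simp only [localFn, compData, map_zero]
    split_ifs
    · exact InteriorIdx.jet h.r_lt h.one_le j d
    · exact hasJet2_zero
  | interface κ =>
    simp only [localFn, compData, map_zero]
    split_ifs
    · exact h.edgeFn_jet _ _ (EdgeIdx.edgePair h.two_le h.one_le j) d
    · exact h.edgeFn_jet _ _ (h.transition_pair κ j) d
    · exact hasJet2_zero
  | vertex V =>
    by_cases hV : M.HasVertex k V.1
    · obtain ⟨c, hc⟩ := hV
      rw [localFn_vertex j hc]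
      obtain ⟨g, hg, e⟩ := h.exists_cornerFn k c (Pi.single j 1)
      simp only [compData]
      by_cases hd : c = d
      · subst hd
        rw [if_pos hc]
        exact hg.jet.congr fun x _ => by rw [e, flip_flip]
      · rw [if_neg (fun h' => hd (corner_unique (hc.trans h'.symm))), map_zero]
        refine (hg.far (xor c.1 d.1, xor c.2 d.2) fun h' => hd ?_).congr fun x _ => ?_
        · rw [Prod.mk.injEq, bne_eq_false_iff_eq, bne_eq_false_iff_eq] at h'
          exact Prod.ext h'.1 h'.2
        · rw [e, flip_eq_flip_flip c d, flip_flip]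
    · rw [localFn_vertex_of_not j hV]
      simp only [compData]
      rw [if_neg fun h' => hV ⟨d, h'⟩, map_zero]
      exact hasJet2_zero
  | boundary σ =>
    simp only [localFn, compData, map_zero]
    split_ifs
    · exact h.edgeFn_jet _ _ (EdgeIdx.edgePair h.two_le h.one_le j) d
    · exact hasJet2_zero

/-- Only the functions of a vertex and those of the edge itself contribute to the trace and the
transversal derivative on an edge. -/
theorem Admissible.localFn_edge (h : M.Admissible P) (c : M.Comp) (hc : ∀ V, c ≠ .vertex V)
    (j : M.LocalIdx c) {k : Fin K} {s : Edge} (hs : (k, s) ∉ compEdges c) (t : ℝ) :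
    HasDerivWithinAt (fun d => M.localFn P c j k (s.frame d t)) 0 (Icc 0 1) 0 ∧
      M.localFn P c j k (s.frame 0 t) = 0 := by
  have z : HasDerivWithinAt (fun d => (0 : ℝ × ℝ → ℝ) (s.frame d t)) 0 (Icc 0 1) 0 ∧
      (0 : ℝ × ℝ → ℝ) (s.frame 0 t) = 0 := ⟨hasDerivWithinAt_const .., rfl⟩
  cases c with
  | interior k₀ =>
    simp only [localFn]
    split_ifs
    · exact InteriorIdx.edge h.r_lt h.one_le j s t
    · exact z
  | interface κ =>
    simp only [localFn]
    split_ifs with h1 h2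
    · refine h.edgeFn_other _ (fun h' => hs ?_) (EdgeIdx.edgePair h.two_le h.one_le j) t
      exact Or.inl (Prod.ext h1 h')
    · refine h.edgeFn_other _ (fun h' => hs ?_) (h.transition_pair κ j) t
      exact Or.inr (Prod.ext h2 h')
    · exact z
  | vertex V => exact absurd rfl (hc V)
  | boundary σ =>
    simp only [localFn]
    split_ifs with h1
    · refine h.edgeFn_other _ (fun h' => hs ?_) (EdgeIdx.edgePair h.two_le h.one_le j) t
      exact Prod.ext h1 h'
    · exact z

/-! ### Traces of the vertex functions -/

/-- The one-jet-set of traces along a curve of functions with `C²`-data `Φ`. -/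
def HasCurveJet (γ : ℝ → Plane) (Φ : C2Index → ℝ) (f : ℝ → ℝ) : Prop :=
  HasJet1 f (Φ .val) (gradAt Φ (derivWithin γ (Icc 0 1) 0))
    (hessAt Φ (derivWithin γ (Icc 0 1) 0) (derivWithin γ (Icc 0 1) 0)
      + gradAt Φ (derivWithin (derivWithin γ (Icc 0 1)) (Icc 0 1) 0))

/-- The jet of a trace sees the patch only through the parametrized edge, which is common to the two
neighbours. -/
theorem HasCurveJet.congr {γ γ' : ℝ → Plane} {Φ : C2Index → ℝ} {f : ℝ → ℝ}
    (h : HasCurveJet γ Φ f) (hγ : ∀ t ∈ Icc (0 : ℝ) 1, γ' t = γ t) : HasCurveJet γ' Φ f := by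
  have h1 : ∀ t ∈ Icc (0 : ℝ) 1, derivWithin γ' (Icc 0 1) t = derivWithin γ (Icc 0 1) t :=
    fun t ht => derivWithin_congr hγ (hγ t ht)
  unfold HasCurveJet
  rw [h1 0 zero_mem01, derivWithin_congr h1 (h1 0 zero_mem01)]
  exact h

theorem Admissible.vertex_trace (h : M.Admissible P) {V : M.Vertex} (q : C2Index) {k : Fin K}
    {s : Edge} {e : Bool} (hV : M.F k (s.frame 0 (mirror e 0)) = V.1) :
    ∃ a, (∀ u, M.localFn P (.vertex V) q k (s.frame 0 (mirror e u)) = lead p (p - 1) n a u) ∧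
      HasCurveJet (fun u => M.F k (s.frame 0 (mirror e u))) (Pi.single q 1) (lead p (p - 1) n a) := by
  rw [← s.pt_corner] at hV
  rw [localFn_vertex q hV]
  obtain ⟨g, hg, hge⟩ := h.exists_cornerFn k (s.corner e) (Pi.single q 1)
  rcases s.frame_mirror e with hf | hf
  · obtain ⟨a, ha⟩ := hg.axis_fst
    have hj := hg.jet.jet1_fst
    simp only [ha] at hj
    refine ⟨a, fun u => by rw [hf, hge, flip_flip, ha], ?_⟩
    simp only [hf]
    exact hj
  · obtain ⟨a, ha⟩ := hg.axis_snd
    have hj := hg.jet.jet1_snd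
    simp only [ha] at hj
    refine ⟨a, fun u => by rw [hf, hge, flip_flip, ha], ?_⟩
    simp only [hf]
    exact hj

theorem Admissible.vertex_trace_zero (h : M.Admissible P) {V : M.Vertex} (q : C2Index) {k : Fin K}
    {s : Edge} (hV : ∀ e, M.F k (s.frame 0 (mirror e 0)) ≠ V.1) {t : ℝ} (ht : t ∈ Icc (0 : ℝ) 1) :
    M.localFn P (.vertex V) q k (s.frame 0 t) = 0 := by
  by_cases hk : M.HasVertex k V.1
  · obtain ⟨c, hc⟩ := hk
    rw [localFn_vertex q hc]
    obtain ⟨g, hg, hge⟩ := h.exists_cornerFn k c (Pi.single q 1)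
    obtain ⟨u, hu, hs | hs⟩ := s.frame_of_ne_corner (c := c) (fun e he => hV e (by
      rw [← s.pt_corner, he, hc])) ht
    · rw [hs, hge, flip_flip, hg.far_fst u hu]
    · rw [hs, hge, flip_flip, hg.far_snd u hu]
  · rw [localFn_vertex_of_not q hk]; rfl

/-- Vertices are covered by `localFn_jet`. Along a shared edge, vertex functions agree by uniqueness
of `lead` combinations with a given jet, interface functions agree on their own edge by the choice
of traces, and all remaining traces are 0. -/
theorem Admissible.localFn_compatible (h : M.Admissible P) (c : M.Comp) (j : M.LocalIdx c) :
    ∀ k l, ∀ x ∈ square, ∀ y ∈ square, M.F k x = M.F l y →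
      M.localFn P c j k x = M.localFn P c j l y := by
  refine compatible_of_edges _ (fun k l a b hab => ?_) (fun k l s s' e hkl hss he t ht => ?_)
  · obtain ⟨_, _, h1⟩ := h.localFn_jet c j k a
    obtain ⟨_, _, h2⟩ := h.localFn_jet c j l b
    have e1 := h1.val
    have e2 := h2.val
    rw [hab] at e1
    simp only [flip_zero] at e1 e2
    rw [e1, e2]
    rfl
  by_cases hc : ∃ V, c = .vertex V
  · obtain ⟨V, rfl⟩ := hc
    by_cases hV : ∃ e', M.F k (s.frame 0 (mirror e' 0)) = V.1
    · obtain ⟨e', hV⟩ := hV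
      have he' : ∀ u ∈ Icc (0 : ℝ) 1, M.F k (s.frame 0 (mirror e' u))
          = M.F l (s'.frame 0 (mirror (xor e e') u)) := fun u hu => by
        rw [he _ (mirror_mem hu), mirror_comp]
      obtain ⟨a, ha, ja⟩ := h.vertex_trace j hV
      obtain ⟨b, hb, jb⟩ := h.vertex_trace j ((he' 0 zero_mem01).symm.trans hV)
      -- Both traces are expressed in the parameter measured from the vertex, where their jets can
      -- be compared.
      rw [show t = mirror e' (mirror e' t) by rw [mirror_mirror], mirror_comp e e', ha, hb]
      exact lead_eq_of_hasJet1 (Nat.sub_lt (by have := h.two_le; omega) one_pos) h.one_le h.two_le ja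
        (jb.congr he') _
    · have hV' : ∀ e', M.F k (s.frame 0 (mirror e' 0)) ≠ V.1 := fun e' h' => hV ⟨e', h'⟩
      rw [h.vertex_trace_zero j hV' ht, h.vertex_trace_zero j (fun e' h' => ?_) (mirror_mem ht)]
      refine hV' (xor e e') ?_
      rw [he _ (mirror_mem zero_mem01), mirror_comp, ← Bool.xor_assoc, Bool.xor_self, Bool.false_xor]
      exact h'
  have hc' : ∀ V, c ≠ .vertex V := fun V hV => hc ⟨V, hV⟩
  by_cases hk : (k, s) ∈ compEdges c
  · cases c with
    | interior k₀ => exact absurd hk (notMem_empty _)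
    | vertex V => exact absurd rfl (hc' V)
    | boundary σ =>
      have hk' : (k, s) = σ.1 := hk
      refine absurd hss.symm (by
        have := not_shared σ (l := l) (s' := s') (by rw [← hk']; exact hkl.symm)
        rwa [← hk'] at this)
    | interface κ =>
      have lt := κ.2.1
      have hκ := κ.2.2
      obtain ⟨e', ht', hF⟩ := M.transition_eq κ
      have tr : ∀ bp bm : ℝ → ℝ, ∀ k s t, M.edgeFn P k s bp bm (s.frame 0 t) = bp t :=
        fun bp bm k s t => h.edgeFn_trace k s bp bm t
      rcases hk with hk | hk
      · have hl : (l, s') = κ.1.2 := by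
          rw [← hk] at lt hκ
          exact partner_unique (k := k) (s := s) hkl.symm lt.ne' hss.symm hκ.symm
        simp only [localFn]
        rw [if_pos (congrArg Prod.fst hk),
          if_neg (by rw [show l = κ.1.2.1 from congrArg Prod.fst hl]; exact lt.ne'),
          if_pos (congrArg Prod.fst hl)]
        obtain rfl : s = κ.1.1.2 := congrArg Prod.snd hk
        obtain rfl : s' = κ.1.2.2 := congrArg Prod.snd hl
        obtain rfl : k = κ.1.1.1 := congrArg Prod.fst hk
        obtain rfl : l = κ.1.2.1 := congrArg Prod.fst hl
        rw [tr, tr, ht']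
        have : mirror e t = mirror e' t := frame_param_injective (mirror_mem ht) (mirror_mem ht)
          ((he t ht).symm.trans (hF t ht))
        rw [this, mirror_mirror]
      -- Here `k` is the second patch of the interface, so the transition is used backwards; a
      -- mirror is its own inverse.
      · have hl : (l, s') = κ.1.1 := by
          rw [← hk] at lt hκ
          exact partner_unique (k := k) (s := s) hkl.symm lt.ne hss.symm hκ
        simp only [localFn]
        rw [if_pos (congrArg Prod.fst hl),
          if_neg (by rw [show k = κ.1.2.1 from congrArg Prod.fst hk]; exact lt.ne'),
          if_pos (congrArg Prod.fst hk)]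
        obtain rfl : s = κ.1.2.2 := congrArg Prod.snd hk
        obtain rfl : s' = κ.1.1.2 := congrArg Prod.snd hl
        obtain rfl : k = κ.1.2.1 := congrArg Prod.fst hk
        obtain rfl : l = κ.1.1.1 := congrArg Prod.fst hl
        rw [tr, tr, ht']
        have := he t ht
        rw [hF _ (mirror_mem ht), mirror_comp] at this
        have := frame_param_injective ht (mirror_mem ht) this
        rw [← mirror_comp] at this
        conv_lhs => rw [this, mirror_mirror]
  · rw [(h.localFn_edge c hc' j hk t).2, (h.localFn_edge c hc' j (s := s') (fun hl => hk ?_) _).2]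
    have lt := hkl
    cases c with
    | interior k₀ => exact absurd hl (notMem_empty _)
    | vertex V => exact absurd rfl (hc' V)
    | boundary σ =>
      have hl' : (l, s') = σ.1 := hl
      refine absurd hss (by
        have := not_shared σ (l := k) (s' := s) (by rw [← hl']; exact hkl)
        rwa [← hl'] at this)
    | interface κ =>
      have lt := κ.2.1
      have hκ := κ.2.2
      rcases hl with hl | hl
      · rw [← hl] at lt hκ
        exact Or.inr (partner_unique (k := l) (s := s') hkl lt.ne' hss hκ.symm)
      · have hl : (l, s') = κ.1.2 := hl
        rw [← hl] at lt hκ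
        exact Or.inl (partner_unique (k := l) (s := s') hkl lt.ne hss hκ)

theorem Admissible.exists_coupled (h : M.Admissible P) (c : M.Comp) (j : M.LocalIdx c) :
    ∃ φ : M.C0, ∀ k, M.PullsTo k φ (M.localFn P c j k) :=
  exists_glue h.r_lt h.one_le _ (h.localFn_cont c j) (h.localFn_compatible c j)

/-- The coupled functions. -/
def Admissible.coupled (h : M.Admissible P) (q : Σ c, M.LocalIdx c) : M.C0 :=
  (h.exists_coupled q.1 q.2).choose

theorem Admissible.pull_coupled (h : M.Admissible P) (c : M.Comp) (j : M.LocalIdx c) (k : Fin K) :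
    M.PullsTo k (h.coupled ⟨c, j⟩) (M.localFn P c j k) := (h.exists_coupled c j).choose_spec k

theorem Admissible.isCoupled (h : M.Admissible P) (c : M.Comp) (j : M.LocalIdx c) :
    M.IsCoupled P c j (h.coupled ⟨c, j⟩) := by
  have hp := h.pull_coupled c j
  cases c with
  | interior k₀ =>
    simp only [localFn] at hp
    refine ⟨?_, fun l hl => ?_⟩
    · simpa only [if_true] using hp k₀
    · have := hp l
      rw [if_neg hl] at this
      exact this
  | interface κ =>
    simp only [localFn] at hp
    refine ⟨?_, ?_, fun m hm hm' => ?_⟩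
    · simpa only [if_true] using hp κ.1.1.1
    · have := hp κ.1.2.1
      rw [if_neg κ.2.1.ne', if_pos rfl] at this
      exact this
    · have := hp m
      rw [if_neg hm, if_neg hm'] at this
      exact this
  | vertex V =>
    refine ⟨fun k c hc => ?_, fun l hl => ?_⟩
    · have := hp k
      rwa [localFn_vertex j hc] at this
    · have := hp l
      rw [localFn_vertex_of_not j hl] at this
      exact this
  | boundary σ =>
    simp only [localFn] at hp
    refine ⟨?_, fun l hl => ?_⟩
    · simpa only [if_true] using hp σ.1.1
    · have := hp l
      rw [if_neg hl] at this
      exact this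

end MultiPatch
end ApproxC1
end

noncomputable section
namespace ApproxC1

/-! ## Linear independence -/

theorem linearIndependent_bspline_family {p r n : ℕ} (hrp : r < p) (hn : 1 ≤ n) {ι : Type*}
    [Fintype ι] {e : ι → ℕ} (he : Function.Injective e) (hN : ∀ i, e i < splineDim p r n)
    {a : ι → ℝ} (h : ∀ x ∈ Icc (0 : ℝ) 1, ∑ i, a i * bspline p r n (e i) x = 0) (i : ι) :
    a i = 0 := by
  have := linearIndependent_bspline hrp hn (Function.extend e a 0) (fun x hx => ?_) (e i) (hN i)
  · rwa [he.extend_apply] at this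
  rw [← h x hx]
  refine (Finset.sum_of_injOn e he.injOn (fun i _ => Finset.mem_coe.2 (Finset.mem_range.2 (hN i)))
    (fun m _ hm => ?_) fun i _ => by rw [he.extend_apply]).symm
  rw [Function.extend_apply' _ _ _ fun ⟨i, hi⟩ => hm ⟨i, Finset.mem_coe.2 (Finset.mem_univ i), hi⟩,
    Pi.zero_apply, zero_mul]

/-- Univariate independence is applied first in u for fixed v, then in v to the resulting
coefficients. -/
theorem linearIndependent_tensorBspline_family {p r n : ℕ} (hrp : r < p) (hn : 1 ≤ n) {ι : Type*}
    [Fintype ι] {e : ι → ℕ × ℕ} (he : Function.Injective e)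
    (hN : ∀ i, (e i).1 < splineDim p r n ∧ (e i).2 < splineDim p r n) {a : ι → ℝ}
    (h : ∀ x ∈ square, ∑ i, a i * tensorBspline p r n (e i).1 (e i).2 x = 0) (i : ι) :
    a i = 0 := by
  have key : ∀ v ∈ Icc (0 : ℝ) 1, ∀ m < splineDim p r n, ∑ m' ∈ Finset.range (splineDim p r n),
      Function.extend e a 0 (m, m') * bspline p r n m' v = 0 := by
    intro v hv
    refine linearIndependent_bspline hrp hn _ fun u hu => ?_
    rw [← h (u, v) ⟨hu, hv⟩]
    simp only [Finset.sum_mul]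
    rw [← Finset.sum_product']
    refine (Finset.sum_of_injOn e he.injOn (fun i _ => Finset.mem_coe.2 (Finset.mem_product.2
      ⟨Finset.mem_range.2 (hN i).1, Finset.mem_range.2 (hN i).2⟩))
      (fun m _ hm => ?_) fun i _ => ?_).symm
    · rw [Prod.mk.eta, Function.extend_apply' _ _ _
        fun ⟨i, hi⟩ => hm ⟨i, Finset.mem_coe.2 (Finset.mem_univ i), hi⟩]
      simp
    · rw [Prod.mk.eta, he.extend_apply, tensorBspline]; ring
  have := linearIndependent_bspline hrp hn (fun m' => Function.extend e a 0 ((e i).1, m'))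
    (fun v hv => key v hv _ (hN i).1) _ (hN i).2
  rwa [Prod.mk.eta, he.extend_apply] at this

instance : Finite Edge :=
  Finite.of_surjective (fun i : Fin 4 => match i with
    | 0 => Edge.bottom
    | 1 => Edge.right
    | 2 => Edge.top
    | 3 => Edge.left) fun s => by
      cases s
      exacts [⟨0, rfl⟩, ⟨1, rfl⟩, ⟨2, rfl⟩, ⟨3, rfl⟩]

instance (a N : ℕ) : Fintype {j : ℕ // a ≤ j ∧ j + a < N} :=
  ((finite_Iio N).subset fun _ h => lt_of_le_of_lt (Nat.le_add_right _ _) h.2).fintype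

instance (p r n : ℕ) : Fintype (InteriorIdx p r n) :=
  (((finite_Iio (splineDim p r n)).prod (finite_Iio (splineDim p r n))).subset
    fun _ h => ⟨lt_of_le_of_lt (Nat.le_add_right _ _) h.1.2,
      lt_of_le_of_lt (Nat.le_add_right _ _) h.2.2⟩).fintype

namespace MultiPatch

variable {p r n K : ℕ} {M : MultiPatch p r n K} {P : (ℝ → ℝ) → ℝ → ℝ}

instance : Finite M.Vertex :=
  Finite.of_surjective (fun q : Fin K × Corner => ⟨M.F q.1 q.2.pt, q.1, q.2, rfl⟩)
    fun ⟨_, k, c, h⟩ => ⟨(k, c), Subtype.ext h⟩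

instance : Finite M.Comp :=
  Finite.of_surjective (fun q : (Fin K ⊕ M.Interface) ⊕ (M.Vertex ⊕ M.BoundaryEdge) => match q with
    | .inl (.inl k) => Comp.interior k
    | .inl (.inr κ) => Comp.interface κ
    | .inr (.inl V) => Comp.vertex V
    | .inr (.inr σ) => Comp.boundary σ) fun c => by
      rcases c with k | κ | V | σ
      exacts [⟨.inl (.inl k), rfl⟩, ⟨.inl (.inr κ), rfl⟩, ⟨.inr (.inl V), rfl⟩, ⟨.inr (.inr σ), rfl⟩]

instance : Fintype M.Comp := Fintype.ofFinite _

instance : (c : M.Comp) → Fintype (M.LocalIdx c)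
  | .interior _ => inferInstanceAs (Fintype (InteriorIdx p r n))
  | .interface _ => inferInstanceAs (Fintype (EdgeIdx p n))
  | .vertex _ => inferInstanceAs (Fintype C2Index)
  | .boundary _ => inferInstanceAs (Fintype (EdgeIdx p n))

theorem cornerMap_det (M : MultiPatch p r n K) (k : Fin K) (c : Corner) :
    det2 (dU (M.cornerMap k c) (0, 0)) (dV (M.cornerMap k c) (0, 0)) ≠ 0 := by
  obtain ⟨a, ha, h⟩ := M.regular k
  have := h c.pt c.pt_mem
  rw [dU_flip, dV_flip]
  simp only [flip_zero]
  have e : det2 (sgn c.1 • dU (M.F k) c.pt) (sgn c.2 • dV (M.F k) c.pt) =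
      (sgn c.1 * sgn c.2) * det2 (dU (M.F k) c.pt) (dV (M.F k) c.pt) := by
    simp [det2]; ring
  rw [e]
  have hs : ∀ e, sgn e ≠ 0 := fun e => by cases e <;> simp [sgn]
  exact mul_ne_zero (mul_ne_zero (hs _) (hs _)) (by linarith)

/-- Edge functions with vanishing trace and slope have vanishing coefficients. -/
theorem Admissible.edge_coeff_eq_zero (h : M.Admissible P) (k : Fin K) (s : Edge)
    {a : EdgeIdx p n → ℝ} (ht : ∀ t ∈ Icc (0 : ℝ) 1, ∑ j, a j * j.plus t = 0)
    (hs : ∀ t ∈ Icc (0 : ℝ) 1, ∑ j, a j * M.edgeSlope P k s j.plus j.minus t = 0) (j : EdgeIdx p n) :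
    a j = 0 := by
  have h2 := h.two_le
  have hl : ∀ j, a (.inl j) = 0 := by
    refine linearIndependent_bspline_family (p := p) (r := p - 1) (n := n) (by omega) h.one_le
      Subtype.val_injective (fun i => by omega) fun t ht' => ?_
    rw [← ht t ht', Fintype.sum_sum_type]
    simp [EdgeIdx.plus]
  have hr : ∀ j, a (.inr j) = 0 := by
    refine linearIndependent_bspline_family (p := p - 1) (r := p - 2) (n := n) (by omega) h.one_le
      Subtype.val_injective (fun i => by omega) fun t ht' => ?_
    -- Once the trace coefficients are 0, the β̃ part is gone and the slope is α̃ times the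
    -- combination of the b⁻.
    refine (mul_eq_zero.1 ((hs t ht').symm.trans ?_).symm).resolve_left (h.alpha_ne k s t ht')
    rw [Fintype.sum_sum_type, Finset.mul_sum]
    simp only [hl, zero_mul, Finset.sum_const_zero, zero_add]
    refine Finset.sum_congr rfl fun i _ => ?_
    simp only [slope, EdgeIdx.plus, EdgeIdx.minus]
    simp
    ring
  cases j
  exacts [hl _, hr _]

section Coefficients

variable {l : (Σ c, M.LocalIdx c) → ℝ}

theorem compData_self (V : M.Vertex) (q : C2Index) :
    M.compData (.vertex V) q V.1 q = 1 := by
  simp [compData]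

theorem compData_of_ne {V : M.Vertex} {q : C2Index} {c : M.Comp} {j : M.LocalIdx c}
    (hq : (⟨c, j⟩ : Σ c, M.LocalIdx c) ≠ ⟨.vertex V, q⟩) : M.compData c j V.1 q = 0 := by
  rcases c with k | κ | W | σ
  · rfl
  · rfl
  · simp only [compData]
    split_ifs with hW
    · obtain rfl : V = W := Subtype.ext hW
      exact Pi.single_eq_of_ne (fun h' => hq (by subst h'; rfl)) _
    · rfl
  · rfl

/-- On any patch at V the two-jet of the vanishing sum is the pull-back of its C²-data, which are
therefore 0; the component q of these data at V is the coefficient itself. -/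
theorem Admissible.coeff_vertex (h : M.Admissible P)
    (hl : ∀ k, ∀ x ∈ square, ∑ q, l q * M.localFn P q.1 q.2 k x = 0) (V : M.Vertex) (q : C2Index) :
    l ⟨.vertex V, q⟩ = 0 := by
  obtain ⟨k, d, hV⟩ := V.2
  have hj := HasJet2.sum Finset.univ fun (q : Σ c, M.LocalIdx c) _ =>
    (h.localFn_jet q.1 q.2 k d).smul (l q)
  have h0 := (hj.congr (g' := 0) fun x hx => by
    have := hl k (flip d x) (flip_mem hx)
    simpa using this.symm).unique hasJet2_zero
  simp only [← map_smul] at h0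
  rw [← map_sum, ← map_zero (pullJet (M.cornerMap k d))] at h0
  have h1 := congrFun (pullJet_injective (M.cornerMap_det k d) h0) q
  rw [Finset.sum_apply, Finset.sum_eq_single ⟨.vertex V, q⟩ (fun q' _ hq' => ?_)
    fun hn => absurd (Finset.mem_univ _) hn] at h1
  · rw [hV] at h1
    simpa [compData_self] using h1
  · rw [hV, Pi.smul_apply, compData_of_ne hq', smul_zero]

/-- With the vertex coefficients gone, every other component has zero trace and derivative on this
edge, so the sum over the component owning the edge must vanish there by itself. -/
theorem Admissible.coeff_edge (h : M.Admissible P)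
    (hl : ∀ k, ∀ x ∈ square, ∑ q, l q * M.localFn P q.1 q.2 k x = 0) {c : M.Comp} {k : Fin K}
    {s : Edge} (hc : (k, s) ∈ compEdges c) {t : ℝ} (ht : t ∈ Icc (0 : ℝ) 1) :
    ∑ j, l ⟨c, j⟩ * M.localFn P c j k (s.frame 0 t) = 0 ∧
      HasDerivWithinAt (fun d => ∑ j, l ⟨c, j⟩ * M.localFn P c j k (s.frame d t)) 0 (Icc 0 1) 0 := by
  classical
  have hz : ∀ c' ∈ Finset.univ.erase c, ∀ j, l ⟨c', j⟩ * M.localFn P c' j k (s.frame 0 t) = 0 ∧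
      HasDerivWithinAt (fun d => l ⟨c', j⟩ * M.localFn P c' j k (s.frame d t)) 0 (Icc 0 1) 0 := by
    intro c' hc' j
    by_cases hV : ∃ V, c' = .vertex V
    · obtain ⟨V, rfl⟩ := hV
      simp only [h.coeff_vertex hl V j, zero_mul, true_and]
      exact hasDerivWithinAt_const ..
    · obtain ⟨h1, h2⟩ := h.localFn_edge c' (fun V e => hV ⟨V, e⟩) j (k := k) (s := s)
        (fun h' => (Finset.mem_erase.1 hc').1 (compEdges_unique h' hc)) t
      refine ⟨by rw [h2, mul_zero], ?_⟩
      simpa using h1.const_mul (l ⟨c', j⟩)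
  have hd : ∀ d ∈ Icc (0 : ℝ) 1, ∑ j, l ⟨c, j⟩ * M.localFn P c j k (s.frame d t) =
      -∑ c' ∈ Finset.univ.erase c, ∑ j, l ⟨c', j⟩ * M.localFn P c' j k (s.frame d t) := by
    intro d hd
    have := hl k _ (s.frame_mem hd ht)
    rw [Fintype.sum_sigma, ← Finset.add_sum_erase _ _ (Finset.mem_univ c)] at this
    exact eq_neg_of_add_eq_zero_left this
  constructor
  · rw [hd 0 zero_mem01, Finset.sum_eq_zero fun c' hc' => Finset.sum_eq_zero fun j _ => (hz c' hc' j).1,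
      neg_zero]
  · have := (HasDerivWithinAt.fun_sum fun c' hc' => HasDerivWithinAt.fun_sum
      fun (j : M.LocalIdx c') (_ : j ∈ Finset.univ) => (hz c' hc' j).2).neg
    simp only [Finset.sum_const_zero, neg_zero] at this
    exact this.congr hd (hd 0 zero_mem01)

theorem Admissible.coeff_edge_eq_zero (h : M.Admissible P) (k : Fin K) (s : Edge)
    {a : EdgeIdx p n → ℝ} (ha : ∀ t ∈ Icc (0 : ℝ) 1,
      ∑ j, a j * M.edgeFn P k s j.plus j.minus (s.frame 0 t) = 0 ∧
      HasDerivWithinAt (fun d => ∑ j, a j * M.edgeFn P k s j.plus j.minus (s.frame d t)) 0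
        (Icc 0 1) 0) (j : EdgeIdx p n) : a j = 0 := by
  refine h.edge_coeff_eq_zero k s (fun t ht => ?_) (fun t ht => ?_) j
  · simpa only [h.edgeFn_trace] using (ha t ht).1
  · have := HasDerivWithinAt.fun_sum fun (j : EdgeIdx p n) (_ : j ∈ Finset.univ) =>
      (h.edgeFn_trans k s j.plus j.minus t).const_mul (a j)
    exact (uniqueDiff01 zero_mem01).eq_deriv _ this (ha t ht).2

theorem Admissible.linearIndependent_coupled (h : M.Admissible P) :
    LinearIndependent ℝ h.coupled := by
  rw [Fintype.linearIndependent_iff]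
  intro l hl
  replace hl : ∀ k, ∀ x ∈ square, ∑ q, l q * M.localFn P q.1 q.2 k x = 0 := by
    intro k x hx
    have := pull_sum Finset.univ k l h.coupled x
    rw [hl] at this
    refine Eq.trans ?_ (this.symm.trans (congrFun (map_zero (M.pullL k)) x))
    exact Finset.sum_congr rfl fun q _ => by rw [← h.pull_coupled q.1 q.2 k x hx]
  have hV := fun V q => h.coeff_vertex hl V q
  have hI : ∀ κ (j : EdgeIdx p n), l ⟨.interface κ, j⟩ = 0 := fun κ =>
    h.coeff_edge_eq_zero κ.1.1.1 κ.1.1.2 (a := fun j : EdgeIdx p n => l ⟨.interface κ, j⟩) fun t ht => by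
      have := h.coeff_edge hl (c := .interface κ) (k := κ.1.1.1) (s := κ.1.1.2) (Or.inl rfl) ht
      simp only [localFn, if_true] at this
      exact this
  have hB : ∀ σ (j : EdgeIdx p n), l ⟨.boundary σ, j⟩ = 0 := fun σ =>
    h.coeff_edge_eq_zero σ.1.1 σ.1.2 (a := fun j : EdgeIdx p n => l ⟨.boundary σ, j⟩) fun t ht => by
      have := h.coeff_edge hl (c := .boundary σ) (k := σ.1.1) (s := σ.1.2) rfl ht
      simp only [localFn, if_true] at this
      exact this
  rintro ⟨k | κ | V | σ, j⟩
  · refine linearIndependent_tensorBspline_family h.r_lt h.one_le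
      (a := fun j : InteriorIdx p r n => l ⟨.interior k, j⟩)
      Subtype.val_injective (fun i => ⟨by omega, by omega⟩) (fun x hx => ?_) j
    rw [← hl k x hx, Fintype.sum_sigma]
    refine ((Fintype.sum_eq_single (Comp.interior k) fun c hc => ?_).trans ?_).symm
    · refine Finset.sum_eq_zero fun j _ => ?_
      rcases c with k' | κ | V | σ
      · simp only [localFn]
        rw [if_neg fun h' => hc (by rw [h']), Pi.zero_apply, mul_zero]
      · exact mul_eq_zero_of_left (hI κ j) _
      · exact mul_eq_zero_of_left (hV V j) _
      · exact mul_eq_zero_of_left (hB σ j) _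
    · simp only [localFn, if_true]
      rfl
  · exact hI κ j
  · exact hV V j
  · exact hB σ j

end Coefficients

end MultiPatch
end ApproxC1
end

noncomputable section
namespace ApproxC1
namespace MultiPatch

variable {p r n K : ℕ} {M : MultiPatch p r n K} {P : (ℝ → ℝ) → ℝ → ℝ}

/-! ## The subspaces -/

theorem edgeFn_congr (k : Fin K) (s : Edge) {bp bm bp' bm' : ℝ → ℝ}
    (hp : ∀ t ∈ Icc (0 : ℝ) 1, bp t = bp' t) (hm : ∀ t ∈ Icc (0 : ℝ) 1, bm t = bm' t) {x : ℝ × ℝ}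
    (hx : x ∈ square) : M.edgeFn P k s bp bm x = M.edgeFn P k s bp' bm' x := by
  have ht := s.param_mem hx
  simp only [edgeFn]
  rw [hp _ ht, hm _ ht, derivWithin_congr hp (hp _ ht)]

theorem sum_edgeFn (hn : 1 ≤ n) (k : Fin K) (s : Edge) {ι : Type*} (S : Finset ι) (a : ι → ℝ)
    {bp bm : ι → ℝ → ℝ} (hb : ∀ i, EdgePair n (bp i) (bm i)) {x : ℝ × ℝ} (hx : x ∈ square) :
    ∑ i ∈ S, a i * M.edgeFn P k s (bp i) (bm i) x =
      M.edgeFn P k s (fun t => ∑ i ∈ S, a i * bp i t) (fun t => ∑ i ∈ S, a i * bm i t) x := by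
  have hd := HasDerivWithinAt.fun_sum fun i (_ : i ∈ S) =>
    (((hb i).plus_isPP1.differentiableOn hn _ (s.param_mem hx)).hasDerivWithinAt).const_mul (a i)
  simp only [edgeFn]
  rw [hd.derivWithin (uniqueDiff01 (s.param_mem hx))]
  simp only [Finset.sum_mul, Finset.mul_sum, ← Finset.sum_add_distrib]
  exact Finset.sum_congr rfl fun i _ => by ring

/-- The tangential part of the approximate normal cancels β̃ (b⁺)' in the slope, and division by α̃
leaves -b⁻. This is what the edge functions are designed for. -/
theorem Admissible.approxNormalDeriv_eq (h : M.Admissible P) {k : Fin K} {s : Edge} {φ : M.C0}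
    {bp bm : ℝ → ℝ} (hφ : M.PullsTo k φ (M.edgeFn P k s bp bm)) {t : ℝ} (ht : t ∈ Icc (0 : ℝ) 1) :
    M.approxNormalDeriv P k s φ t = -bm t := by
  have h1 : dTrans s (M.pull k φ) t = M.edgeSlope P k s bp bm t :=
    ((h.edgeFn_trans k s bp bm t).congr (fun d hd => hφ _ (s.frame_mem hd ht))
      (hφ _ (s.frame_mem zero_mem01 ht))).derivWithin (uniqueDiff01 zero_mem01)
  have e : ∀ τ ∈ Icc (0 : ℝ) 1, M.pull k φ (s.frame 0 τ) = bp τ := fun τ hτ => by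
    rw [hφ _ (s.frame_mem zero_mem01 hτ), h.edgeFn_trace]
  have h2 : dTang s (M.pull k φ) t = derivWithin bp (Icc 0 1) t := derivWithin_congr e (e t ht)
  have hA := h.alpha_ne k s t ht
  rw [approxNormalDeriv, h1, h2, edgeSlope, slope]
  field_simp
  ring

/-- The span of the coupled functions of a component. -/
abbrev Admissible.compSpan (h : M.Admissible P) (c : M.Comp) : Submodule ℝ M.C0 :=
  Submodule.span ℝ (range fun j : M.LocalIdx c => h.coupled ⟨c, j⟩)

theorem Admissible.mem_compSpan_iff (h : M.Admissible P) (c : M.Comp) {φ : M.C0} :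
    φ ∈ h.compSpan c ↔
      ∃ a : M.LocalIdx c → ℝ, ∀ k, M.PullsTo k φ fun x => ∑ j, a j * M.localFn P c j k x := by
  have hs : ∀ (a : M.LocalIdx c → ℝ) k, M.PullsTo k (∑ j, a j • h.coupled ⟨c, j⟩)
      fun x => ∑ j, a j * M.localFn P c j k x := fun a k x hx => by
    rw [pull_sum]
    exact Finset.sum_congr rfl fun j _ => by rw [h.pull_coupled c j k x hx]
  rw [Submodule.mem_span_range_iff_exists_fun]
  refine exists_congr fun a => ⟨fun e k => e ▸ hs a k, fun e => ?_⟩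
  exact ext_of_pull fun k x hx => (hs a k x hx).trans (e k x hx).symm

theorem localFn_interior_self (k : Fin K) (q : InteriorIdx p r n) :
    M.localFn P (.interior k) q k = tensorBspline p r n q.1.1 q.1.2 := if_pos rfl

theorem localFn_interior_of_ne {k l : Fin K} (hl : l ≠ k) (q : InteriorIdx p r n) :
    M.localFn P (.interior k) q l = 0 := if_neg hl

theorem localFn_boundary_self (σ : M.BoundaryEdge) (j : EdgeIdx p n) :
    M.localFn P (.boundary σ) j σ.1.1 = M.edgeFn P σ.1.1 σ.1.2 j.plus j.minus := if_pos rfl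

theorem localFn_boundary_of_ne {σ : M.BoundaryEdge} {l : Fin K} (hl : l ≠ σ.1.1) (j : EdgeIdx p n) :
    M.localFn P (.boundary σ) j l = 0 := if_neg hl

theorem localFn_interface_fst (κ : M.Interface) (j : EdgeIdx p n) :
    M.localFn P (.interface κ) j κ.1.1.1 = M.edgeFn P κ.1.1.1 κ.1.1.2 j.plus j.minus := if_pos rfl

theorem localFn_interface_snd (κ : M.Interface) (j : EdgeIdx p n) :
    M.localFn P (.interface κ) j κ.1.2.1 = M.edgeFn P κ.1.2.1 κ.1.2.2
      (fun t => j.plus (M.transition κ t)) (fun t => -j.minus (M.transition κ t)) :=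
  (if_neg κ.2.1.ne').trans (if_pos rfl)

theorem localFn_interface_of_ne {κ : M.Interface} {l : Fin K} (hl : l ≠ κ.1.1.1) (hl' : l ≠ κ.1.2.1)
    (j : EdgeIdx p n) : M.localFn P (.interface κ) j l = 0 := (if_neg hl).trans (if_neg hl')

theorem sum_localFn (M : MultiPatch p r n K) (c : M.Comp) {k : Fin K} {f : M.LocalIdx c → ℝ × ℝ → ℝ}
    (hf : ∀ j, M.localFn P c j k = f j) (a : M.LocalIdx c → ℝ) (x : ℝ × ℝ) :
    ∑ j, a j * M.localFn P c j k x = ∑ j, a j * f j x :=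
  Finset.sum_congr rfl fun j _ => by rw [hf]

theorem sum_localFn_zero (M : MultiPatch p r n K) (c : M.Comp) {k : Fin K} (hf : ∀ j, M.localFn P c j k = 0)
    (a : M.LocalIdx c → ℝ) (x : ℝ × ℝ) : ∑ j, a j * M.localFn P c j k x = 0 :=
  Finset.sum_eq_zero fun j _ => by rw [hf, Pi.zero_apply, mul_zero]

theorem mem_span_range_iff {ι : Type*} [Fintype ι] {f : ι → ℝ × ℝ → ℝ} {g : ℝ × ℝ → ℝ} :
    g ∈ Submodule.span ℝ (range f) ↔ ∃ a : ι → ℝ, g = fun x => ∑ i, a i * f i x := by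
  rw [Submodule.mem_span_range_iff_exists_fun]
  refine exists_congr fun a => ⟨fun e => ?_, fun e => ?_⟩
  · rw [← e]; funext x; simp only [Finset.sum_apply, Pi.smul_apply, smul_eq_mul]
  · rw [e]; funext x; simp only [Finset.sum_apply, Pi.smul_apply, smul_eq_mul]

theorem Admissible.mem_component_interior (h : M.Admissible P) (k : Fin K) (φ : M.C0) :
    φ ∈ M.component P (.interior k) ↔ φ ∈ h.compSpan (.interior k) := by
  rw [h.mem_compSpan_iff]
  constructor
  · rintro ⟨⟨g, hg, hφ⟩, hz⟩
    obtain ⟨a, rfl⟩ := mem_span_range_iff.1 hg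
    refine ⟨a, fun l x hx => ?_⟩
    by_cases hl : l = k
    · subst hl
      exact (hφ x hx).trans (sum_localFn M (.interior l) (localFn_interior_self l) a x).symm
    · exact (hz l hl x hx).trans (sum_localFn_zero M (.interior k) (localFn_interior_of_ne hl) a x).symm
  · rintro ⟨a, ha⟩
    exact ⟨⟨_, mem_span_range_iff.2 ⟨a, rfl⟩, fun x hx =>
      (ha k x hx).trans (sum_localFn M (.interior k) (localFn_interior_self k) a x)⟩, fun l hl x hx =>
      (ha l x hx).trans (sum_localFn_zero M (.interior k) (localFn_interior_of_ne hl) a x)⟩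

theorem Admissible.mem_component_boundary (h : M.Admissible P) (σ : M.BoundaryEdge) (φ : M.C0) :
    φ ∈ M.component P (.boundary σ) ↔ φ ∈ h.compSpan (.boundary σ) := by
  rw [h.mem_compSpan_iff]
  constructor
  · rintro ⟨⟨g, hg, hφ⟩, hz⟩
    obtain ⟨a, rfl⟩ := mem_span_range_iff.1 hg
    refine ⟨a, fun l x hx => ?_⟩
    by_cases hl : l = σ.1.1
    · subst hl
      exact (hφ x hx).trans (sum_localFn M (.boundary σ) (localFn_boundary_self σ) a x).symm
    · exact (hz l hl x hx).trans (sum_localFn_zero M (.boundary σ) (localFn_boundary_of_ne hl) a x).symm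
  · rintro ⟨a, ha⟩
    exact ⟨⟨_, mem_span_range_iff.2 ⟨a, rfl⟩, fun x hx =>
      (ha _ x hx).trans (sum_localFn M (.boundary σ) (localFn_boundary_self σ) a x)⟩, fun l hl x hx =>
      (ha l x hx).trans (sum_localFn_zero M (.boundary σ) (localFn_boundary_of_ne hl) a x)⟩

/-- Reflection permutes the edge indices. The sign in front of b⁻ is harmless, since each index has
either b⁻ = 0 or b⁺ = 0: the function is a generator in the first case and minus a generator in the
second. -/
theorem Admissible.exists_mem_edgeSpace (h : M.Admissible P) (k : Fin K) (s : Edge) (e : Bool)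
    (j : EdgeIdx p n) : ∃ g ∈ M.edgeSpace P k s, ∀ x ∈ square, g x =
      M.edgeFn P k s (fun t => j.plus (mirror e t)) (fun t => -j.minus (mirror e t)) x := by
  obtain ⟨j', hp, hm⟩ : ∃ j' : EdgeIdx p n, (∀ t ∈ Icc (0 : ℝ) 1, j.plus (mirror e t) = j'.plus t) ∧
      ∀ t ∈ Icc (0 : ℝ) 1, j.minus (mirror e t) = j'.minus t := by
    cases e
    · exact ⟨j, fun _ _ => rfl, fun _ _ => rfl⟩
    · exact j.reflect h.two_le h.one_le
  have hj : M.edgeFn P k s j'.plus j'.minus ∈ M.edgeSpace P k s := Submodule.subset_span ⟨j', rfl⟩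
  have key : ∀ x ∈ square, M.edgeFn P k s (fun t => j.plus (mirror e t))
      (fun t => -j.minus (mirror e t)) x = M.edgeFn P k s j'.plus (fun t => -j'.minus t) x :=
    fun x hx => edgeFn_congr k s hp (fun t ht => by rw [hm t ht]) hx
  rcases j' with i | i
  · exact ⟨_, hj, fun x hx => by rw [key x hx]; simp [EdgeIdx.minus, edgeFn]⟩
  · refine ⟨_, Submodule.neg_mem _ hj, fun x hx => ?_⟩
    rw [key x hx]
    simp [EdgeIdx.plus, edgeFn]

theorem Admissible.mem_component_interface (h : M.Admissible P) (κ : M.Interface) (φ : M.C0) :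
    φ ∈ M.component P (.interface κ) ↔ φ ∈ h.compSpan (.interface κ) := by
  rw [h.mem_compSpan_iff]
  obtain ⟨e, he, hF⟩ := M.transition_eq κ
  have hn := h.one_le
  have pair := fun j : EdgeIdx p n => j.edgePair h.two_le hn
  have pair' := h.transition_pair κ
  constructor
  · rintro ⟨⟨g, hg, hφ⟩, ⟨g', hg', hφ'⟩, hz, hN⟩
    obtain ⟨a, rfl⟩ := mem_span_range_iff.1 hg
    obtain ⟨b, rfl⟩ := mem_span_range_iff.1 hg'
    have e1 : M.PullsTo κ.1.1.1 φ _ := fun x hx => (hφ x hx).trans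
      (sum_edgeFn hn κ.1.1.1 κ.1.1.2 Finset.univ a pair hx)
    have e2 : M.PullsTo κ.1.2.1 φ _ := fun x hx => (hφ' x hx).trans
      (sum_edgeFn hn κ.1.2.1 κ.1.2.2 Finset.univ b pair hx)
    -- Continuity of φ across the interface identifies the two traces.
    have hp : ∀ t ∈ Icc (0 : ℝ) 1,
        ∑ j, b j * j.plus t = ∑ j : EdgeIdx p n, a j * j.plus (M.transition κ t) := fun t ht => by
      have m1 := κ.1.1.2.frame_mem zero_mem01 (mirror_mem (e := e) ht)
      have m2 := κ.1.2.2.frame_mem zero_mem01 ht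
      have f1 := e1 _ m1
      have f2 := e2 _ m2
      rw [pull_apply _ _ m1, h.edgeFn_trace] at f1
      rw [pull_apply _ _ m2, h.edgeFn_trace] at f2
      rw [he, ← f1, ← f2]
      congr 2
      rw [hF _ (mirror_mem ht), mirror_mirror]
    -- The normal derivative condition identifies the b⁻ parts up to sign; trace and b⁻ part
    -- together determine the second pull-back.
    have hm : ∀ t ∈ Icc (0 : ℝ) 1,
        ∑ j, b j * j.minus t = ∑ j : EdgeIdx p n, a j * -j.minus (M.transition κ t) := fun t ht => by
      have := hN _ (mirror_mem (e := e) ht)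
      rw [h.approxNormalDeriv_eq e1 (mirror_mem ht), he, mirror_mirror,
        h.approxNormalDeriv_eq e2 ht, neg_neg] at this
      simp only [he, mul_neg, Finset.sum_neg_distrib]
      exact this.symm
    refine ⟨a, fun l x hx => ?_⟩
    by_cases hl : l = κ.1.1.1
    · subst hl
      exact (hφ x hx).trans (sum_localFn M (.interface κ) (localFn_interface_fst κ) a x).symm
    by_cases hl' : l = κ.1.2.1
    · subst hl'
      refine Eq.trans ?_ (sum_localFn M (.interface κ) (localFn_interface_snd κ) a x).symm
      exact ((e2 x hx).trans (edgeFn_congr _ _ hp hm hx)).trans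
        (sum_edgeFn hn κ.1.2.1 κ.1.2.2 Finset.univ a pair' hx).symm
    · exact (hz l hl hl' x hx).trans (sum_localFn_zero M (.interface κ) (localFn_interface_of_ne hl hl') a x).symm
  · rintro ⟨(a : EdgeIdx p n → ℝ), ha⟩
    have a1 : M.PullsTo κ.1.1.1 φ fun x => ∑ j : EdgeIdx p n,
        a j * M.edgeFn P κ.1.1.1 κ.1.1.2 j.plus j.minus x := fun x hx =>
      (ha _ x hx).trans (sum_localFn M (.interface κ) (localFn_interface_fst κ) a x)
    have a2 : M.PullsTo κ.1.2.1 φ fun x => ∑ j : EdgeIdx p n,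
        a j * M.edgeFn P κ.1.2.1 κ.1.2.2 (fun t => j.plus (M.transition κ t))
        (fun t => -j.minus (M.transition κ t)) x := fun x hx =>
      (ha _ x hx).trans (sum_localFn M (.interface κ) (localFn_interface_snd κ) a x)
    have e1 : M.PullsTo κ.1.1.1 φ _ := fun x hx => (a1 x hx).trans
      (sum_edgeFn hn κ.1.1.1 κ.1.1.2 Finset.univ a pair hx)
    have e2 : M.PullsTo κ.1.2.1 φ _ := fun x hx => (a2 x hx).trans
      (sum_edgeFn hn κ.1.2.1 κ.1.2.2 Finset.univ a pair' hx)
    refine ⟨⟨_, mem_span_range_iff.2 ⟨a, rfl⟩, a1⟩, ?_, fun m hm hm' x hx =>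
      (ha m x hx).trans (sum_localFn_zero M (.interface κ) (localFn_interface_of_ne hm hm') a x), fun t ht => ?_⟩
    · choose g hg hgx using h.exists_mem_edgeSpace κ.1.2.1 κ.1.2.2 e
      refine ⟨_, Submodule.sum_mem _ fun j (_ : j ∈ Finset.univ) =>
        Submodule.smul_mem _ (a j) (hg j), fun x hx => ?_⟩
      rw [a2 x hx, Finset.sum_apply]
      exact Finset.sum_congr rfl fun j _ => by
        rw [Pi.smul_apply, smul_eq_mul, hgx j x hx]
        simp only [he]
    · have ht' := mirror_mem (e := e) ht
      rw [h.approxNormalDeriv_eq e1 ht, he, h.approxNormalDeriv_eq e2 ht']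
      simp only [he, mirror_mirror, mul_neg, Finset.sum_neg_distrib, neg_neg]

/-- The vertex functions interpolate the unit data, so the coefficient vector is the vector of
C²-data of the combination. -/
theorem Admissible.vertex_sum_jet (h : M.Admissible P) {V : M.Vertex} {k : Fin K} {c : Corner}
    (hc : M.F k c.pt = V.1) {φ : M.C0} {a : C2Index → ℝ}
    (hφ : M.PullsTo k φ fun x => ∑ q, a q * M.vertexFn P k c (Pi.single q 1) x) :
    axisJet (fun x => M.pull k φ (flip c x)) = pullJet (M.cornerMap k c) a := by
  have hcd : ∀ q : C2Index, M.compData (.vertex V) q (M.F k c.pt) = Pi.single q 1 :=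
    fun q => if_pos hc
  have hj := HasJet2.sum Finset.univ fun (q : C2Index) _ =>
    (h.localFn_jet (.vertex V) q k c).smul (a q)
  rw [(hj.congr fun x hx => ?_).axisJet_eq]
  · simp only [← map_smul, hcd]
    rw [← map_sum]
    congr 1
    funext q
    rw [Finset.sum_apply, Finset.sum_eq_single q]
    · simp
    · intro q' _ hq'
      rw [Pi.smul_apply, Pi.single_eq_of_ne hq'.symm, smul_zero]
    · exact fun hq => absurd (Finset.mem_univ q) hq
  · rw [hφ _ (flip_mem hx), Finset.sum_apply]
    exact Finset.sum_congr rfl fun q _ => by rw [Pi.smul_apply, smul_eq_mul, localFn_vertex q hc]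

theorem Admissible.mem_component_vertex (h : M.Admissible P) (V : M.Vertex) (φ : M.C0) :
    φ ∈ M.component P (.vertex V) ↔ φ ∈ h.compSpan (.vertex V) := by
  rw [h.mem_compSpan_iff]
  constructor
  · rintro ⟨hφ, hz, Φ, hΦ⟩
    -- The common C²-data serve as coefficients on every patch; injectivity of `pullJet` forces the
    -- local coefficients to equal them.
    refine ⟨Φ, fun k x hx => ?_⟩
    by_cases hV : M.HasVertex k V.1
    · obtain ⟨c, hc⟩ := hV
      obtain ⟨g, hg, ha⟩ := hφ k c hc
      obtain ⟨a, rfl⟩ := mem_span_range_iff.1 hg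
      have hj := h.vertex_sum_jet hc ha
      rw [(hasC2Data_flip _ _ _ _).1 (hΦ k c hc)] at hj
      obtain rfl := pullJet_injective (M.cornerMap_det k c) hj
      exact (ha x hx).trans (sum_localFn M (.vertex V) (fun q => localFn_vertex q hc) Φ x).symm
    · exact (hz k hV x hx).trans (sum_localFn_zero M (.vertex V) (fun q => localFn_vertex_of_not q hV) Φ x).symm
  · rintro ⟨(a : C2Index → ℝ), ha⟩
    have hv : ∀ k c, M.F k (Corner.pt c) = V.1 →
        M.PullsTo k φ fun x => ∑ q, a q * M.vertexFn P k c (Pi.single q 1) x :=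
      fun k c hc x hx => (ha k x hx).trans (sum_localFn M (.vertex V) (fun q => localFn_vertex q hc) a x)
    exact ⟨fun k c hc => ⟨_, mem_span_range_iff.2 ⟨a, rfl⟩, hv k c hc⟩, fun l hl x hx =>
      (ha l x hx).trans (sum_localFn_zero M (.vertex V) (fun q => localFn_vertex_of_not q hl) a x), a,
      fun k c hc => (hasC2Data_flip _ _ _ _).2 (h.vertex_sum_jet hc (hv k c hc))⟩

/-! ### The direct sum decomposition -/

theorem Admissible.coe_compSpan (h : M.Admissible P) (c : M.Comp) :
    (h.compSpan c : Set M.C0) = M.component P c := by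
  ext φ
  cases c
  exacts [(h.mem_component_interior _ φ).symm, (h.mem_component_interface _ φ).symm,
    (h.mem_component_vertex _ φ).symm, (h.mem_component_boundary _ φ).symm]

theorem Admissible.iSup_compSpan (h : M.Admissible P) : ⨆ c, h.compSpan c = M.approxSpace P := by
  simp only [approxSpace, ← h.coe_compSpan, Submodule.span_iUnion, Submodule.span_eq]

theorem Admissible.span_coupled (h : M.Admissible P) :
    Submodule.span ℝ (range h.coupled) = M.approxSpace P := by
  rw [← h.iSup_compSpan, ← Submodule.span_iUnion]
  congr 1
  ext φ
  simp only [mem_range, mem_iUnion, Sigma.exists]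

/-- Disjoint subsets of a linearly independent family have disjoint spans; here the family is split
by component. -/
theorem Admissible.iSupIndep_compSpan (h : M.Admissible P) : iSupIndep h.compSpan := by
  intro c
  have hd : Disjoint {q : Σ c, M.LocalIdx c | q.1 = c} {q | q.1 ≠ c} :=
    Set.disjoint_left.2 fun q hq hq' => hq' hq
  refine (h.linearIndependent_coupled.disjoint_span_image hd).mono ?_ (iSup₂_le fun c' hc' => ?_)
  · refine Submodule.span_mono ?_
    rintro _ ⟨j, rfl⟩
    exact ⟨_, rfl, rfl⟩
  · refine Submodule.span_mono ?_
    rintro _ ⟨j, rfl⟩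
    exact ⟨_, hc', rfl⟩

end MultiPatch
end ApproxC1
end

/-! ### The lemma on bases and the direct sum -/

theorem mainTheorem2 (p r n p' r' K : ℕ) (hr : 1 ≤ r) (hrp : r < p) (hn : 1 ≤ n)
    (hpn : 6 ≤ p + n) (hr' : r' < p') (M : MultiPatch p r n K)
    (P : (ℝ → ℝ) → ℝ → ℝ) (hP : IsProjectionOnto (splineSpace p' r' n) P)
    (hα : ∀ k s, ¬ M.IsBoundaryEdge k s → ∀ t ∈ Set.Icc (0 : ℝ) 1, M.alphaT P k s t ≠ 0) :
    ∃ (A : M.Comp → Submodule ℝ M.C0)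
      (b : ∀ c, Module.Basis (M.LocalIdx c) ℝ (A c))
      (B : Module.Basis (Σ c, M.LocalIdx c) ℝ (M.approxSpace P)),
      (∀ c, (A c : Set M.C0) = M.component P c) ∧
      iSupIndep A ∧
      (⨆ c, A c) = M.approxSpace P ∧
      (∀ c j, M.IsCoupled P c j (b c j : M.C0)) ∧
      (∀ c j, (B ⟨c, j⟩ : M.C0) = (b c j : M.C0)) := by
  have h := MultiPatch.Admissible.of_projection hr hrp hn hpn hr' hP hα
  have hc : ∀ c, LinearIndependent ℝ fun j : M.LocalIdx c => h.coupled ⟨c, j⟩ := fun c =>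
    h.linearIndependent_coupled.comp (Sigma.mk c) sigma_mk_injective
  refine ⟨h.compSpan, fun c => Module.Basis.span (hc c),
    (Module.Basis.span h.linearIndependent_coupled).map (LinearEquiv.ofEq _ _ h.span_coupled),
    h.coe_compSpan, h.iSupIndep_compSpan, h.iSup_compSpan, fun c j => ?_, fun c j => ?_⟩
  · rw [Module.Basis.span_apply]
    exact h.isCoupled c j
  · rw [Module.Basis.map_apply, LinearEquiv.coe_ofEq_apply, Module.Basis.span_apply,
      Module.Basis.span_apply]
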